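/- Let $0<H_1\le H_2<2$ with $H_1,H_2\neq 1$, let $c>0$, and let $Y=\{Y(t,s);(t,s)\in\mathbb Z^2\}$ be a real stationary Gaussian random field with zero mean and spectral density $f$, that is, $\mathbb E[Y(t,s)Y(0,0)]=\int_{[-\pi,\pi]^2}e^{i(tx+sy)}f(x,y)\,dx\,dy$ with $f\ge 0$ a.e. and integrable on $[-\pi,\pi]^2$, where $$f(x,y)=\frac{g(x,y)}{\big(|x|^2+c|y|^{2H_2/H_1}\big)^{H_1/2}},\qquad (x,y)\in[-\pi,\pi]^2,$$ and $g$ is bounded on $[-\pi,\pi]^2$, continuous at the origin, with $g(0,0)>0$. Put $\gamma_0=H_1/H_2$, $h(u,v)=(|u|^2+c|v|^{2H_2/H_1})^{-H_1/2}$, and for $\gamma>0$ $$H(\gamma)=\begin{cases}(1+\gamma+H_1)/2,&\gamma\ge\gamma_0,\ H_1<1,\\ (\gamma H_1+\gamma H_1H_2-\gamma H_2+2H_1)/(2H_1),&\gamma\ge\gamma_0,\ H_1>1,\\ (1+\gamma+\gamma H_2)/2,&\gamma\le\gamma_0,\ H_2<1,\\ (H_2+H_1H_2-H_1+2\gamma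 H_2)/(2H_2),&\gamma\le\gamma_0,\ H_2>1\end{cases}$$ (the formulas agree at $\gamma=\gamma_0$). Let $W$ and $W_1$ be standard complex-valued Gaussian noises on $\mathbb R^2$ and $\mathbb R$: zero mean, jointly Gaussian (as a family, for each noise), $\mathbb E[W(A)\overline{W(B)}]=|A\cap B|$, $\overline{W(A)}=W(-A)$, and likewise for $W_1$; such noises exist. With $e_x(u)=(1-e^{iux})/(iu)$ define, for $x,y\ge 0$, $$V_\gamma(x,y)=\begin{cases} \int_{\mathbb R^2}e_x(u)e_y(v)\sqrt{h(u,v)}\,W(du,dv),&\gamma=\gamma_0,\\ \int_{\mathbb R^2}e_x(u)e_y(v)|u|^{-H_1/2}\,W(du,dv),&\gamma>\gamma_0,\ H_1<1,\\ x\rho_1c^{(1-H_1)/4}\int_{\mathbb R}e_y(v)|v|^{-(H_1H_2-H_2)/(2H_1)}\,W_1(dv),&\gamma>\gamma_0,\ H_1>1,\\ c^{-H_1/4}\int_{\mathbb R^2}e_x(u)e_y(v)|v|^{-H_2/2}\,W(du,dv),&\gamma<\gamma_0,\ H_2<1,\\ y\rho_2c^{-H_1/(4H_2)}\int_{\mathbb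 R}e_x(u)|u|^{-(H_1H_2-H_1)/(2H_2)}\,W_1(du),&\gamma<\gamma_0,\ H_2>1, \end{cases}$$ where $\rho_1^2=B\big(\tfrac12,\tfrac{H_1-1}2\big)$, $\rho_2^2=\tfrac{H_1}{H_2}B\big(\tfrac{H_1}{2H_2},\tfrac{H_1H_2-H_1}{2H_2}\big)$ and $B$ is the beta function. Then: (a) For every $\gamma>0$ the field $V_\gamma$ is well defined, real and Gaussian, and it is operator scaling: for every $\lambda>0$, $\{V_\gamma(\lambda x,\lambda^\gamma y)\}$ and $\{\lambda^{H(\gamma)}V_\gamma(x,y)\}$, $x,y\ge0$, have the same finite-dimensional distributions. As $n\to\infty$, $$n^{-H(\gamma)}\sum_{1\le t\le nx,\ 1\le s\le n^\gamma y}Y(t,s)\ \longrightarrow\ \sqrt{g(0,0)}\,V_\gamma(x,y),\qquad x,y>0,$$ in the sense of weak convergence of finite-dimensional distributions. (b) If $H_1=H_2$, then $Y$ has Type I isotropic distributional LRD; if $H_1<H_2$, then $Y$ has Type I anisotropic distributional LRD. The notions in (b) are as follows. Let $V$ be a random field on $[0,\infty)^2$ with $V(x,0)=V(0,y)=0$ a.s.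 For a rectangle $K=(u,x]\times(v,y]\subset(0,\infty)^2$ put $V(K)=V(x,y)-V(u,y)-V(x,v)+V(u,v)$. $V$ has stationary rectangular increments if for all $u,v\ge 0$ the families $\{V((u,x]\times(v,y])\}_{x\ge u,y\ge v}$ and $\{V((0,x-u]\times(0,y-v])\}_{x\ge u,y\ge v}$ have the same finite-dimensional distributions. For a line $\ell\ni(0,0)$, such a $V$ has independent rectangular increments in direction $\ell$ if $V(K)$ and $V(K')$ are independent whenever $K,K'\subset(0,\infty)^2$ lie on different sides of a line orthogonal to $\ell$; invariant ones if $V(K)=V(K+z)$ a.s. whenever $z\in\ell$ and $K,K+z\subset(0,\infty)^2$; dependent ones if neither holds. $V$ has dependent rectangular increments if they are dependent in every direction, and semi-dependent ones if they are dependent in some direction and independent or invariant in some direction. A stationary field $Y$ on $\mathbb Z^2$ has Type I distributional LRD, with critical exponent $\gamma_0>0$, if for every $\gamma>0$ there are $H(\gamma)>0$ and a field $V_\gamma$ with stationary rectangular increments, vanishing on the axes, which is the limit of the normalized partial sums as in (a) (in finite-dimensional distributions, for $x,y>0$), and $V_{\gamma}$ has dependent rectangular increments for $\gamma=\gamma_0$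 and semi-dependent ones for every $\gamma\ne\gamma_0$. It is isotropic if $\gamma_0=1$ and anisotropic if $\gamma_0\ne1$. -/

import Mathlib

open MeasureTheory ProbabilityTheory Filter Topology

noncomputable section

namespace ScalingLimits

/-! ### Random fields: finite-dimensional distributions, rectangular increments -/

/-- The open quadrant `ℝ²₊`. -/
def openQuadrant : Set (ℝ × ℝ) := {p | 0 < p.1 ∧ 0 < p.2}

/-- The closed quadrant. -/
def closedQuadrant : Set (ℝ × ℝ) := {p | 0 ≤ p.1 ∧ 0 ≤ p.2}

/-- Weak convergence of all finite-dimensional distributions at points of the open quadrant. -/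
def FddTendsto {Ω Ω' : Type*} [MeasurableSpace Ω] [MeasurableSpace Ω']
    (P : Measure Ω) [IsProbabilityMeasure P] (P' : Measure Ω') [IsProbabilityMeasure P']
    (X : ℕ → ℝ × ℝ → Ω → ℝ) (V : ℝ × ℝ → Ω' → ℝ) : Prop :=
  ∀ (k : ℕ) (p : Fin k → ℝ × ℝ), (∀ i, p i ∈ openQuadrant) →
    TendstoInDistribution (fun (n : ℕ) (ω : Ω) (i : Fin k) => X n (p i) ω) atTop
      (fun (ω : Ω') (i : Fin k) => V (p i) ω) (fun _ => P) P'

/-- `V(K) = V(x,y) - V(u,y) - V(x,v) + V(u,v)` for `K = (u,x] × (v,y]`. -/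
def increment {Ω : Type*} (V : ℝ × ℝ → Ω → ℝ) (u v x y : ℝ) (ω : Ω) : ℝ :=
  V (x, y) ω - V (u, y) ω - V (x, v) ω + V (u, v) ω

/-- Corner data of a nonempty rectangle `(u,x] × (v,y]`. -/
structure Rect where
  u : ℝ
  v : ℝ
  x : ℝ
  y : ℝ
  hx : u < x
  hy : v < y

/-- The rectangle as a set. -/
def Rect.toSet (K : Rect) : Set (ℝ × ℝ) := Set.Ioc K.u K.x ×ˢ Set.Ioc K.v K.y

/-- The increment of `V` on the rectangle `K`. -/
def Rect.incr {Ω : Type*} (K : Rect) (V : ℝ × ℝ → Ω → ℝ) : Ω → ℝ :=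
  increment V K.u K.v K.x K.y

/-- The shifted rectangle `K + (z,w)`. -/
def Rect.shift (K : Rect) (z w : ℝ) : Rect where
  u := K.u + z
  v := K.v + w
  x := K.x + z
  y := K.y + w
  hx := by have := K.hx; linarith
  hy := by have := K.hy; linarith

/-- `K` and `K'` lie on different sides of the line `{a x + b y = c}`. -/
def Separated (a b c : ℝ) (K K' : Rect) : Prop :=
  ((∀ p ∈ K.toSet, a * p.1 + b * p.2 ≤ c) ∧ (∀ p ∈ K'.toSet, c ≤ a * p.1 + b * p.2)) ∨
  ((∀ p ∈ K'.toSet, a * p.1 + b * p.2 ≤ c) ∧ (∀ p ∈ K.toSet, c ≤ a * p.1 + b * p.2))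

section Increments

variable {Ω : Type*} [MeasurableSpace Ω]

/-- Stationary rectangular increments. -/
def StationaryIncrements (P : Measure Ω) (V : ℝ × ℝ → Ω → ℝ) : Prop :=
  ∀ u v : ℝ, 0 ≤ u → 0 ≤ v → ∀ (k : ℕ) (p : Fin k → ℝ × ℝ),
    (∀ i, u ≤ (p i).1 ∧ v ≤ (p i).2) →
    IdentDistrib (fun (ω : Ω) (i : Fin k) => increment V u v (p i).1 (p i).2 ω)
      (fun (ω : Ω) (i : Fin k) => increment V 0 0 ((p i).1 - u) ((p i).2 - v) ω) P P

/-- `V(x,0) = V(0,y) = 0` for `x, y ≥ 0`, almost surely. -/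
def VanishesOnAxes (P : Measure Ω) (V : ℝ × ℝ → Ω → ℝ) : Prop :=
  ∀ x : ℝ, 0 ≤ x → (∀ᵐ ω ∂P, V (x, 0) ω = 0) ∧ (∀ᵐ ω ∂P, V (0, x) ω = 0)

/-- Independent rectangular increments in the direction of the line `{a x + b y = 0}`. -/
def IndepIncrementsDir (P : Measure Ω) (V : ℝ × ℝ → Ω → ℝ) (a b : ℝ) : Prop :=
  ∀ a' b' c' : ℝ, (a', b') ≠ (0, 0) → a * a' + b * b' = 0 →
    ∀ K K' : Rect, K.toSet ⊆ openQuadrant → K'.toSet ⊆ openQuadrant →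
      Separated a' b' c' K K' → IndepFun (K.incr V) (K'.incr V) P

/-- Invariant rectangular increments in the direction of the line `{a x + b y = 0}`. -/
def InvariantIncrementsDir (P : Measure Ω) (V : ℝ × ℝ → Ω → ℝ) (a b : ℝ) : Prop :=
  ∀ z w : ℝ, a * z + b * w = 0 → ∀ K : Rect, K.toSet ⊆ openQuadrant →
    (K.shift z w).toSet ⊆ openQuadrant → K.incr V =ᵐ[P] (K.shift z w).incr V

/-- Dependent rectangular increments in the direction of the line `{a x + b y = 0}`. -/
def DependentIncrementsDir (P : Measure Ω) (V : ℝ × ℝ → Ω → ℝ) (a b : ℝ) : Prop :=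
  ¬ IndepIncrementsDir P V a b ∧ ¬ InvariantIncrementsDir P V a b

/-- Dependent rectangular increments: dependent in every direction. -/
def DependentIncrements (P : Measure Ω) (V : ℝ × ℝ → Ω → ℝ) : Prop :=
  ∀ a b : ℝ, (a, b) ≠ (0, 0) → DependentIncrementsDir P V a b

/-- Semi-dependent rectangular increments: dependent in some direction, and independent or
invariant in some other. -/
def SemiDependentIncrements (P : Measure Ω) (V : ℝ × ℝ → Ω → ℝ) : Prop :=
  (∃ a b : ℝ, (a, b) ≠ (0, 0) ∧ DependentIncrementsDir P V a b) ∧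
  (∃ a b : ℝ, (a, b) ≠ (0, 0) ∧ (IndepIncrementsDir P V a b ∨ InvariantIncrementsDir P V a b))

/-- Operator scaling on the closed quadrant with exponent `H` and matrix `diag(1, γ)`:
`V(lx, l^γ y)` and `l^H V(x,y)` have the same finite-dimensional distributions, for all `l > 0`. -/
def OperatorScaling (P : Measure Ω) (V : ℝ × ℝ → Ω → ℝ) (γ H : ℝ) : Prop :=
  ∀ l : ℝ, 0 < l → ∀ (k : ℕ) (p : Fin k → ℝ × ℝ), (∀ i, p i ∈ closedQuadrant) →
    IdentDistrib (fun (ω : Ω) (i : Fin k) => V (l * (p i).1, l ^ γ * (p i).2) ω)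
      (fun (ω : Ω) (i : Fin k) => l ^ H * V (p i) ω) P P

/-! ### Stationary fields on `ℤ²`, partial sums, Type I distributional LRD -/

/-- Strict stationarity of a random field on `ℤ²`. -/
def IsStationaryField (P : Measure Ω) (Y : ℤ × ℤ → Ω → ℝ) : Prop :=
  ∀ q : ℤ × ℤ, IdentDistrib (fun (ω : Ω) (p : ℤ × ℤ) => Y (p + q) ω)
    (fun (ω : Ω) (p : ℤ × ℤ) => Y p ω) P P

/-- `n^{-H} ∑ Y(t,s)` over `1 ≤ t ≤ n x`, `1 ≤ s ≤ n^γ y`. -/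
def normalizedSum (Y : ℤ × ℤ → Ω → ℝ) (γ H : ℝ) (n : ℕ) (p : ℝ × ℝ) (ω : Ω) : ℝ :=
  (n : ℝ) ^ (-H) *
    ∑ t ∈ Finset.Icc (1 : ℤ) ⌊(n : ℝ) * p.1⌋, ∑ s ∈ Finset.Icc (1 : ℤ) ⌊(n : ℝ) ^ γ * p.2⌋,
      Y (t, s) ω

/-- Type I distributional long-range dependence with critical exponent `γ₀`: for every `γ > 0`
the normalized rectangular partial sums have a limit field, whose rectangular increments are
dependent for `γ = γ₀` and semi-dependent for `γ ≠ γ₀`. -/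
def HasTypeILRDAt (P : Measure Ω) [IsProbabilityMeasure P] (Y : ℤ × ℤ → Ω → ℝ) (γ₀ : ℝ) : Prop :=
  0 < γ₀ ∧ IsStationaryField P Y ∧
  ∀ γ : ℝ, 0 < γ → ∃ H : ℝ, 0 < H ∧
    ∃ (Ω' : Type) (_ : MeasurableSpace Ω') (P' : Measure Ω') (_ : IsProbabilityMeasure P')
      (V : ℝ × ℝ → Ω' → ℝ),
      FddTendsto P P' (normalizedSum Y γ H) V ∧
      StationaryIncrements P' V ∧ VanishesOnAxes P' V ∧
      (γ = γ₀ → DependentIncrements P' V) ∧ (γ ≠ γ₀ → SemiDependentIncrements P' V)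

/-- Type I isotropic distributional LRD. -/
def HasTypeIIsotropicLRD (P : Measure Ω) [IsProbabilityMeasure P] (Y : ℤ × ℤ → Ω → ℝ) : Prop :=
  ∃ γ₀ : ℝ, γ₀ = 1 ∧ HasTypeILRDAt P Y γ₀

/-- Type I anisotropic distributional LRD. -/
def HasTypeIAnisotropicLRD (P : Measure Ω) [IsProbabilityMeasure P] (Y : ℤ × ℤ → Ω → ℝ) : Prop :=
  ∃ γ₀ : ℝ, γ₀ ≠ 1 ∧ HasTypeILRDAt P Y γ₀

/-- The square `[-π,π]²`. -/
def piSquare : Set (ℝ × ℝ) := Set.Icc (-Real.pi) Real.pi ×ˢ Set.Icc (-Real.pi) Real.pi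

/-- `f` is a spectral density of the zero-mean stationary field `Y`:
`E[Y(t,s) Y(0,0)] = ∫_{[-π,π]²} e^{i(tx+sy)} f(x,y) dx dy`. -/
structure IsSpectralDensity (P : Measure Ω) (Y : ℤ × ℤ → Ω → ℝ) (f : ℝ × ℝ → ℝ) : Prop where
  nonneg : ∀ᵐ p ∂(volume.restrict piSquare), 0 ≤ f p
  integrable : IntegrableOn f piSquare
  covariance : ∀ t s : ℤ, ((∫ ω, Y (t, s) ω * Y (0, 0) ω ∂P : ℝ) : ℂ) =
    ∫ p in piSquare, Complex.exp (Complex.I * (t * p.1 + s * p.2)) * (f p : ℂ)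

/-! ### Complex Gaussian white noise and its stochastic integral -/

/-- Sets on which the noise is defined: measurable of finite volume. -/
abbrev FiniteVolumeSet (E : Type*) [MeasureSpace E] : Type _ :=
  {A : Set E // MeasurableSet A ∧ volume A ≠ ⊤}

/-- Standard complex-valued Gaussian noise `W` on `E` (`ℝ` or `ℝ × ℝ`): jointly Gaussian with
zero mean, `E[W(A) conj W(B)] = vol(A ∩ B)`, and `W(-A) = conj W(A)` almost surely. -/
structure IsGaussianNoise {E : Type*} [MeasureSpace E] [Neg E] (P : Measure Ω)
    (W : FiniteVolumeSet E → Ω → ℂ) : Prop where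
  gaussian : IsGaussianProcess W P
  mean_zero : ∀ A, ∫ ω, W A ω ∂P = 0
  covariance : ∀ A B, ∫ ω, W A ω * (starRingEnd ℂ) (W B ω) ∂P =
    ((volume.real (A.1 ∩ B.1) : ℝ) : ℂ)
  hermitian : ∀ A B, B.1 = (fun x => -x) ⁻¹' A.1 →
    W B =ᵐ[P] fun ω => (starRingEnd ℂ) (W A ω)

open Classical in
/-- The integral `∑ z W({ψ = z})` (over the nonzero values `z`) of a simple function `ψ`.
The fallback value is never met for a square-integrable `ψ`. -/
def simpleIntegral {E : Type*} [MeasureSpace E] (W : FiniteVolumeSet E → Ω → ℂ)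
    (ψ : SimpleFunc E ℂ) (ω : Ω) : ℂ :=
  ∑ z ∈ ψ.range.filter (fun z => z ≠ 0),
    z * (if h : volume (ψ ⁻¹' {z}) ≠ ⊤ then W ⟨ψ ⁻¹' {z}, ψ.measurableSet_fiber z, h⟩ ω else 0)

/-- `Z = ∫ φ dW`: `Z` is the `L²(P)`-limit of the integrals of square-integrable simple functions
that converge to `φ` in `L²(E)`. -/
def IsStochasticIntegral {E : Type*} [MeasureSpace E] (P : Measure Ω)
    (W : FiniteVolumeSet E → Ω → ℂ) (φ : E → ℂ) (Z : Ω → ℂ) : Prop :=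
  MemLp φ 2 volume ∧ MemLp Z 2 P ∧
  ∃ ψ : ℕ → SimpleFunc E ℂ, (∀ n, MemLp (ψ n) 2 volume) ∧
    Tendsto (fun n => eLpNorm (fun e => ψ n e - φ e) 2 volume) atTop (𝓝 0) ∧
    Tendsto (fun n => eLpNorm (fun ω => simpleIntegral W (ψ n) ω - Z ω) 2 P) atTop (𝓝 0)

end Increments

/-! ### The Type I spectral density and its scaling limits -/

/-- `h(x,y) = (|x|² + c |y|^{2H₂/H₁})^{-H₁/2}`. -/
def hFun (H₁ H₂ c : ℝ) (p : ℝ × ℝ) : ℝ :=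
  1 / (|p.1| ^ 2 + c * |p.2| ^ (2 * H₂ / H₁)) ^ (H₁ / 2)

/-- The Type I spectral density `g(x,y) / (|x|² + c |y|^{2H₂/H₁})^{H₁/2}`. -/
def typeIDensity (g : ℝ × ℝ → ℝ) (H₁ H₂ c : ℝ) (p : ℝ × ℝ) : ℝ :=
  g p / (|p.1| ^ 2 + c * |p.2| ^ (2 * H₂ / H₁)) ^ (H₁ / 2)

/-- The normalizing exponent `H(γ)`; the two branches agree at `γ = H₁ / H₂`. -/
def scalingExponent (H₁ H₂ γ : ℝ) : ℝ :=
  if H₁ / H₂ ≤ γ then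
    if H₁ < 1 then (1 + γ + H₁) / 2
    else (γ * H₁ + γ * H₁ * H₂ - γ * H₂ + 2 * H₁) / (2 * H₁)
  else
    if H₂ < 1 then (1 + γ + γ * H₂) / 2
    else (H₂ + H₁ * H₂ - H₁ + 2 * γ * H₂) / (2 * H₂)

/-- `(1 - e^{i u x}) / (i u)`. -/
def expKernel (x u : ℝ) : ℂ :=
  (1 - Complex.exp (Complex.I * (u * x))) / (Complex.I * u)

/-- `ρ₁ = B(1/2, (H₁-1)/2)^{1/2}`, so that `ρ₁² = ∫ (1+w²)^{-H₁/2} dw`. -/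
def rho₁ (H₁ : ℝ) : ℝ := √(beta (1 / 2) ((H₁ - 1) / 2))

/-- `ρ₂ = ((H₁/H₂) B(H₁/(2H₂), (H₁H₂-H₁)/(2H₂)))^{1/2}`, so that
`ρ₂² = ∫ (1+|w|^{2H₂/H₁})^{-H₁/2} dw`. -/
def rho₂ (H₁ H₂ : ℝ) : ℝ :=
  √(H₁ / H₂ * beta (H₁ / (2 * H₂)) ((H₁ * H₂ - H₁) / (2 * H₂)))

/-- `V(x,y)`, `x, y ≥ 0`, is the stochastic integral that defines the limit field `V_γ`, driven by
the noise `W` on `ℝ²` or the noise `W₁` on `ℝ`. Constants stand inside the integral. -/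
def IsLimitField {Ω : Type*} [MeasurableSpace Ω] (H₁ H₂ c γ : ℝ) (P : Measure Ω)
    (W : FiniteVolumeSet (ℝ × ℝ) → Ω → ℂ) (W₁ : FiniteVolumeSet ℝ → Ω → ℂ)
    (V : ℝ × ℝ → Ω → ℝ) : Prop :=
  ∀ x y : ℝ, 0 ≤ x → 0 ≤ y →
    if γ = H₁ / H₂ then
      IsStochasticIntegral P W
        (fun q => expKernel x q.1 * expKernel y q.2 * (√(hFun H₁ H₂ c q) : ℝ))
        (fun ω => (V (x, y) ω : ℂ))
    else if H₁ / H₂ < γ then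
      if H₁ < 1 then
        IsStochasticIntegral P W
          (fun q => expKernel x q.1 * expKernel y q.2 * ((|q.1| ^ (-H₁ / 2) : ℝ) : ℂ))
          (fun ω => (V (x, y) ω : ℂ))
      else
        IsStochasticIntegral P W₁
          (fun v => ((x * rho₁ H₁ * c ^ ((1 - H₁) / 4) : ℝ) : ℂ) * expKernel y v *
            ((|v| ^ (-(H₁ * H₂ - H₂) / (2 * H₁)) : ℝ) : ℂ))
          (fun ω => (V (x, y) ω : ℂ))
    else
      if H₂ < 1 then
        IsStochasticIntegral P W
          (fun q => ((c ^ (-H₁ / 4) : ℝ) : ℂ) * (expKernel x q.1 * expKernel y q.2) *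
            ((|q.2| ^ (-H₂ / 2) : ℝ) : ℂ))
          (fun ω => (V (x, y) ω : ℂ))
      else
        IsStochasticIntegral P W₁
          (fun u => ((y * rho₂ H₁ H₂ * c ^ (-H₁ / (4 * H₂)) : ℝ) : ℂ) * expKernel x u *
            ((|u| ^ (-(H₁ * H₂ - H₁) / (2 * H₂)) : ℝ) : ℂ))
          (fun ω => (V (x, y) ω : ℂ))

end ScalingLimits

end

open ScalingLimits

/-! All fields involved are centred and Gaussian, so convergence of finite-dimensional distributions
follows from convergence of covariances (`tendstoInDistribution_of_tendsto_covariance`), and every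
property of the limit field can be read off its covariance.

Convergence. The covariance of two normalized sums is `n^{-2H} ∫ D D conj(D D) g h` over `[-π,π]²`,
where each `D` is a Dirichlet sum in one coordinate
(`IsSpectralDensity.integral_normalizedSum_mul`). Substitute `(u/R₁, v/R₂)` and apply dominated
convergence (`tendsto_integral_dirichletSum`); only the value `g(0,0)` survives. The choice of `R₁,
R₂` distinguishes the regimes. When the limit is an integral over `ℝ²`, `R₁ = n` and `R₂ = n^γ`: the
Dirichlet sums become `-e_x` and `-e_y`, and the rescaled `h` tends to `h` if `γ = γ₀`, to its trace
on the axis `v = 0` if `γ > γ₀`, and to its trace on `u = 0` if `γ < γ₀`. If `γ > γ₀` and `H₁ > 1`,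
the trace `|u|^{-H₁}` is not integrable at `0`: the mass sits at frequencies `u ~ n^{-γ/γ₀}`, far
below `1/n`, where the Dirichlet sum in `t` is just `n x`. Then `R₁ = n^{γ/γ₀}`, the rescaled `h` is
exactly `h`, and integrating out `u` produces the beta constant `ρ₁²` and a power of `|v|`. The case
`γ < γ₀`, `H₂ > 1` is the mirror image.

Limit fields. Since `Re (e_x conj e_y) = (|e_x|² + |e_y|² - |e_{x-y}|²) / 2`, the covariance of
`V_γ` is obtained by polarizing, in each coordinate, one function `Φ(x,y) = E V_γ(x,y)²` (`covOf`,
`IsVariogramField`). Covariances of rectangular increments depend on `Φ` at coordinate differences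
only, which gives stationarity of increments; homogeneity of `Φ` gives operator scaling.

Dependence. For `γ ≠ γ₀`, `Φ` is `κ |x|^{1+a} |y|^{1+b}`, where one exponent lies strictly between
`1` and `2` (dependence along that axis) and the other is `1` (Brownian, independence) or `2`
(linear paths, invariance). For `γ = γ₀`, translating a square multiplies the spectral integrand by
a product of cosines, which excludes invariance (`not_invariant_of_hVariogram`). Independence is
excluded by strict monotonicity of `h`: directly for the vertical direction, and otherwise because
independence would make `Φ(2x,1) - 2Φ(x,1)` constant for large `x`, while scaling makes it grow at
least like a multiple of `x^{1+H₁-H₁/H₂}` (`not_indep_of_hVariogram`).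

The noises come from an isonormal process, with the even and odd parts of an indicator feeding the
real and imaginary parts (`exists_isGaussianNoise`). -/

namespace ScalingLimits

section

/-! ### Gaussian vectors: criteria, `L²` limits, convergence from convergence of covariances -/

section Gaussian

variable {Ω Ω' : Type*} [MeasurableSpace Ω] [MeasurableSpace Ω'] {P : Measure Ω} {P' : Measure Ω'}

/-- Cramér–Wold: every continuous linear functional on `ι → ℝ` is a linear combination of
coordinates. -/
lemma hasGaussianLaw_pi_of_forall_sum {ι : Type*} [Fintype ι] {X : ι → Ω → ℝ}
    (h : ∀ a : ι → ℝ, HasGaussianLaw (fun ω => ∑ i, a i * X i ω) P) :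
    HasGaussianLaw (fun ω i => X i ω) P := by
  classical
  have hm : ∀ i, AEMeasurable (X i) P := by
    intro i
    have := (h (Pi.single i 1)).aemeasurable
    simpa [Pi.single_apply] using this
  have hm' : AEMeasurable (fun ω i => X i ω) P := aemeasurable_pi_iff.2 hm
  constructor
  refine isGaussian_of_isGaussian_map fun L => ?_
  rw [AEMeasurable.map_map_of_aemeasurable L.continuous.aemeasurable hm']
  convert! (h (fun i => L (fun j => if i = j then 1 else 0))).isGaussian_map using 2
  ext ω
  have := LinearMap.pi_apply_eq_sum_univ (L : (ι → ℝ) →ₗ[ℝ] ℝ) (fun i => X i ω)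
  simp only [ContinuousLinearMap.coe_coe, smul_eq_mul] at this
  simp only [Function.comp_apply, this]
  exact Finset.sum_congr rfl fun i _ => mul_comm _ _

lemma hasGaussianLaw_sum_mul {ι : Type*} [Fintype ι] {X : ι → Ω → ℝ}
    (h : HasGaussianLaw (fun ω i => X i ω) P) (a : ι → ℝ) :
    HasGaussianLaw (fun ω => ∑ i, a i * X i ω) P := by
  have := h.map_fun (∑ i, a i • (ContinuousLinearMap.proj i : (ι → ℝ) →L[ℝ] ℝ))
  simpa using this

lemma tendsto_integral_mul_conj {α 𝕜 : Type*} [MeasurableSpace α] [RCLike 𝕜] {μ : Measure α}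
    {f g : ℕ → α → 𝕜} {F G : α → 𝕜} (hf : ∀ n, MemLp (f n) 2 μ) (hg : ∀ n, MemLp (g n) 2 μ)
    (hF : MemLp F 2 μ) (hG : MemLp G 2 μ)
    (h1 : Tendsto (fun n => eLpNorm (f n - F) 2 μ) atTop (𝓝 0))
    (h2 : Tendsto (fun n => eLpNorm (g n - G) 2 μ) atTop (𝓝 0)) :
    Tendsto (fun n => ∫ x, f n x * (starRingEnd 𝕜) (g n x) ∂μ) atTop
      (𝓝 (∫ x, F x * (starRingEnd 𝕜) (G x) ∂μ)) := by
  have key : ∀ {a b : α → 𝕜} (ha : MemLp a 2 μ) (hb : MemLp b 2 μ),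
      ∫ x, a x * (starRingEnd 𝕜) (b x) ∂μ = inner 𝕜 (hb.toLp b) (ha.toLp a) := by
    intro a b ha hb
    rw [L2.inner_def]
    refine integral_congr_ae ?_
    filter_upwards [ha.coeFn_toLp, hb.coeFn_toLp] with x hx hy
    rw [hx, hy, RCLike.inner_apply]
  simp_rw [key (hf _) (hg _), key hF hG]
  exact ((Lp.tendsto_Lp_iff_tendsto_eLpNorm'' _ hg _ hG).2 h2).inner
    ((Lp.tendsto_Lp_iff_tendsto_eLpNorm'' _ hf _ hF).2 h1)

lemma tendsto_integral_of_tendsto_eLpNorm_two {E : Type*} [NormedAddCommGroup E] [NormedSpace ℝ E]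
    [IsProbabilityMeasure P]
    {X : ℕ → Ω → E} {Z : Ω → E} (hX : ∀ n, MemLp (X n) 2 P) (hZ : MemLp Z 2 P)
    (h : Tendsto (fun n => eLpNorm (X n - Z) 2 P) atTop (𝓝 0)) :
    Tendsto (fun n => ∫ ω, X n ω ∂P) atTop (𝓝 (∫ ω, Z ω ∂P)) := by
  refine tendsto_integral_of_L1' Z hZ.1
    (Eventually.of_forall fun n => (hX n).integrable (by norm_num)) ?_
  refine tendsto_of_tendsto_of_tendsto_of_le_of_le tendsto_const_nhds h (fun _ => zero_le) ?_
  intro n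
  exact eLpNorm_le_eLpNorm_of_exponent_le (by norm_num) ((hX n).sub hZ).1

/-- The law of a centred Gaussian variable is determined by its second moment. -/
lemma charFun_map_of_centered {X : Ω → ℝ}
    (hX : HasGaussianLaw X P) (h0 : ∫ ω, X ω ∂P = 0) (t : ℝ) :
    charFun (P.map X) t = Complex.exp (-((t ^ 2 * ∫ ω, X ω * X ω ∂P : ℝ) : ℂ) / 2) := by
  have := hX.isProbabilityMeasure
  rw [hX.charFun_map_eq]
  have h1 : (fun ω => inner ℝ t (X ω)) = fun ω => t * X ω := by
    ext ω; simp [RCLike.inner_apply, mul_comm]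
  rw [h1, integral_const_mul, h0, variance_const_mul, variance_eq_sub hX.memLp_two, h0]
  congr 1
  simp [sq]
  ring

/-- Convergence in `L²` gives both convergence in distribution and convergence of variances, so the
characteristic function of `Z` is the limit of the Gaussian ones. -/
lemma hasGaussianLaw_of_tendsto_eLpNorm [IsProbabilityMeasure P] {X : ℕ → Ω → ℝ} {Z : Ω → ℝ}
    (hX : ∀ n, HasGaussianLaw (X n) P) (h0 : ∀ n, ∫ ω, X n ω ∂P = 0) (hZ : MemLp Z 2 P)
    (h : Tendsto (fun n => eLpNorm (X n - Z) 2 P) atTop (𝓝 0)) :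
    HasGaussianLaw Z P ∧ ∫ ω, Z ω ∂P = 0 := by
  have hm : ∫ ω, Z ω ∂P = 0 := by
    have := tendsto_integral_of_tendsto_eLpNorm_two (fun n => (hX n).memLp_two) hZ h
    simp_rw [h0] at this
    exact (tendsto_nhds_unique this tendsto_const_nhds)
  refine ⟨?_, hm⟩
  have hv := tendsto_integral_mul_conj (fun n => (hX n).memLp_two) (fun n => (hX n).memLp_two)
    hZ hZ h h
  simp only [conj_trivial] at hv
  have hd : TendstoInDistribution X atTop Z (fun _ => P) P :=
    (tendstoInMeasure_of_tendsto_eLpNorm (by norm_num) (fun n => (hX n).memLp_two.1) hZ.1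
      h).tendstoInDistribution (fun n => (hX n).aemeasurable)
  rw [hasGaussianLaw_iff_charFun_map_eq hZ.1.aemeasurable]
  intro t
  have h1 : (fun ω => inner ℝ t (Z ω)) = fun ω => t * Z ω := by
    ext ω; simp [RCLike.inner_apply, mul_comm]
  rw [h1, integral_const_mul, hm, variance_const_mul, variance_eq_sub hZ, hm]
  have hc := ProbabilityMeasure.tendsto_iff_tendsto_charFun.1 hd.tendsto t
  simp only [ProbabilityMeasure.coe_mk] at hc
  simp_rw [fun n => charFun_map_of_centered (hX n) (h0 n)] at hc
  have hc2 : Tendsto (fun n => Complex.exp (-((t ^ 2 * ∫ ω, X n ω * X n ω ∂P : ℝ) : ℂ) / 2)) atTop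
      (𝓝 (Complex.exp (-((t ^ 2 * ∫ ω, Z ω * Z ω ∂P : ℝ) : ℂ) / 2))) := by
    have hcont : Continuous fun r : ℝ => Complex.exp (-((t ^ 2 * r : ℝ) : ℂ) / 2) := by fun_prop
    exact (hcont.tendsto _).comp hv
  rw [tendsto_nhds_unique hc hc2]
  congr 1
  simp [sq]
  ring

lemma integral_sum_mul_sum {α ι κ 𝕜 : Type*} [RCLike 𝕜] [MeasurableSpace α] {μ : Measure α} [Fintype ι]
    [Fintype κ] {f : ι → α → 𝕜} {g : κ → α → 𝕜} (a : ι → 𝕜) (b : κ → 𝕜)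
    (h : ∀ i j, Integrable (fun x => f i x * g j x) μ) :
    ∫ x, (∑ i, a i * f i x) * (∑ j, b j * g j x) ∂μ
      = ∑ i, ∑ j, a i * b j * ∫ x, f i x * g j x ∂μ := by
  simp_rw [Finset.sum_mul_sum]
  have h2 : ∀ i j x, a i * f i x * (b j * g j x) = a i * b j * (f i x * g j x) :=
    fun i j x => by ring
  simp_rw [h2]
  rw [integral_finsetSum _ fun i _ => integrable_finsetSum _ fun j _ => (h i j).const_mul _]
  refine Finset.sum_congr rfl fun i _ => ?_
  rw [integral_finsetSum _ fun j _ => (h i j).const_mul _]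
  exact Finset.sum_congr rfl fun j _ => integral_const_mul _ _

lemma integral_sum_mul_eq_zero {ι : Type*} [Fintype ι] {X : ι → Ω → ℝ}
    (hX : ∀ i, Integrable (X i) P) (h0 : ∀ i, ∫ ω, X i ω ∂P = 0) (a : ι → ℝ) :
    ∫ ω, ∑ i, a i * X i ω ∂P = 0 := by
  rw [integral_finsetSum _ fun i _ => (hX i).const_mul _]
  simp [integral_const_mul, h0]

lemma charFun_map_toLp_of_centered {k : ℕ} {Y : Fin k → Ω → ℝ}
    (hY : HasGaussianLaw (fun ω i => Y i ω) P) (hY0 : ∀ i, ∫ ω, Y i ω ∂P = 0)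
    (t : EuclideanSpace ℝ (Fin k)) :
    charFun (P.map (fun ω => WithLp.toLp 2 (fun i => Y i ω))) t =
      Complex.exp (-((∑ i, ∑ j, t i * t j * ∫ ω, Y i ω * Y j ω ∂P : ℝ) : ℂ) / 2) := by
  have := hY.isProbabilityMeasure
  have hY2 : ∀ i, MemLp (Y i) 2 P := fun i => (hY.eval i).memLp_two
  have h1 := (hY.toLp_pi 2).charFun_map_eq t
  rw [h1]
  have h2 : (fun ω => inner ℝ t (WithLp.toLp 2 fun i => Y i ω)) = fun ω => ∑ i, t i * Y i ω := by
    ext ω; simp [PiLp.inner_apply, mul_comm]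
  rw [h2, integral_sum_mul_eq_zero (fun i => (hY2 i).integrable (by norm_num)) hY0,
    variance_eq_sub (hasGaussianLaw_sum_mul hY t).memLp_two,
    integral_sum_mul_eq_zero (fun i => (hY2 i).integrable (by norm_num)) hY0,
    ← integral_sum_mul_sum t t (fun i j => (hY2 i).integrable_mul (hY2 j))]
  simp [sq, neg_div]

/-- Centred Gaussian vectors converge in distribution if their covariances do. -/
theorem tendstoInDistribution_of_tendsto_covariance [IsProbabilityMeasure P]
    [IsProbabilityMeasure P'] {k : ℕ} {X : ℕ → Fin k → Ω → ℝ} {Z : Fin k → Ω' → ℝ}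
    (hX : ∀ n, HasGaussianLaw (fun ω i => X n i ω) P) (hX0 : ∀ n i, ∫ ω, X n i ω ∂P = 0)
    (hZ : HasGaussianLaw (fun ω i => Z i ω) P') (hZ0 : ∀ i, ∫ ω, Z i ω ∂P' = 0)
    (h : ∀ i j, Tendsto (fun n => ∫ ω, X n i ω * X n j ω ∂P) atTop
      (𝓝 (∫ ω, Z i ω * Z j ω ∂P'))) :
    TendstoInDistribution (fun n ω i => X n i ω) atTop (fun ω i => Z i ω) (fun _ => P) P' := by
  -- Characteristic functions need an inner product, hence the detour through `EuclideanSpace`;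
  -- Lévy's continuity theorem applies there.
  have hT : TendstoInDistribution (fun n ω => (WithLp.toLp 2 (fun i => X n i ω) : EuclideanSpace ℝ (Fin k))) atTop
      (fun ω => (WithLp.toLp 2 (fun i => Z i ω) : EuclideanSpace ℝ (Fin k))) (fun _ => P) P' := by
    refine ⟨fun n => ((hX n).toLp_pi 2).aemeasurable, (hZ.toLp_pi 2).aemeasurable, ?_⟩
    refine ProbabilityMeasure.tendsto_iff_tendsto_charFun.2 fun t => ?_
    simp only [ProbabilityMeasure.coe_mk]
    rw [charFun_map_toLp_of_centered hZ hZ0]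
    simp_rw [fun n => charFun_map_toLp_of_centered (hX n) (hX0 n)]
    have hs : Tendsto (fun n => ∑ i, ∑ j, t i * t j * ∫ ω, X n i ω * X n j ω ∂P) atTop
        (𝓝 (∑ i, ∑ j, t i * t j * ∫ ω, Z i ω * Z j ω ∂P')) :=
      tendsto_finsetSum _ fun i _ => tendsto_finsetSum _ fun j _ => (h i j).const_mul _
    have hcont : Continuous fun r : ℝ => Complex.exp (-((r : ℝ) : ℂ) / 2) := by fun_prop
    exact (hcont.tendsto _).comp hs
  exact hT.continuous_comp (g := WithLp.ofLp) (PiLp.continuous_ofLp 2 _)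

/-- The constant sequence `X` converges in distribution to `X` and, by equality of covariances, to
`Z`; limits in distribution are unique. -/
theorem identDistrib_of_covariance_eq {k : ℕ} {X : Fin k → Ω → ℝ} {Z : Fin k → Ω' → ℝ}
    (hX : HasGaussianLaw (fun ω i => X i ω) P) (hX0 : ∀ i, ∫ ω, X i ω ∂P = 0)
    (hZ : HasGaussianLaw (fun ω i => Z i ω) P') (hZ0 : ∀ i, ∫ ω, Z i ω ∂P' = 0)
    (h : ∀ i j, ∫ ω, X i ω * X j ω ∂P = ∫ ω, Z i ω * Z j ω ∂P') :
    IdentDistrib (fun ω i => X i ω) (fun ω i => Z i ω) P P' := by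
  have := hX.isProbabilityMeasure
  have := hZ.isProbabilityMeasure
  refine ⟨hX.aemeasurable, hZ.aemeasurable, ?_⟩
  refine tendstoInDistribution_unique (fun (_ : ℕ) ω (i : Fin k) => X i ω) (μ := fun _ => P)
    (l := atTop) (tendstoInDistribution_const hX.aemeasurable) ?_
  exact tendstoInDistribution_of_tendsto_covariance (X := fun _ => X) (fun _ => hX) (fun _ => hX0)
    hZ hZ0 (fun i j => by rw [h i j]; exact tendsto_const_nhds)

end Gaussian

end

section

/-! ### Stochastic integrals with respect to a complex Gaussian noise -/

section Noise

variable {Ω : Type*} [MeasurableSpace Ω] {P : Measure Ω} {E : Type*} [MeasureSpace E]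

open Classical in
/-- The nonzero values of a simple function. -/
abbrev NonzeroValue (ψ : SimpleFunc E ℂ) : Type := {z // z ∈ ψ.range.filter (fun z => z ≠ 0)}

open Classical in
lemma NonzeroValue.ne_zero {ψ : SimpleFunc E ℂ} (z : NonzeroValue ψ) : z.1 ≠ 0 :=
  (Finset.mem_filter.1 z.2).2

/-- The fibre over a nonzero value of a square-integrable simple function. -/
def fiber {ψ : SimpleFunc E ℂ} (hψ : MemLp ψ 2 volume) (z : NonzeroValue ψ) : FiniteVolumeSet E :=
  ⟨ψ ⁻¹' {z.1}, ψ.measurableSet_fiber z.1,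
    (SimpleFunc.measure_preimage_lt_top_of_memLp (by norm_num) (by norm_num) ψ hψ z.1
      z.ne_zero).ne⟩

omit [MeasurableSpace Ω] in
lemma simpleIntegral_eq (W : FiniteVolumeSet E → Ω → ℂ) {ψ : SimpleFunc E ℂ}
    (hψ : MemLp ψ 2 volume) (ω : Ω) :
    simpleIntegral W ψ ω = ∑ z : NonzeroValue ψ, z.1 * W (fiber hψ z) ω := by
  classical
  rw [simpleIntegral, ← Finset.sum_coe_sort]
  refine Finset.sum_congr rfl fun z _ => ?_
  have hz : volume (ψ ⁻¹' {z.1}) ≠ ⊤ := (fiber hψ z).2.2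
  rw [dif_pos hz]
  rfl

lemma simpleFunc_eq_sum {ψ : SimpleFunc E ℂ} (hψ : MemLp ψ 2 volume) (e : E) :
    ψ e = ∑ z : NonzeroValue ψ, z.1 * (fiber hψ z).1.indicator (fun _ => (1 : ℂ)) e := by
  classical
  by_cases h0 : ψ e = 0
  · rw [h0, Finset.sum_eq_zero]
    intro z _
    rw [Set.indicator_of_notMem, mul_zero]
    simp only [fiber, Set.mem_preimage, Set.mem_singleton_iff, h0]
    exact fun h => z.ne_zero h.symm
  · rw [Finset.sum_eq_single (⟨ψ e, by simp [h0]⟩ : NonzeroValue ψ)]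
    · simp [fiber]
    · intro z _ hz
      rw [Set.indicator_of_notMem, mul_zero]
      simp only [fiber, Set.mem_preimage, Set.mem_singleton_iff]
      exact fun h => hz (Subtype.ext h.symm)
    · simp

lemma integral_indicator_mul_indicator (A B : FiniteVolumeSet E) :
    Integrable (fun e => A.1.indicator (fun _ => (1 : ℂ)) e * B.1.indicator (fun _ => (1 : ℂ)) e)
      volume ∧
    ∫ e, A.1.indicator (fun _ => (1 : ℂ)) e * B.1.indicator (fun _ => (1 : ℂ)) e =
      ((volume.real (A.1 ∩ B.1) : ℝ) : ℂ) := by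
  have h : (fun e => A.1.indicator (fun _ => (1 : ℂ)) e * B.1.indicator (fun _ => (1 : ℂ)) e) =
      (A.1 ∩ B.1).indicator (fun _ => (1 : ℂ)) := by
    ext e
    simp only [← Set.inter_indicator_mul, mul_one]
  have hm := A.2.1.inter B.2.1
  rw [h]
  refine ⟨(integrable_indicator_iff hm).2 (integrableOn_const
    (measure_ne_top_of_subset Set.inter_subset_left A.2.2)), ?_⟩
  rw [integral_indicator_const _ hm]
  simp

lemma memLp_conj {α : Type*} [MeasurableSpace α] {μ : Measure α} {f : α → ℂ} {p : ENNReal}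
    (hf : MemLp f p μ) : MemLp (fun x => (starRingEnd ℂ) (f x)) p μ :=
  (memLp_congr_norm hf.1 (Complex.continuous_conj.comp_aestronglyMeasurable hf.1)
    (Eventually.of_forall fun x => by simp)).1 hf

variable [Neg E] {W : FiniteVolumeSet E → Ω → ℂ}

lemma IsGaussianNoise.memLp (hW : IsGaussianNoise P W) (A : FiniteVolumeSet E) :
    MemLp (W A) 2 P := (hW.gaussian.hasGaussianLaw_eval A).memLp_two

lemma IsGaussianNoise.memLp_simpleIntegral (hW : IsGaussianNoise P W) {ψ : SimpleFunc E ℂ}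
    (hψ : MemLp ψ 2 volume) : MemLp (simpleIntegral W ψ) 2 P := by
  have : simpleIntegral W ψ = fun ω => ∑ z : NonzeroValue ψ, z.1 * W (fiber hψ z) ω :=
    funext fun ω => simpleIntegral_eq W hψ ω
  rw [this]
  exact memLp_finsetSum _ fun z _ => (hW.memLp _).const_mul _

/-- The Itô isometry for simple functions: both sides expand to the same double sum of volumes of
intersections of fibres. -/
lemma IsGaussianNoise.integral_simpleIntegral_mul_conj (hW : IsGaussianNoise P W)
    {ψ ψ' : SimpleFunc E ℂ} (hψ : MemLp ψ 2 volume) (hψ' : MemLp ψ' 2 volume) :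
    ∫ ω, simpleIntegral W ψ ω * (starRingEnd ℂ) (simpleIntegral W ψ' ω) ∂P =
      ∫ e, ψ e * (starRingEnd ℂ) (ψ' e) := by
  simp_rw [simpleIntegral_eq W hψ, simpleIntegral_eq W hψ']
  conv_rhs =>
    enter [2, e]
    rw [simpleFunc_eq_sum hψ e, simpleFunc_eq_sum hψ' e]
  have hc : ∀ (z : NonzeroValue ψ') e,
      (starRingEnd ℂ) ((fiber hψ' z).1.indicator (fun _ => (1 : ℂ)) e) =
      (fiber hψ' z).1.indicator (fun _ => (1 : ℂ)) e := by
    intro z e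
    by_cases h : e ∈ (fiber hψ' z).1 <;> simp [h]
  simp_rw [map_sum, map_mul, hc]
  rw [integral_sum_mul_sum (fun z : NonzeroValue ψ => z.1)
      (fun z : NonzeroValue ψ' => (starRingEnd ℂ) z.1)
      (fun i j => (hW.memLp _).integrable_mul (memLp_conj (hW.memLp _))),
    integral_sum_mul_sum (fun z : NonzeroValue ψ => z.1)
      (fun z : NonzeroValue ψ' => (starRingEnd ℂ) z.1)
      (fun i j => (integral_indicator_mul_indicator _ _).1)]
  simp_rw [(integral_indicator_mul_indicator _ _).2, hW.covariance]

/-- The covariance of two stochastic integrals. -/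
theorem IsGaussianNoise.integral_mul_conj (hW : IsGaussianNoise P W) {φ φ' : E → ℂ}
    {Z Z' : Ω → ℂ} (h : IsStochasticIntegral P W φ Z) (h' : IsStochasticIntegral P W φ' Z') :
    ∫ ω, Z ω * (starRingEnd ℂ) (Z' ω) ∂P = ∫ e, φ e * (starRingEnd ℂ) (φ' e) := by
  obtain ⟨hφ, hZ, ψ, hψ, h1, h2⟩ := h
  obtain ⟨hφ', hZ', ψ', hψ', h1', h2'⟩ := h'
  have t1 := tendsto_integral_mul_conj (𝕜 := ℂ) hψ hψ' hφ hφ' h1 h1'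
  have t2 := tendsto_integral_mul_conj (𝕜 := ℂ) (fun n => hW.memLp_simpleIntegral (hψ n))
    (fun n => hW.memLp_simpleIntegral (hψ' n)) hZ hZ' h2 h2'
  simp_rw [fun n => hW.integral_simpleIntegral_mul_conj (hψ n) (hψ' n)] at t2
  exact tendsto_nhds_unique t2 t1

theorem IsGaussianNoise.integral_mul_of_real (hW : IsGaussianNoise P W) {φ φ' : E → ℂ}
    {V V' : Ω → ℝ} (h : IsStochasticIntegral P W φ (fun ω => (V ω : ℂ)))
    (h' : IsStochasticIntegral P W φ' (fun ω => (V' ω : ℂ))) :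
    ((∫ ω, V ω * V' ω ∂P : ℝ) : ℂ) = ∫ e, φ e * (starRingEnd ℂ) (φ' e) := by
  rw [← hW.integral_mul_conj h h', ← integral_complex_ofReal]
  simp

/-- Real parts of linear combinations of integrals of simple functions are centred Gaussian. -/
lemma IsGaussianNoise.hasGaussianLaw_sum_simpleIntegral (hW : IsGaussianNoise P W) {ι : Type*}
    [Fintype ι] {ψ : ι → SimpleFunc E ℂ} (hψ : ∀ i, MemLp (ψ i) 2 volume) (a : ι → ℝ) :
    HasGaussianLaw (fun ω => ∑ i, a i * (simpleIntegral W (ψ i) ω).re) P ∧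
      ∫ ω, ∑ i, a i * (simpleIntegral W (ψ i) ω).re ∂P = 0 := by
  have hP := hW.gaussian.isProbabilityMeasure
  let J := Σ i, NonzeroValue (ψ i)
  -- The variable is a sum of real-linear images of finitely many values of the noise, which are
  -- jointly Gaussian.
  let L : J → ℂ →L[ℝ] ℝ := fun j => a j.1 • (Complex.reCLM.comp
    ((ContinuousLinearMap.mul ℝ ℂ) j.2.1))
  have hL : ∀ j w, L j w = a j.1 * (j.2.1 * w).re := fun j w => by simp [L]
  have hsum : (fun ω => ∑ i, a i * (simpleIntegral W (ψ i) ω).re) =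
      fun ω => ∑ j : J, L j (W (fiber (hψ j.1) j.2) ω) := by
    ext ω
    rw [Fintype.sum_sigma]
    refine Finset.sum_congr rfl fun i _ => ?_
    simp_rw [hL, ← Finset.mul_sum, simpleIntegral_eq W (hψ i), Complex.re_sum]
  have hg : IsGaussianProcess (fun (j : J) ω => L j (W (fiber (hψ j.1) j.2) ω)) P :=
    (hW.gaussian.comp_right (fun j : J => fiber (hψ j.1) j.2)).comp_left L
  rw [hsum]
  refine ⟨hg.hasGaussianLaw_fun_sum (I := Finset.univ), ?_⟩
  rw [integral_finsetSum _ fun j _ =>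
    (L j).integrable_comp ((hW.memLp _).integrable (by norm_num))]
  refine Finset.sum_eq_zero fun j _ => ?_
  rw [(L j).integral_comp_comm ((hW.memLp _).integrable (by norm_num)), hW.mean_zero, map_zero]

lemma tendsto_eLpNorm_sum {α ι F : Type*} [MeasurableSpace α] [NormedAddCommGroup F]
    [NormedSpace ℝ F] {μ : Measure α}
    [Fintype ι] {f : ι → ℕ → α → F} {g : ι → α → F} (hf : ∀ i n, MemLp (f i n) 2 μ)
    (hg : ∀ i, MemLp (g i) 2 μ)
    (h : ∀ i, Tendsto (fun n => eLpNorm (f i n - g i) 2 μ) atTop (𝓝 0)) (a : ι → ℝ) :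
    Tendsto (fun n => eLpNorm ((fun x => ∑ i, a i • f i n x) - fun x => ∑ i, a i • g i x) 2 μ)
      atTop (𝓝 0) := by
  have hb : Tendsto (fun n => ∑ i, ‖a i‖ₑ * eLpNorm (f i n - g i) 2 μ) atTop (𝓝 0) := by
    have : Tendsto (fun n => ∑ i, ‖a i‖ₑ * eLpNorm (f i n - g i) 2 μ) atTop
        (𝓝 (∑ i : ι, ‖a i‖ₑ * 0)) :=
      tendsto_finsetSum _ fun i _ => ENNReal.Tendsto.const_mul (h i) (Or.inr (by simp))
    simpa using this
  refine tendsto_of_tendsto_of_tendsto_of_le_of_le tendsto_const_nhds hb (fun _ => zero_le) ?_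
  intro n
  have he : ((fun x => ∑ i, a i • f i n x) - fun x => ∑ i, a i • g i x) =
      ∑ i, a i • (f i n - g i) := by
    ext x
    simp [Finset.sum_apply, smul_sub, Finset.sum_sub_distrib]
  simp only [he]
  refine (eLpNorm_sum_le (fun i _ => (((hf i n).sub (hg i)).const_smul (a i)).1)
    (by norm_num)).trans ?_
  exact Finset.sum_le_sum fun i _ => (eLpNorm_const_smul _ _ _ _).le

/-- Real-valued stochastic integrals are jointly Gaussian and centred. -/
theorem IsGaussianNoise.hasGaussianLaw_pi (hW : IsGaussianNoise P W) {ι : Type*} [Fintype ι]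
    {φ : ι → E → ℂ} {V : ι → Ω → ℝ}
    (h : ∀ i, IsStochasticIntegral P W (φ i) (fun ω => (V i ω : ℂ))) :
    HasGaussianLaw (fun ω i => V i ω) P ∧ ∀ i, ∫ ω, V i ω ∂P = 0 := by
  classical
  have hP := hW.gaussian.isProbabilityMeasure
  have hV : ∀ i, MemLp (V i) 2 P := fun i => by simpa using (h i).2.1.re
  have key : ∀ a : ι → ℝ, HasGaussianLaw (fun ω => ∑ i, a i * V i ω) P ∧
      ∫ ω, ∑ i, a i * V i ω ∂P = 0 := by
    intro a
    choose h1 h2 ψ hψ h3 h4 using h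
    refine hasGaussianLaw_of_tendsto_eLpNorm
      (fun n => (hW.hasGaussianLaw_sum_simpleIntegral (fun i => hψ i n) a).1)
      (fun n => (hW.hasGaussianLaw_sum_simpleIntegral (fun i => hψ i n) a).2)
      (memLp_finsetSum _ fun i _ => (hV i).const_mul _) ?_
    refine tendsto_eLpNorm_sum (fun i n => (hW.memLp_simpleIntegral (hψ i n)).re) hV ?_ a
    intro i
    refine tendsto_of_tendsto_of_tendsto_of_le_of_le tendsto_const_nhds (h4 i)
      (fun _ => zero_le) fun n => ?_
    -- As `V i` is real, taking real parts can only decrease the distance.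
    refine eLpNorm_mono fun ω => ?_
    have := Complex.abs_re_le_norm (simpleIntegral W (ψ i n) ω - (V i ω : ℂ))
    simpa using this
  refine ⟨hasGaussianLaw_pi_of_forall_sum fun a => (key a).1, fun i => ?_⟩
  have := (key (Pi.single i 1)).2
  simpa [Pi.single_apply] using this

omit [Neg E] in
lemma isStochasticIntegral_of_ae_eq {φ : E → ℂ} {Z Z' : Ω → ℂ}
    (h : IsStochasticIntegral P W φ Z) (hZ : Z =ᵐ[P] Z') : IsStochasticIntegral P W φ Z' := by
  obtain ⟨h1, h2, ψ, hψ, h3, h4⟩ := h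
  refine ⟨h1, h2.ae_eq hZ, ψ, hψ, h3, ?_⟩
  refine h4.congr fun n => eLpNorm_congr_ae ?_
  filter_upwards [hZ] with ω hω
  rw [hω]

/-- The isometry turns simple functions converging to `φ` in `L²(E)` into a Cauchy sequence of
integrals in `L²(P)`, which is complete. -/
lemma IsGaussianNoise.exists_complex (hW : IsGaussianNoise P W) {φ : E → ℂ}
    (hφ : MemLp φ 2 volume) : ∃ Z : Ω → ℂ, IsStochasticIntegral P W φ Z := by
  have hex : ∀ n : ℕ, ∃ ψ : SimpleFunc E ℂ,
      eLpNorm (φ - (ψ : E → ℂ)) 2 volume < ENNReal.ofReal (1 / (n + 1)) ∧ MemLp ψ 2 volume := fun n =>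
    hφ.exists_simpleFunc_eLpNorm_sub_lt (by norm_num)
      (ENNReal.ofReal_pos.2 (by positivity)).ne'
  choose ψ hψ1 hψ2 using hex
  have hψ : Tendsto (fun n => eLpNorm ((ψ n : E → ℂ) - φ) 2 volume) atTop (𝓝 0) := by
    have hb : Tendsto (fun n : ℕ => ENNReal.ofReal (1 / (n + 1 : ℝ))) atTop (𝓝 0) := by
      have := ENNReal.tendsto_ofReal (tendsto_one_div_add_atTop_nhds_zero_nat (𝕜 := ℝ))
      simpa using this
    refine tendsto_of_tendsto_of_tendsto_of_le_of_le tendsto_const_nhds hb (fun _ => zero_le) ?_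
    intro n
    have := (hψ1 n).le
    rwa [← eLpNorm_neg, neg_sub] at this
  let b : ℕ → Lp ℂ 2 (volume : Measure E) := fun n => (hψ2 n).toLp (ψ n)
  let a : ℕ → Lp ℂ 2 P := fun n => (hW.memLp_simpleIntegral (hψ2 n)).toLp _
  have hinner : ∀ n m, inner ℂ (a n) (a m) = inner ℂ (b n) (b m) := by
    intro n m
    rw [L2.inner_def, L2.inner_def]
    have := hW.integral_simpleIntegral_mul_conj (hψ2 m) (hψ2 n)
    calc _ = ∫ ω, simpleIntegral W (ψ m) ω * (starRingEnd ℂ) (simpleIntegral W (ψ n) ω) ∂P := by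
          refine integral_congr_ae ?_
          filter_upwards [(hW.memLp_simpleIntegral (hψ2 n)).coeFn_toLp,
            (hW.memLp_simpleIntegral (hψ2 m)).coeFn_toLp] with ω h1 h2
          simp only [a]
          rw [h1, h2, RCLike.inner_apply]
      _ = _ := by
          rw [this]
          refine integral_congr_ae ?_
          filter_upwards [(hψ2 n).coeFn_toLp, (hψ2 m).coeFn_toLp] with ω h1 h2
          simp only [b]
          rw [h1, h2, RCLike.inner_apply]
  have hdist : ∀ n m, dist (a n) (a m) = dist (b n) (b m) := by
    intro n m
    rw [dist_eq_norm, dist_eq_norm, ← sq_eq_sq₀ (norm_nonneg _) (norm_nonneg _),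
      ← inner_self_eq_norm_sq (𝕜 := ℂ), ← inner_self_eq_norm_sq (𝕜 := ℂ)]
    simp only [inner_sub_left, inner_sub_right, hinner]
  have hbc : CauchySeq b :=
    ((Lp.tendsto_Lp_iff_tendsto_eLpNorm'' _ hψ2 _ hφ).2 hψ).cauchySeq
  have hac : CauchySeq a := by
    rw [Metric.cauchySeq_iff] at hbc ⊢
    simpa only [hdist] using hbc
  obtain ⟨z, hz⟩ := cauchySeq_tendsto_of_complete hac
  refine ⟨z, hφ, Lp.memLp z, ψ, hψ2, hψ, ?_⟩
  have := (Lp.tendsto_Lp_iff_tendsto_eLpNorm'' _ (fun n => hW.memLp_simpleIntegral (hψ2 n)) z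
    (Lp.memLp z)).1 (by simpa [a] using hz)
  exact this

end Noise

/-! ### Reality of the integrals of Hermitian functions -/

section Hermitian

variable {Ω : Type*} [MeasurableSpace Ω] {P : Measure Ω} {E : Type*} [MeasureSpace E]
  [InvolutiveNeg E] [MeasurableNeg E] [(volume : Measure E).IsNegInvariant]
  {W : FiniteVolumeSet E → Ω → ℂ}

/-- The reflected set `-A`. -/
def negSet (A : FiniteVolumeSet E) : FiniteVolumeSet E :=
  ⟨(fun x => -x) ⁻¹' A.1, measurable_neg A.2.1, by
    rw [(Measure.measurePreserving_neg (volume : Measure E)).measure_preimage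
      A.2.1.nullMeasurableSet]
    exact A.2.2⟩

/-- The pseudo-covariance of the noise follows from its covariance, because `W(B)` is the conjugate
of `W(-B)`. -/
lemma IsGaussianNoise.integral_mul (hW : IsGaussianNoise P W) (A B : FiniteVolumeSet E) :
    ∫ ω, W A ω * W B ω ∂P = ((volume.real (A.1 ∩ (negSet B).1) : ℝ) : ℂ) := by
  rw [← hW.covariance]
  refine integral_congr_ae ?_
  filter_upwards [hW.hermitian B (negSet B) rfl] with ω h
  rw [h, Complex.conj_conj]

lemma IsGaussianNoise.integral_simpleIntegral_mul (hW : IsGaussianNoise P W)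
    {ψ : SimpleFunc E ℂ} (hψ : MemLp ψ 2 volume) :
    ∫ ω, simpleIntegral W ψ ω * simpleIntegral W ψ ω ∂P = ∫ e, ψ e * ψ (-e) := by
  simp_rw [simpleIntegral_eq W hψ]
  have hn : ∀ e, ψ (-e) = ∑ z : NonzeroValue ψ,
      z.1 * (negSet (fiber hψ z)).1.indicator (fun _ => (1 : ℂ)) e := fun e => by
    rw [simpleFunc_eq_sum hψ (-e)]; rfl
  conv_rhs =>
    enter [2, e]
    rw [hn e, simpleFunc_eq_sum hψ e]
  rw [integral_sum_mul_sum (fun z : NonzeroValue ψ => z.1) (fun z : NonzeroValue ψ => z.1)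
      (fun i j => (hW.memLp _).integrable_mul (hW.memLp _)),
    integral_sum_mul_sum (fun z : NonzeroValue ψ => z.1) (fun z : NonzeroValue ψ => z.1)
      (fun i j => (integral_indicator_mul_indicator _ _).1)]
  simp_rw [(integral_indicator_mul_indicator _ _).2, hW.integral_mul]

/-- The integral of a Hermitian square-integrable function exists and is real. -/
theorem IsGaussianNoise.exists_real (hW : IsGaussianNoise P W) {φ : E → ℂ}
    (hφ : MemLp φ 2 volume) (hherm : ∀ e, φ (-e) = (starRingEnd ℂ) (φ e)) :
    ∃ V : Ω → ℝ, IsStochasticIntegral P W φ (fun ω => (V ω : ℂ)) := by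
  obtain ⟨Z, hZ⟩ := hW.exists_complex hφ
  refine ⟨fun ω => (Z ω).re, isStochasticIntegral_of_ae_eq hZ ?_⟩
  have h1 := hW.integral_mul_conj hZ hZ
  obtain ⟨-, hZ2, ψ, hψ, h3, h4⟩ := hZ
  have mp := Measure.measurePreserving_neg (volume : Measure E)
  -- The point is `E Z² = E |Z|²`: since `2 (Im Z)² = |Z|² - Re Z²`, it forces `Im Z = 0` almost
  -- surely.
  have h2 : ∫ ω, Z ω * Z ω ∂P = ∫ e, φ e * (starRingEnd ℂ) (φ e) := by
    have t2 := tendsto_integral_mul_conj (𝕜 := ℂ) (fun n => hW.memLp_simpleIntegral (hψ n))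
      (fun n => memLp_conj (hW.memLp_simpleIntegral (hψ n))) hZ2 (memLp_conj hZ2) h4 (by
        refine h4.congr fun n => eLpNorm_congr_norm_ae (Eventually.of_forall fun ω => ?_)
        simp only [Pi.sub_apply]
        rw [← map_sub, RCLike.norm_conj])
    have t1 := tendsto_integral_mul_conj (𝕜 := ℂ) hψ
      -- These functions also tend to `φ` in `L²`, because `φ` is Hermitian and reflection preserves
      -- volume.
      (g := fun n e => (starRingEnd ℂ) (ψ n (-e)))
      (fun n => memLp_conj ((hψ n).comp_measurePreserving mp)) hφ hφ h3 (by
        refine h3.congr fun n => ?_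
        have he := eLpNorm_comp_measurePreserving (p := 2) (((hψ n).sub hφ).1) mp
        refine he.symm.trans ?_
        refine eLpNorm_congr_norm_ae (Eventually.of_forall fun e => ?_)
        simp only [Pi.sub_apply, Function.comp_apply]
        rw [hherm e, ← RCLike.norm_conj, map_sub, Complex.conj_conj])
    simp only [Complex.conj_conj] at t1 t2
    simp_rw [fun n => hW.integral_simpleIntegral_mul (hψ n)] at t2
    exact tendsto_nhds_unique t2 t1
  have i1 : Integrable (fun ω => Z ω * (starRingEnd ℂ) (Z ω)) P :=
    hZ2.integrable_mul (memLp_conj hZ2)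
  have i2 : Integrable (fun ω => Z ω * Z ω) P := hZ2.integrable_mul hZ2
  have h5 : ∫ ω, (Z ω).im ^ 2 ∂P = 0 := by
    have e1 : ∀ ω, (Z ω).im ^ 2 = ((Z ω * (starRingEnd ℂ) (Z ω) - Z ω * Z ω) / 2).re := by
      intro ω
      have : ((Z ω * (starRingEnd ℂ) (Z ω) - Z ω * Z ω) / 2) =
        ((1 / 2 : ℝ) : ℂ) * (Z ω * (starRingEnd ℂ) (Z ω) - Z ω * Z ω) := by push_cast; ring
      rw [this, Complex.re_ofReal_mul]
      simp [Complex.mul_re]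
      ring
    simp_rw [e1]
    have := integral_re ((i1.sub i2).div_const 2)
    simp only [Pi.sub_apply, RCLike.re_eq_complex_re] at this
    rw [this, integral_div, integral_sub i1 i2, h1, h2]
    simp
  have h6 : Integrable (fun ω => (Z ω).im ^ 2) P := by
    have := hZ2.im.integrable_sq
    simpa using this
  have h7 := (integral_eq_zero_iff_of_nonneg (fun ω => sq_nonneg _) h6).1 h5
  filter_upwards [h7] with ω hω
  have : (Z ω).im = 0 := by simpa using hω
  exact Complex.ext (by simp) (by simp [this])

end Hermitian

end

section

/-! ### Existence of complex Gaussian noises -/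

section Existence

/-- Every real Hilbert space embeds isometrically into the centred Gaussian variables of some
probability space. -/
theorem exists_isonormal (H : Type) [NormedAddCommGroup H] [InnerProductSpace ℝ H]
    [CompleteSpace H] :
    ∃ (Ω : Type) (_ : MeasurableSpace Ω) (P : Measure Ω) (_ : IsProbabilityMeasure P)
      (G : H →ₗᵢ[ℝ] Lp ℝ 2 P), ∀ h, HasGaussianLaw (G h) P ∧ ∫ ω, G h ω ∂P = 0 := by
  classical
  obtain ⟨w, b, -⟩ := exists_hilbertBasis ℝ H
  obtain ⟨Ω, mΩ, P, X, hXm, hXl, hXi, hP⟩ := exists_iid w (gaussianReal 0 1)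
  have hXg : ∀ i, HasGaussianLaw (X i) P := fun i => (hXl i).hasGaussianLaw
  have hX2 : ∀ i, MemLp (X i) 2 P := fun i => (hXg i).memLp_two
  have hX0 : ∀ i, ∫ ω, X i ω ∂P = 0 := fun i => by
    have := (hXl i).integral_comp (f := id) (by fun_prop)
    simpa [Function.comp_def] using this
  have hXv : ∀ i, ∫ ω, X i ω * X i ω ∂P = 1 := fun i => by
    have h1 := (hXl i).variance_eq
    rw [variance_eq_sub (hX2 i), hX0 i, variance_id_gaussianReal] at h1
    simpa [sq] using h1
  let Y : w → Lp ℝ 2 P := fun i => (hX2 i).toLp (X i)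
  have hYi : ∀ i j, inner ℝ (Y i) (Y j) = ∫ ω, X i ω * X j ω ∂P := by
    intro i j
    rw [L2.inner_def]
    refine integral_congr_ae ?_
    filter_upwards [(hX2 i).coeFn_toLp, (hX2 j).coeFn_toLp] with ω h1 h2
    simp only [Y]
    rw [h1, h2, RCLike.inner_apply, conj_trivial, mul_comm]
  have hY : Orthonormal ℝ Y := by
    rw [orthonormal_iff_ite]
    intro i j
    rw [hYi]
    split_ifs with hij
    · rw [hij, hXv]
    · rw [(hXi.indepFun hij).integral_fun_mul_eq_mul_integral (hX2 i).1 (hX2 j).1, hX0, zero_mul]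
  -- `G` maps a Hilbert basis of `H` to independent standard normal variables.
  let G : H →ₗᵢ[ℝ] Lp ℝ 2 P :=
    hY.orthogonalFamily.linearIsometry.comp b.repr.toLinearIsometry
  refine ⟨Ω, mΩ, P, hP, G, fun h => ?_⟩
  -- Centred Gaussian variables are closed in `L²`, so it suffices to treat the finite partial sums
  -- of the basis expansion.
  have hclosed : IsClosed {z : Lp ℝ 2 P | HasGaussianLaw z P ∧ ∫ ω, z ω ∂P = 0} := by
    refine IsSeqClosed.isClosed fun z z₀ hz hlim => ?_
    refine hasGaussianLaw_of_tendsto_eLpNorm (fun n => (hz n).1) (fun n => (hz n).2)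
      (Lp.memLp z₀) ?_
    exact (Lp.tendsto_Lp_iff_tendsto_eLpNorm' z z₀).1 hlim
  refine hclosed.mem_of_tendsto (hY.orthogonalFamily.hasSum_linearIsometry (b.repr h))
    (Eventually.of_forall fun s => ?_)
  have hs : HasGaussianLaw (fun ω => ∑ i : s, (b.repr h : w → ℝ) i * X i ω) P :=
    hasGaussianLaw_sum_mul (X := fun i : s => X i)
      (iIndepFun.hasGaussianLaw (fun i : s => hXg i)
        (hXi.precomp Subtype.val_injective)) _
  have hs0 : ∫ ω, ∑ i : s, (b.repr h : w → ℝ) i * X i ω ∂P = 0 :=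
    integral_sum_mul_eq_zero (X := fun i : s => X i)
      (fun i => (hX2 i).integrable (by norm_num)) (fun i => hX0 i) _
  have hae : (fun ω => ∑ i : s, (b.repr h : w → ℝ) i * X i ω) =ᵐ[P]
      (∑ i ∈ s, (LinearIsometry.toSpanSingleton ℝ (Lp ℝ 2 P) (hY.1 i))
        ((b.repr h : w → ℝ) i) : Lp ℝ 2 P) := by
    have h1 := Lp.coeFn_finsetSum s (fun i => (LinearIsometry.toSpanSingleton ℝ (Lp ℝ 2 P)
      (hY.1 i)) ((b.repr h : w → ℝ) i))
    have h2 : ∀ i, ((LinearIsometry.toSpanSingleton ℝ (Lp ℝ 2 P)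
      (hY.1 i)) ((b.repr h : w → ℝ) i) : Lp ℝ 2 P) =ᵐ[P]
        fun ω => (b.repr h : w → ℝ) i * X i ω := by
      intro i
      rw [LinearIsometry.toSpanSingleton_apply]
      filter_upwards [Lp.coeFn_smul ((b.repr h : w → ℝ) i) (Y i), (hX2 i).coeFn_toLp] with ω e1 e2
      rw [e1, Pi.smul_apply, smul_eq_mul, e2]
    have h3 : ∀ᵐ ω ∂P, ∀ i ∈ s, ((LinearIsometry.toSpanSingleton ℝ (Lp ℝ 2 P)
      (hY.1 i)) ((b.repr h : w → ℝ) i) : Lp ℝ 2 P) ω = (b.repr h : w → ℝ) i * X i ω :=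
      (Finset.eventually_all s).2 fun i _ => h2 i
    filter_upwards [h1, h3] with ω e1 e2
    rw [e1, Finset.sum_apply, Finset.sum_congr rfl e2,
      Finset.sum_coe_sort s (fun i => (b.repr h : w → ℝ) i * X i ω)]
  exact ⟨hs.congr hae, by rw [← integral_congr_ae hae]; exact hs0⟩

variable {E : Type} [MeasureSpace E]

/-- The indicator of a set of finite volume as an element of `L²`. -/
noncomputable abbrev indL2 (A : FiniteVolumeSet E) : Lp ℝ 2 (volume : Measure E) :=
  indicatorConstLp 2 A.2.1 A.2.2 (1 : ℝ)

variable [InvolutiveNeg E] [MeasurableNeg E] [(volume : Measure E).IsNegInvariant]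

lemma negSet_negSet (A : FiniteVolumeSet E) : negSet (negSet A) = A :=
  Subtype.ext (by ext; simp [negSet])

lemma volume_real_neg_inter (A B : FiniteVolumeSet E) :
    volume.real ((negSet A).1 ∩ B.1) = volume.real (A.1 ∩ (negSet B).1) := by
  have mp := Measure.measurePreserving_neg (volume : Measure E)
  have h : (negSet A).1 ∩ B.1 = (fun x => -x) ⁻¹' (A.1 ∩ (negSet B).1) := by
    ext x; simp [negSet]
  rw [h, measureReal_def, measureReal_def,
    mp.measure_preimage (A.2.1.inter (negSet B).2.1).nullMeasurableSet]

/-- Existence of the standard complex-valued Gaussian noise. -/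
theorem exists_isGaussianNoise :
    ∃ (Ω : Type) (_ : MeasurableSpace Ω) (P : Measure Ω) (_ : IsProbabilityMeasure P)
      (W : FiniteVolumeSet E → Ω → ℂ), IsGaussianNoise P W := by
  classical
  obtain ⟨Ω, mΩ, P, hP, G, hG⟩ := exists_isonormal (Lp ℝ 2 (volume : Measure E))
  -- `p A` and `m A` are the even and odd parts of the indicator of `A`, and `W(A) = G(p A) + i G(m
  -- A)`. Even and odd functions are orthogonal, so the covariance is `⟨1_A, 1_B⟩`; reflecting `A`
  -- fixes `p A` and changes the sign of `m A`, which is the Hermitian symmetry.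
  let p : FiniteVolumeSet E → Lp ℝ 2 (volume : Measure E) := fun A =>
    (1 / 2 : ℝ) • (indL2 A + indL2 (negSet A))
  let m : FiniteVolumeSet E → Lp ℝ 2 (volume : Measure E) := fun A =>
    (1 / 2 : ℝ) • (indL2 A - indL2 (negSet A))
  have hG2 : ∀ h, MemLp (G h) 2 P := fun h => Lp.memLp _
  have hGi : ∀ h k, ∫ ω, G h ω * G k ω ∂P = inner ℝ h k := by
    intro h k
    rw [← G.inner_map_map h k, L2.inner_def]
    refine integral_congr_ae (Eventually.of_forall fun ω => ?_)
    simp [RCLike.inner_apply, mul_comm]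
  have hGP : IsGaussianProcess (fun h ω => G h ω) P := by
    refine ⟨fun I => ?_⟩
    refine hasGaussianLaw_pi_of_forall_sum (X := fun (i : I) ω => G i ω) fun a => ?_
    refine (hG (∑ i : I, a i • i.1)).1.congr ?_
    rw [map_sum]
    have h1 := Lp.coeFn_finsetSum Finset.univ (fun i : I => G (a i • i.1))
    have h3 : ∀ᵐ ω ∂P, ∀ i ∈ (Finset.univ : Finset I), G (a i • i.1) ω = a i * G i.1 ω := by
      refine (Finset.eventually_all _).2 fun i _ => ?_
      rw [map_smul]
      filter_upwards [Lp.coeFn_smul (a i) (G i.1)] with ω e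
      rw [e, Pi.smul_apply, smul_eq_mul]
    filter_upwards [h1, h3] with ω e1 e2
    rw [e1, Finset.sum_apply, Finset.sum_congr rfl e2]
  refine ⟨Ω, mΩ, P, hP, fun A ω => (G (p A) ω : ℂ) + Complex.I * (G (m A) ω : ℂ), ?_⟩
  refine ⟨?_, ?_, ?_, ?_⟩
  · refine hGP.of_isGaussianProcess fun A => ⟨{p A, m A},
      Complex.ofRealCLM.comp (ContinuousLinearMap.proj ⟨p A, by simp⟩) +
      (Complex.I • Complex.ofRealCLM).comp (ContinuousLinearMap.proj ⟨m A, by simp⟩), fun ω => ?_⟩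
    simp
  · intro A
    have i1 : ∀ h, Integrable (fun ω => (G h ω : ℂ)) P := fun h =>
      ((hG2 h).integrable (by norm_num)).ofReal
    rw [integral_add (i1 _) ((i1 _).const_mul _), integral_const_mul, integral_complex_ofReal,
      integral_complex_ofReal, (hG _).2, (hG _).2]
    simp
  · intro A B
    have i2 : ∀ h k, Integrable (fun ω => ((G h ω * G k ω : ℝ) : ℂ)) P := fun h k =>
      ((hG2 h).integrable_mul (hG2 k)).ofReal
    have e : ∀ ω, ((G (p A) ω : ℂ) + Complex.I * (G (m A) ω : ℂ)) *
        (starRingEnd ℂ) ((G (p B) ω : ℂ) + Complex.I * (G (m B) ω : ℂ)) =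
        (((G (p A) ω * G (p B) ω : ℝ) : ℂ) + ((G (m A) ω * G (m B) ω : ℝ) : ℂ)) +
        (Complex.I * ((G (m A) ω * G (p B) ω : ℝ) : ℂ) -
          Complex.I * ((G (p A) ω * G (m B) ω : ℝ) : ℂ)) := by
      intro ω
      simp only [map_add, map_mul, Complex.conj_ofReal, Complex.conj_I]
      push_cast
      linear_combination (-(G (m A) ω : ℂ) * (G (m B) ω : ℂ)) * Complex.I_sq
    simp_rw [e]
    have j1 : ∀ h k h' k', Integrable (fun ω => ((G h ω * G k ω : ℝ) : ℂ) +
        ((G h' ω * G k' ω : ℝ) : ℂ)) P := fun h k h' k' => (i2 h k).add (i2 h' k')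
    have j2 : ∀ h k h' k', Integrable (fun ω => Complex.I * ((G h ω * G k ω : ℝ) : ℂ) -
        Complex.I * ((G h' ω * G k' ω : ℝ) : ℂ)) P := fun h k h' k' =>
      ((i2 h k).const_mul _).sub ((i2 h' k').const_mul _)
    rw [integral_add (j1 _ _ _ _) (j2 _ _ _ _),
      integral_add (i2 _ _) (i2 _ _), integral_sub ((i2 _ _).const_mul _) ((i2 _ _).const_mul _),
      integral_const_mul, integral_const_mul]
    simp_rw [integral_complex_ofReal, hGi]
    have v : ∀ A B : FiniteVolumeSet E, inner ℝ (indL2 A) (indL2 B) = volume.real (A.1 ∩ B.1) :=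
      fun A B => L2.real_inner_indicatorConstLp_one_indicatorConstLp_one A.2.1 B.2.1 A.2.2 B.2.2
    simp only [p, m, inner_smul_left, inner_smul_right, inner_add_left, inner_add_right,
      inner_sub_left, inner_sub_right, v, volume_real_neg_inter, negSet_negSet]
    simp only [conj_trivial]
    push_cast
    ring
  · intro A B hB
    have hB' : B = negSet A := Subtype.ext hB
    have hp : p B = p A := by simp only [p, hB', negSet_negSet, add_comm]
    have hm : m B = -m A := by simp only [m, hB', negSet_negSet, ← smul_neg, neg_sub]
    rw [hp, hm, map_neg]
    filter_upwards [Lp.coeFn_neg (G (m A))] with ω e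
    rw [e]
    simp

/-- A noise on `ℝ` obtained from a noise on `ℝ²`. -/
lemma IsGaussianNoise.slab {Ω : Type*} [MeasurableSpace Ω] {P : Measure Ω}
    {W : FiniteVolumeSet (ℝ × ℝ) → Ω → ℂ} (hW : IsGaussianNoise P W) :
    ∃ W₁ : FiniteVolumeSet ℝ → Ω → ℂ, IsGaussianNoise P W₁ := by
  have hv : volume (Set.Icc (-(1 / 2) : ℝ) (1 / 2)) = 1 := by
    rw [Real.volume_Icc]; norm_num
  -- The second factor has length one, so volumes are kept, and it is symmetric, so reflections are
  -- kept.
  let T : FiniteVolumeSet ℝ → FiniteVolumeSet (ℝ × ℝ) := fun A =>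
    ⟨A.1 ×ˢ Set.Icc (-(1 / 2) : ℝ) (1 / 2), A.2.1.prod measurableSet_Icc, by
      rw [Measure.volume_eq_prod, Measure.prod_prod, hv, mul_one]; exact A.2.2⟩
  refine ⟨fun A => W (T A), hW.gaussian.comp_right T, fun A => hW.mean_zero _, fun A B => ?_,
    fun A B hB => hW.hermitian _ _ ?_⟩
  · rw [hW.covariance]
    simp only [T]
    rw [Set.prod_inter_prod, Set.inter_self, measureReal_def, measureReal_def,
      Measure.volume_eq_prod, Measure.prod_prod, hv, mul_one]
  · ext ⟨x, y⟩
    simp only [T, hB, Set.mem_prod, Set.mem_preimage, Prod.neg_mk, Set.mem_Icc]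
    refine and_congr_right fun _ => ⟨fun h => ⟨by linarith [h.2], by linarith [h.1]⟩,
      fun h => ⟨by linarith [h.2], by linarith [h.1]⟩⟩

end Existence

theorem exists_noises : ∃ (Ω' : Type) (_ : MeasurableSpace Ω') (P' : MeasureTheory.Measure Ω')
      (_ : MeasureTheory.IsProbabilityMeasure P')
      (W : FiniteVolumeSet (ℝ × ℝ) → Ω' → ℂ) (W₁ : FiniteVolumeSet ℝ → Ω' → ℂ),
      IsGaussianNoise P' W ∧ IsGaussianNoise P' W₁ := by
  obtain ⟨Ω, m, P, hP, W, hW⟩ := exists_isGaussianNoise (E := ℝ × ℝ)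
  obtain ⟨W₁, hW₁⟩ := hW.slab
  exact ⟨Ω, m, P, hP, W, W₁, hW, hW₁⟩

end

section

/-! ### The kernels `e_x` and the density `h` -/

/-- `|e_x(u)|²`. -/
noncomputable def sqKernel (x u : ℝ) : ℝ := 2 * (1 - Real.cos (x * u)) / u ^ 2

lemma sqKernel_nonneg (x u : ℝ) : 0 ≤ sqKernel x u :=
  div_nonneg (by linarith [Real.cos_le_one (x * u)]) (sq_nonneg _)

@[simp] lemma sqKernel_zero_left (u : ℝ) : sqKernel 0 u = 0 := by simp [sqKernel]

@[simp] lemma sqKernel_neg_left (x u : ℝ) : sqKernel (-x) u = sqKernel x u := by simp [sqKernel]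

@[fun_prop] lemma measurable_sqKernel (x : ℝ) : Measurable (sqKernel x) := by
  unfold sqKernel; fun_prop

lemma sqKernel_mul_left {l : ℝ} (hl : l ≠ 0) (x u : ℝ) :
    sqKernel (l * x) u = l ^ 2 * sqKernel x (l * u) := by
  rcases eq_or_ne u 0 with rfl | hu
  · simp [sqKernel]
  · simp only [sqKernel]
    rw [show l * x * u = x * (l * u) by ring]
    field_simp

/-- The sum of the two bounds `|e_x|² ≤ x²` and `|e_x|² u² ≤ 4`. The resulting majorant `(1 + u²)⁻¹`
is also the one that controls the Dirichlet sums. -/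
lemma sqKernel_mul_one_add_sq_le (x u : ℝ) : sqKernel x u * (1 + u ^ 2) ≤ x ^ 2 + 4 := by
  rcases eq_or_ne u 0 with rfl | hu
  · simp [sqKernel]; positivity
  have hu2 : 0 < u ^ 2 := by positivity
  have h1 : sqKernel x u ≤ x ^ 2 := by
    rw [sqKernel, div_le_iff₀ hu2]
    nlinarith [Real.one_sub_sq_div_two_le_cos (x := x * u)]
  have h2 : sqKernel x u * u ^ 2 ≤ 4 := by
    rw [sqKernel, div_mul_cancel₀ _ hu2.ne']
    linarith [Real.neg_one_le_cos (x * u)]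
  linarith

lemma sqKernel_le (x u : ℝ) : sqKernel x u ≤ (x ^ 2 + 4) * (1 + u ^ 2)⁻¹ := by
  rw [← div_eq_mul_inv, le_div_iff₀ (by positivity)]
  exact sqKernel_mul_one_add_sq_le x u

lemma sqKernel_pos {x u : ℝ} (hx : 0 < x * u) (hx' : x * u < 2 * Real.pi) : 0 < sqKernel x u := by
  have hu : u ≠ 0 := by rintro rfl; simp at hx
  refine div_pos ?_ (by positivity)
  have : Real.cos (x * u) ≠ 1 := by
    intro h
    rw [Real.cos_eq_one_iff_of_lt_of_lt (by linarith [Real.pi_pos]) hx'] at h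
    exact hx.ne' h
  have := lt_of_le_of_ne (Real.cos_le_one _) this
  linarith

lemma expKernel_eq (x u : ℝ) : expKernel x u =
    (-Real.sin (x * u) / u : ℝ) - Complex.I * ((1 - Real.cos (x * u)) / u : ℝ) := by
  rcases eq_or_ne u 0 with rfl | hu
  · simp [expKernel]
  have hu' : (u : ℂ) ≠ 0 := by exact_mod_cast hu
  have : Complex.exp (Complex.I * (u * x)) =
      Real.cos (x * u) + Real.sin (x * u) * Complex.I := by
    rw [show Complex.I * ((u : ℂ) * x) = ((x * u : ℝ) : ℂ) * Complex.I by push_cast; ring,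
      Complex.exp_mul_I, Complex.ofReal_cos, Complex.ofReal_sin]
  rw [expKernel, this, div_eq_iff (mul_ne_zero Complex.I_ne_zero hu')]
  push_cast
  field_simp
  linear_combination ((1 - Complex.cos (x * u))) * Complex.I_sq

lemma expKernel_re (x u : ℝ) : (expKernel x u).re = -Real.sin (x * u) / u := by
  rw [expKernel_eq]
  simp only [Complex.sub_re, Complex.mul_re, Complex.I_re, Complex.I_im, Complex.ofReal_re,
    Complex.ofReal_im]
  ring

lemma expKernel_im (x u : ℝ) : (expKernel x u).im = -((1 - Real.cos (x * u)) / u) := by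
  rw [expKernel_eq]
  simp only [Complex.sub_im, Complex.mul_im, Complex.I_re, Complex.I_im, Complex.ofReal_re,
    Complex.ofReal_im]
  ring

lemma expKernel_neg (x u : ℝ) : expKernel x (-u) = (starRingEnd ℂ) (expKernel x u) := by
  apply Complex.ext
  · simp only [expKernel_re, Complex.conj_re, mul_neg, Real.sin_neg]; ring
  · simp only [expKernel_im, Complex.conj_im, mul_neg, Real.cos_neg]; ring

/-- Polarization, because `e_x - e_y` and `e_{x-y}` differ by a factor of modulus one. -/
lemma expKernel_re_mul_conj (x y u : ℝ) :
    (expKernel x u * (starRingEnd ℂ) (expKernel y u)).re =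
      (sqKernel x u + sqKernel y u - sqKernel (x - y) u) / 2 := by
  rcases eq_or_ne u 0 with rfl | hu
  · simp [expKernel, sqKernel]
  simp only [Complex.mul_re, Complex.conj_re, Complex.conj_im, expKernel_re, expKernel_im, sqKernel]
  rw [sub_mul, Real.cos_sub]
  field_simp
  ring

lemma expKernel_norm_sq (x u : ℝ) : ‖expKernel x u‖ ^ 2 = sqKernel x u := by
  have h := expKernel_re_mul_conj x x u
  rw [Complex.mul_conj, sub_self, sqKernel_zero_left, Complex.ofReal_re] at h
  rw [← Complex.normSq_eq_norm_sq, h]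
  ring

@[fun_prop] lemma measurable_expKernel (x : ℝ) : Measurable (expKernel x) := by
  unfold expKernel; fun_prop

/-- The model integrand `|u|^{-a}/(1+u²)`. -/
lemma integrable_rpow_mul_inv {a : ℝ} (ha : 0 ≤ a) (ha1 : a < 1) :
    Integrable (fun u : ℝ => (1 + u ^ 2)⁻¹ * |u| ^ (-a)) := by
  have h0 : IntervalIntegrable (fun u : ℝ => |u| ^ (-a)) volume 0 1 := by
    refine (intervalIntegral.intervalIntegrable_rpow' (r := -a) (by linarith)).congr ?_
    intro u hu
    rw [Set.uIoc_of_le zero_le_one] at hu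
    simp only [abs_of_pos hu.1]
  have h1 : IntervalIntegrable (fun u : ℝ => |u| ^ (-a)) volume (-1) 0 := by
    have := (IntervalIntegrable.iff_comp_neg (by simp)).1 h0
    simp only [abs_neg, neg_zero] at this
    exact this.symm
  have h2 : IntegrableOn (fun u : ℝ => |u| ^ (-a)) (Set.Ioc (-1) 1) :=
    (intervalIntegrable_iff_integrableOn_Ioc_of_le (by norm_num)).1 (h1.trans h0)
  have h3 := (integrable_indicator_iff measurableSet_Ioc).2 h2
  refine (h3.add integrable_inv_one_add_sq).mono' (by fun_prop) (Eventually.of_forall fun u => ?_)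
  have hp : 0 ≤ |u| ^ (-a) := by positivity
  have hi : 0 < (1 + u ^ 2)⁻¹ := by positivity
  rw [Real.norm_of_nonneg (by positivity), Pi.add_apply]
  by_cases hu : u ∈ Set.Ioc (-1 : ℝ) 1
  · rw [Set.indicator_of_mem hu]
    have : (1 + u ^ 2)⁻¹ ≤ 1 := inv_le_one_of_one_le₀ (by nlinarith [sq_nonneg u])
    nlinarith
  · rw [Set.indicator_of_notMem hu, zero_add]
    have h1u : 1 ≤ |u| := by
      by_contra hlt
      push Not at hlt
      have := abs_lt.1 hlt
      exact hu ⟨this.1, this.2.le⟩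
    have : |u| ^ (-a) ≤ 1 := Real.rpow_le_one_of_one_le_of_nonpos h1u (by linarith)
    nlinarith

lemma integrable_sqKernel_mul_rpow (x : ℝ) {a : ℝ} (ha : 0 ≤ a) (ha1 : a < 1) :
    Integrable (fun u : ℝ => sqKernel x u * |u| ^ (-a)) := by
  refine ((integrable_rpow_mul_inv ha ha1).const_mul (x ^ 2 + 4)).mono' (by fun_prop)
    (Eventually.of_forall fun u => ?_)
  have hp : 0 ≤ |u| ^ (-a) := by positivity
  rw [Real.norm_of_nonneg (mul_nonneg (sqKernel_nonneg _ _) hp), ← mul_assoc]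
  exact mul_le_mul_of_nonneg_right (sqKernel_le x u) hp

/-- The scaling relation `∫ |e_x|² |u|^{-a} = |x|^{1+a} ∫ |e_1|² |u|^{-a}`. -/
lemma integral_sqKernel_mul_rpow (x : ℝ) {a : ℝ} (ha : 0 ≤ a) :
    ∫ u, sqKernel x u * |u| ^ (-a) = |x| ^ (1 + a) * ∫ u, sqKernel 1 u * |u| ^ (-a) := by
  rcases eq_or_ne x 0 with rfl | hx
  · simp [Real.zero_rpow (by linarith : 1 + a ≠ 0)]
  have hx' : 0 < |x| := abs_pos.2 hx
  have h := Measure.integral_comp_mul_left (fun u => sqKernel 1 u * |u| ^ (-a)) x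
  have e : ∀ u, sqKernel x u * |u| ^ (-a) =
      |x| ^ (2 + a) * (sqKernel 1 (x * u) * |x * u| ^ (-a)) := by
    intro u
    have h1 := sqKernel_mul_left hx 1 u
    rw [mul_one] at h1
    rw [h1, abs_mul, Real.mul_rpow hx'.le (abs_nonneg u), Real.rpow_add hx', ← sq_abs x,
      Real.rpow_neg hx'.le]
    norm_cast
    field_simp
  simp_rw [e]
  rw [integral_const_mul, h, smul_eq_mul, ← mul_assoc, abs_inv]
  congr 1
  rw [show (2 : ℝ) + a = (1 + a) + 1 by ring, Real.rpow_add_one hx'.ne']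
  field_simp

lemma integral_sqKernel_mul_rpow_pos {a : ℝ} (ha : 0 ≤ a) (ha1 : a < 1) :
    0 < ∫ u, sqKernel 1 u * |u| ^ (-a) := by
  rw [integral_pos_iff_support_of_nonneg
    (fun u => mul_nonneg (sqKernel_nonneg _ _) (by positivity)) (integrable_sqKernel_mul_rpow 1 ha ha1)]
  refine lt_of_lt_of_le (b := volume (Set.Ioo (0 : ℝ) 1)) (by simp) (measure_mono fun u hu => ?_)
  refine (mul_pos (sqKernel_pos (by simpa using hu.1) ?_) ?_).ne'
  · have := Real.pi_gt_three; linarith [hu.2]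
  · exact Real.rpow_pos_of_pos (abs_pos.2 hu.1.ne') _

/-! ### Scaling, bounds and integrability of `h` -/

section Density

variable {H₁ H₂ c : ℝ}

lemma hFun_nonneg (hc : 0 < c) (p : ℝ × ℝ) : 0 ≤ hFun H₁ H₂ c p := by
  unfold hFun; positivity

@[fun_prop] lemma measurable_hFun : Measurable (hFun H₁ H₂ c) := by
  unfold hFun; fun_prop

lemma hFun_neg_left (u v : ℝ) : hFun H₁ H₂ c (-u, v) = hFun H₁ H₂ c (u, v) := by simp [hFun]

lemma hFun_neg (p : ℝ × ℝ) : hFun H₁ H₂ c (-p) = hFun H₁ H₂ c p := by simp [hFun]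

lemma hFun_pos (hc : 0 < c) {p : ℝ × ℝ} (hp : p.1 ≠ 0) : 0 < hFun H₁ H₂ c p := by
  unfold hFun
  have : 0 < |p.1| ^ 2 := by positivity
  positivity

/-- Anisotropic scaling of `h`. -/
lemma hFun_scale (hH₁ : 0 < H₁) (hH₂ : 0 < H₂) (hc : 0 < c) {l : ℝ} (hl : 0 < l) (u v : ℝ) :
    hFun H₁ H₂ c (l * u, l ^ (H₁ / H₂) * v) = l ^ (-H₁) * hFun H₁ H₂ c (u, v) := by
  have h1 : (l ^ (H₁ / H₂)) ^ (2 * H₂ / H₁) = l ^ (2 : ℝ) := by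
    rw [← Real.rpow_mul hl.le]; congr 1; field_simp
  have h2 : |l * u| ^ 2 + c * |l ^ (H₁ / H₂) * v| ^ (2 * H₂ / H₁) =
      l ^ (2 : ℝ) * (|u| ^ 2 + c * |v| ^ (2 * H₂ / H₁)) := by
    rw [abs_mul, abs_mul, abs_of_pos hl, abs_of_pos (Real.rpow_pos_of_pos hl _),
      Real.mul_rpow (by positivity) (abs_nonneg v), h1, Real.rpow_two]
    ring
  simp only [hFun]
  rw [h2, Real.mul_rpow (by positivity) (by positivity), ← Real.rpow_mul hl.le,
    show 2 * (H₁ / 2) = H₁ by ring, Real.rpow_neg hl.le]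
  field_simp

lemma hFun_le_left (hH₁ : 0 < H₁) (hc : 0 < c) {u : ℝ} (hu : u ≠ 0) (v : ℝ) :
    hFun H₁ H₂ c (u, v) ≤ |u| ^ (-H₁) := by
  have hu' : 0 < |u| := abs_pos.2 hu
  have h : |u| ^ H₁ ≤ (|u| ^ 2 + c * |v| ^ (2 * H₂ / H₁)) ^ (H₁ / 2) := by
    calc |u| ^ H₁ = (|u| ^ 2) ^ (H₁ / 2) := by
          rw [← Real.rpow_two, ← Real.rpow_mul hu'.le]; congr 1; ring
      _ ≤ _ := Real.rpow_le_rpow (by positivity) (le_add_of_nonneg_right (by positivity))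
          (by positivity)
  rw [Real.rpow_neg hu'.le, ← one_div]
  exact one_div_le_one_div_of_le (Real.rpow_pos_of_pos hu' _) h

lemma rpow_base_right (hH₁ : 0 < H₁) (hc : 0 < c) (v : ℝ) :
    (c * |v| ^ (2 * H₂ / H₁)) ^ (H₁ / 2) = c ^ (H₁ / 2) * |v| ^ H₂ := by
  rw [Real.mul_rpow hc.le (by positivity), ← Real.rpow_mul (abs_nonneg v)]
  congr 2; field_simp

lemma hFun_le_right (hH₁ : 0 < H₁) (hc : 0 < c) {v : ℝ} (hv : v ≠ 0) (u : ℝ) :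
    hFun H₁ H₂ c (u, v) ≤ c ^ (-H₁ / 2) * |v| ^ (-H₂) := by
  have hv' : 0 < |v| := abs_pos.2 hv
  have h : c ^ (H₁ / 2) * |v| ^ H₂ ≤ (|u| ^ 2 + c * |v| ^ (2 * H₂ / H₁)) ^ (H₁ / 2) := by
    rw [← rpow_base_right hH₁ hc]
    exact Real.rpow_le_rpow (by positivity) (le_add_of_nonneg_left (by positivity)) (by positivity)
  rw [Real.rpow_neg hv'.le, neg_div, Real.rpow_neg hc.le, ← mul_inv, ← one_div]
  exact one_div_le_one_div_of_le (by positivity) h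

/-- Interpolation between the two bounds. -/
lemma hFun_le_mul (hH₁ : 0 < H₁) (hc : 0 < c) {u v : ℝ} (hu : u ≠ 0) (hv : v ≠ 0) :
    hFun H₁ H₂ c (u, v) ≤ c ^ (-H₁ / 4) * (|u| ^ (-(H₁ / 2)) * |v| ^ (-(H₂ / 2))) := by
  have hu' : 0 < |u| := abs_pos.2 hu
  have hv' : 0 < |v| := abs_pos.2 hv
  have h1 := hFun_le_left (H₂ := H₂) hH₁ hc hu v
  have h2 := hFun_le_right (H₂ := H₂) hH₁ hc hv u
  have h0 := hFun_nonneg (H₁ := H₁) (H₂ := H₂) hc (u, v)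
  have e1 : |u| ^ (-H₁) = (|u| ^ (-(H₁ / 2))) ^ 2 := by
    rw [← Real.rpow_natCast, ← Real.rpow_mul hu'.le]; congr 1; push_cast; ring
  have e2 : |v| ^ (-H₂) = (|v| ^ (-(H₂ / 2))) ^ 2 := by
    rw [← Real.rpow_natCast, ← Real.rpow_mul hv'.le]; congr 1; push_cast; ring
  have e3 : c ^ (-H₁ / 2) = (c ^ (-H₁ / 4)) ^ 2 := by
    rw [← Real.rpow_natCast, ← Real.rpow_mul hc.le]; congr 1; push_cast; ring
  rw [e1] at h1
  rw [e2, e3] at h2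
  refine (sq_le_sq₀ h0 (by positivity)).1 ?_
  calc (hFun H₁ H₂ c (u, v)) ^ 2 = hFun H₁ H₂ c (u, v) * hFun H₁ H₂ c (u, v) := sq _
    _ ≤ _ := mul_le_mul h1 h2 h0 (by positivity)
    _ = _ := by ring

lemma ae_ne_zero_prod : ∀ᵐ q : ℝ × ℝ, q.1 ≠ 0 ∧ q.2 ≠ 0 := by
  have h1 : ∀ᵐ q : ℝ × ℝ, q.1 ≠ 0 :=
    (Measure.quasiMeasurePreserving_fst (μ := (volume : Measure ℝ)) (ν := (volume : Measure ℝ))).ae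
      (Measure.ae_ne volume 0)
  have h2 : ∀ᵐ q : ℝ × ℝ, q.2 ≠ 0 :=
    (Measure.quasiMeasurePreserving_snd (μ := (volume : Measure ℝ)) (ν := (volume : Measure ℝ))).ae
      (Measure.ae_ne volume 0)
  exact h1.and h2

lemma integrable_inv_mul_rpow_prod {a b : ℝ} (ha : 0 ≤ a) (ha1 : a < 1) (hb : 0 ≤ b)
    (hb1 : b < 1) : Integrable (fun q : ℝ × ℝ =>
      ((1 + q.1 ^ 2)⁻¹ * |q.1| ^ (-a)) * ((1 + q.2 ^ 2)⁻¹ * |q.2| ^ (-b))) :=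
  (integrable_rpow_mul_inv ha ha1).mul_prod (integrable_rpow_mul_inv hb hb1)

/-- The geometric mean of the two one-variable bounds on `h` has exponents `H₁/2` and `H₂/2`, both
below `1`; each bound alone would fail on its axis once its exponent reaches `1`. -/
lemma integrable_inv_mul_hFun (hH₁ : 0 < H₁) (hH₁2 : H₁ < 2) (hH₂0 : 0 < H₂) (hH₂ : H₂ < 2)
    (hc : 0 < c) :
    Integrable (fun q : ℝ × ℝ => (1 + q.1 ^ 2)⁻¹ * (1 + q.2 ^ 2)⁻¹ * hFun H₁ H₂ c q) := by
  refine ((integrable_inv_mul_rpow_prod (a := H₁ / 2) (b := H₂ / 2) (by linarith) (by linarith)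
    (by linarith) (by linarith)).const_mul (c ^ (-H₁ / 4))).mono' (by fun_prop) ?_
  filter_upwards [ae_ne_zero_prod] with q hq
  rw [Real.norm_of_nonneg (mul_nonneg (by positivity) (hFun_nonneg hc q))]
  have := hFun_le_mul (H₂ := H₂) hH₁ hc hq.1 hq.2
  calc _ ≤ (1 + q.1 ^ 2)⁻¹ * (1 + q.2 ^ 2)⁻¹ *
        (c ^ (-H₁ / 4) * (|q.1| ^ (-(H₁ / 2)) * |q.2| ^ (-(H₂ / 2)))) :=
        mul_le_mul_of_nonneg_left this (by positivity)
    _ = _ := by ring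

/-- For `H₁ > 1` decay in the first variable comes from `h` alone. -/
lemma integrable_inv_snd_mul_hFun (hH₁ : 1 < H₁) (hH₁2 : H₁ < 2) (hH₂0 : 0 < H₂) (hH₂ : H₂ < 2)
    (hc : 0 < c) : Integrable (fun q : ℝ × ℝ => (1 + q.2 ^ 2)⁻¹ * hFun H₁ H₂ c q) := by
  have i1 := ((integrable_inv_mul_hFun (by linarith : 0 < H₁) hH₁2 hH₂0 hH₂ hc).const_mul 2)
  have i2 : Integrable (fun u : ℝ => (1 + u ^ 2) ^ (-(H₁ / 2))) := by
    have := integrable_rpow_neg_one_add_norm_sq (E := ℝ) (μ := volume) (r := H₁) (by simpa using hH₁)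
    simpa [neg_div] using this
  have i3 := (i2.mul_prod (integrable_inv_one_add_sq)).const_mul (2 ^ (H₁ / 2))
  refine (i1.add i3).mono' (by fun_prop) ?_
  filter_upwards [ae_ne_zero_prod] with q hq
  have h0 := hFun_nonneg (H₁ := H₁) (H₂ := H₂) hc q
  rw [Real.norm_of_nonneg (mul_nonneg (by positivity) h0), Pi.add_apply]
  have hi : 0 < (1 + q.2 ^ 2)⁻¹ := by positivity
  -- For `|u| ≤ 1` the missing factor `(1 + u²)⁻¹` is at least `1/2` and the previous lemma applies;
  -- for `|u| > 1` use `|u|^{-H₁}`, integrable at infinity as `H₁ > 1`.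
  by_cases h : |q.1| ≤ 1
  · have h1 : (1 : ℝ) ≤ 2 * (1 + q.1 ^ 2)⁻¹ := by
      rw [← div_eq_mul_inv, le_div_iff₀ (by positivity)]
      have : q.1 ^ 2 ≤ 1 := by rw [← sq_abs]; nlinarith [abs_nonneg q.1]
      linarith
    have h2 : 0 ≤ 2 ^ (H₁ / 2) * ((1 + q.1 ^ 2) ^ (-(H₁ / 2)) * (1 + q.2 ^ 2)⁻¹) := by positivity
    have h3 : 0 ≤ (1 + q.2 ^ 2)⁻¹ * hFun H₁ H₂ c q := by positivity
    nlinarith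
  · push Not at h
    have h1 : hFun H₁ H₂ c q ≤ 2 ^ (H₁ / 2) * (1 + q.1 ^ 2) ^ (-(H₁ / 2)) := by
      refine (hFun_le_left (H₂ := H₂) (by linarith : 0 < H₁) hc hq.1 q.2).trans ?_
      have hq1 : 0 < |q.1| := by linarith
      have e : 2 ^ (H₁ / 2) * (1 + q.1 ^ 2) ^ (-(H₁ / 2)) = ((1 + q.1 ^ 2) / 2) ^ (-(H₁ / 2)) := by
        rw [Real.div_rpow (by positivity) (by norm_num), Real.rpow_neg (by norm_num : (0:ℝ) ≤ 2),
          div_inv_eq_mul, mul_comm]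
      have e2 : |q.1| ^ (-H₁) = (q.1 ^ 2) ^ (-(H₁ / 2)) := by
        rw [← sq_abs, ← Real.rpow_two, ← Real.rpow_mul hq1.le]; congr 1; ring
      rw [e, e2]
      refine Real.rpow_le_rpow_of_nonpos (by positivity) ?_ (by linarith)
      have : 1 ≤ q.1 ^ 2 := by rw [← sq_abs]; nlinarith
      linarith
    have h2 : 0 ≤ 2 * ((1 + q.1 ^ 2)⁻¹ * (1 + q.2 ^ 2)⁻¹ * hFun H₁ H₂ c q) := by positivity
    have h3 := mul_le_mul_of_nonneg_left h1 hi.le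
    have e3 : (1 + q.2 ^ 2)⁻¹ * (2 ^ (H₁ / 2) * (1 + q.1 ^ 2) ^ (-(H₁ / 2))) =
      2 ^ (H₁ / 2) * ((1 + q.1 ^ 2) ^ (-(H₁ / 2)) * (1 + q.2 ^ 2)⁻¹) := by ring
    linarith

/-- For `H₂ > 1` decay in the second variable comes from `h` alone. -/
lemma integrable_inv_fst_mul_hFun (hH₁ : 0 < H₁) (hH₁2 : H₁ < 2) (hH₂1 : 1 < H₂) (hH₂ : H₂ < 2)
    (hc : 0 < c) : Integrable (fun q : ℝ × ℝ => (1 + q.1 ^ 2)⁻¹ * hFun H₁ H₂ c q) := by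
  have i1 := ((integrable_inv_mul_hFun hH₁ hH₁2 (by linarith : 0 < H₂) hH₂ hc).const_mul 2)
  have i2 : Integrable (fun u : ℝ => (1 + u ^ 2) ^ (-(H₂ / 2))) := by
    have := integrable_rpow_neg_one_add_norm_sq (E := ℝ) (μ := volume) (r := H₂) (by simpa using hH₂1)
    simpa [neg_div] using this
  have i3 := ((integrable_inv_one_add_sq).mul_prod i2).const_mul (c ^ (-H₁ / 2) * 2 ^ (H₂ / 2))
  refine (i1.add i3).mono' (by fun_prop) ?_
  filter_upwards [ae_ne_zero_prod] with q hq
  have h0 := hFun_nonneg (H₁ := H₁) (H₂ := H₂) hc q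
  rw [Real.norm_of_nonneg (mul_nonneg (by positivity) h0), Pi.add_apply]
  have hi : 0 < (1 + q.1 ^ 2)⁻¹ := by positivity
  by_cases h : |q.2| ≤ 1
  · have h1 : (1 : ℝ) ≤ 2 * (1 + q.2 ^ 2)⁻¹ := by
      rw [← div_eq_mul_inv, le_div_iff₀ (by positivity)]
      have : q.2 ^ 2 ≤ 1 := by rw [← sq_abs]; nlinarith [abs_nonneg q.2]
      linarith
    have h2 : 0 ≤ c ^ (-H₁ / 2) * 2 ^ (H₂ / 2) *
      ((1 + q.1 ^ 2)⁻¹ * (1 + q.2 ^ 2) ^ (-(H₂ / 2))) := by positivity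
    have h3 : 0 ≤ (1 + q.1 ^ 2)⁻¹ * hFun H₁ H₂ c q := by positivity
    nlinarith
  · push Not at h
    have h1 : hFun H₁ H₂ c q ≤ c ^ (-H₁ / 2) * (2 ^ (H₂ / 2) * (1 + q.2 ^ 2) ^ (-(H₂ / 2))) := by
      refine (hFun_le_right (H₂ := H₂) hH₁ hc hq.2 q.1).trans ?_
      have hq1 : 0 < |q.2| := by linarith
      have e : 2 ^ (H₂ / 2) * (1 + q.2 ^ 2) ^ (-(H₂ / 2)) = ((1 + q.2 ^ 2) / 2) ^ (-(H₂ / 2)) := by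
        rw [Real.div_rpow (by positivity) (by norm_num), Real.rpow_neg (by norm_num : (0:ℝ) ≤ 2),
          div_inv_eq_mul, mul_comm]
      have e2 : |q.2| ^ (-H₂) = (q.2 ^ 2) ^ (-(H₂ / 2)) := by
        rw [← sq_abs, ← Real.rpow_two, ← Real.rpow_mul hq1.le]; congr 1; ring
      rw [e, e2]
      refine mul_le_mul_of_nonneg_left ?_ (by positivity)
      refine Real.rpow_le_rpow_of_nonpos (by positivity) ?_ (by linarith)
      have : 1 ≤ q.2 ^ 2 := by rw [← sq_abs]; nlinarith
      linarith
    have h2 : 0 ≤ 2 * ((1 + q.1 ^ 2)⁻¹ * (1 + q.2 ^ 2)⁻¹ * hFun H₁ H₂ c q) := by positivity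
    have h3 := mul_le_mul_of_nonneg_left h1 hi.le
    have e3 : (1 + q.1 ^ 2)⁻¹ * (c ^ (-H₁ / 2) * (2 ^ (H₂ / 2) * (1 + q.2 ^ 2) ^ (-(H₂ / 2)))) =
      c ^ (-H₁ / 2) * 2 ^ (H₂ / 2) * ((1 + q.1 ^ 2)⁻¹ * (1 + q.2 ^ 2) ^ (-(H₂ / 2))) := by ring
    linarith

end Density

end

section

/-! ### Gaussian fields with a covariance generated by a variogram -/

/-- `f x + f y - f (x - y)`. -/
def polar (f : ℝ → ℝ) (x y : ℝ) : ℝ := f x + f y - f (x - y)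

/-- The covariance generated by `Φ`. -/
noncomputable def covOf (Φ : ℝ → ℝ → ℝ) (p q : ℝ × ℝ) : ℝ :=
  polar (fun A => polar (fun B => Φ A B) p.2 q.2) p.1 q.1 / 4

/-- `V` is a centred Gaussian field on the closed quadrant whose covariance is generated by `Φ`. -/
structure IsVariogramField {Ω : Type*} [MeasurableSpace Ω] (P : Measure Ω) (V : ℝ × ℝ → Ω → ℝ)
    (Φ : ℝ → ℝ → ℝ) : Prop where
  gaussian : ∀ {ι : Type} [Fintype ι] (p : ι → ℝ × ℝ), (∀ i, p i ∈ closedQuadrant) →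
    HasGaussianLaw (fun ω i => V (p i) ω) P
  centered : ∀ p ∈ closedQuadrant, ∫ ω, V p ω ∂P = 0
  cov : ∀ p ∈ closedQuadrant, ∀ q ∈ closedQuadrant, ∫ ω, V p ω * V q ω ∂P = covOf Φ p q

section Variogram

variable {Ω : Type*} [MeasurableSpace Ω] {P : Measure Ω} {V : ℝ × ℝ → Ω → ℝ} {Φ : ℝ → ℝ → ℝ}

lemma IsVariogramField.isGaussianProcess (hV : IsVariogramField P V Φ) :
    IsGaussianProcess (fun p : closedQuadrant => V p) P :=
  ⟨fun I => hV.gaussian (fun i : I => i.1.1) fun i => i.1.2⟩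

lemma covOf_smul {r : ℝ} (Φ' : ℝ → ℝ → ℝ) {a b : ℝ} (h : ∀ x y, Φ' (a * x) (b * y) = r * Φ x y)
    (p q : ℝ × ℝ) :
    covOf Φ' (a * p.1, b * p.2) (a * q.1, b * q.2) = r * covOf Φ p q := by
  simp only [covOf, polar, ← mul_sub, h]
  ring

lemma IsVariogramField.operatorScaling (hV : IsVariogramField P V Φ) {γ H : ℝ}
    (h : ∀ l : ℝ, 0 < l → ∀ x y, Φ (l * x) (l ^ γ * y) = l ^ (2 * H) * Φ x y) :
    OperatorScaling P V γ H := by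
  intro l hl k p hp
  have hlγ : 0 < l ^ γ := Real.rpow_pos_of_pos hl γ
  have hq : ∀ i, (l * (p i).1, l ^ γ * (p i).2) ∈ closedQuadrant := fun i =>
    ⟨mul_nonneg hl.le (hp i).1, mul_nonneg hlγ.le (hp i).2⟩
  refine identDistrib_of_covariance_eq (X := fun i ω => V (l * (p i).1, l ^ γ * (p i).2) ω)
    (Z := fun i ω => l ^ H * V (p i) ω) (hV.gaussian _ hq) (fun i => hV.centered _ (hq i))
    ?_ (fun i => ?_) fun i j => ?_
  · have := (hV.gaussian p hp).fun_smul (l ^ H)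
    simpa [Pi.smul_def] using this
  · rw [integral_const_mul, hV.centered _ (hp i), mul_zero]
  · rw [hV.cov _ (hq i) _ (hq j), covOf_smul Φ (h l hl), ← hV.cov _ (hp i) _ (hp j),
      ← integral_const_mul]
    refine integral_congr_ae (Eventually.of_forall fun ω => ?_)
    have : l ^ (2 * H) = l ^ H * l ^ H := by rw [← Real.rpow_add hl]; congr 1; ring
    simp only [this]; ring

lemma closedQuadrant_swap {p : ℝ × ℝ} (hp : p ∈ closedQuadrant) : p.swap ∈ closedQuadrant :=
  ⟨hp.2, hp.1⟩

lemma IsVariogramField.swap (hV : IsVariogramField P V Φ) :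
    IsVariogramField P (fun p => V p.swap) (fun x y => Φ y x) where
  gaussian p hp := hV.gaussian (fun i => (p i).swap) fun i => closedQuadrant_swap (hp i)
  centered p hp := hV.centered _ (closedQuadrant_swap hp)
  cov p hp q hq := by
    rw [hV.cov _ (closedQuadrant_swap hp) _ (closedQuadrant_swap hq)]
    simp only [covOf, polar, Prod.fst_swap, Prod.snd_swap]
    ring

lemma IsVariogramField.congr {Φ' : ℝ → ℝ → ℝ} (hV : IsVariogramField P V Φ)
    (h : ∀ x y, Φ x y = Φ' x y) : IsVariogramField P V Φ' := by
  have : Φ = Φ' := funext fun x => funext fun y => h x y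
  rwa [← this]

end Variogram

/-! ### Covariance of fields that are integrals over `ℝ²` -/

section Plane

variable {s w : ℝ × ℝ → ℝ}

/-- The kernel `e_x(u) e_y(v) s(u,v)`. -/
noncomputable def planeKernel (s : ℝ × ℝ → ℝ) (x y : ℝ) (q : ℝ × ℝ) : ℂ :=
  expKernel x q.1 * expKernel y q.2 * (s q : ℝ)

lemma planeKernel_norm_sq (hsw : ∀ q, s q ^ 2 = w q) (x y : ℝ) (q : ℝ × ℝ) :
    ‖planeKernel s x y q‖ ^ 2 = sqKernel x q.1 * sqKernel y q.2 * w q := by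
  simp only [planeKernel, norm_mul, mul_pow, expKernel_norm_sq, Complex.norm_real, Real.norm_eq_abs,
    sq_abs, hsw]

lemma memLp_planeKernel (hs : Measurable s) (hsw : ∀ q, s q ^ 2 = w q)
    {x y : ℝ} (hint : Integrable (fun q : ℝ × ℝ => sqKernel x q.1 * sqKernel y q.2 * w q)) :
    MemLp (planeKernel s x y) 2 volume := by
  rw [memLp_two_iff_integrable_sq_norm (by unfold planeKernel; fun_prop)]
  simpa only [planeKernel_norm_sq hsw] using hint

lemma planeKernel_neg (hs : ∀ q, s (-q) = s q) (x y : ℝ) (q : ℝ × ℝ) :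
    planeKernel s x y (-q) = (starRingEnd ℂ) (planeKernel s x y q) := by
  simp only [planeKernel, hs, Prod.fst_neg, Prod.snd_neg, expKernel_neg, map_mul,
    Complex.conj_ofReal]

lemma measurePreserving_neg_fst :
    MeasurePreserving (fun q : ℝ × ℝ => (-q.1, q.2)) volume volume :=
  (Measure.measurePreserving_neg (volume : Measure ℝ)).prod (MeasurePreserving.id volume)

/-- The integrand is `α β w`, with `α` depending on `u` and `β` on `v`. Averaging over `u ↦ -u`,
which conjugates `α` and fixes `w`, removes the term `Im α Im β`; the remaining `Re α Re β`
polarizes in each variable separately. -/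
lemma integral_planeKernel_mul_conj_re (hs : Measurable s) (hsw : ∀ q, s q ^ 2 = w q)
    (hw : ∀ u v, w (-u, v) = w (u, v))
    (hint : ∀ x y, Integrable (fun q : ℝ × ℝ => sqKernel x q.1 * sqKernel y q.2 * w q))
    (p q : ℝ × ℝ) :
    (∫ e, planeKernel s p.1 p.2 e * (starRingEnd ℂ) (planeKernel s q.1 q.2 e)).re =
      covOf (fun x y => ∫ e : ℝ × ℝ, sqKernel x e.1 * sqKernel y e.2 * w e) p q := by
  have hi : Integrable (fun e => planeKernel s p.1 p.2 e *
      (starRingEnd ℂ) (planeKernel s q.1 q.2 e)) :=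
    (memLp_planeKernel hs hsw (hint p.1 p.2)).integrable_mul
      (memLp_conj (memLp_planeKernel hs hsw (hint q.1 q.2)))
  have h1 := integral_re hi
  simp only [RCLike.re_eq_complex_re] at h1
  rw [← h1]
  have hre : Integrable (fun e => (planeKernel s p.1 p.2 e *
      (starRingEnd ℂ) (planeKernel s q.1 q.2 e)).re) := hi.re
  have hsym : ∫ e, (planeKernel s p.1 p.2 e * (starRingEnd ℂ) (planeKernel s q.1 q.2 e)).re =
      ∫ e : ℝ × ℝ, (planeKernel s p.1 p.2 (-e.1, e.2) *
        (starRingEnd ℂ) (planeKernel s q.1 q.2 (-e.1, e.2))).re :=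
    (measurePreserving_neg_fst.integral_comp
      (MeasurableEquiv.prodCongr (MeasurableEquiv.neg ℝ) (MeasurableEquiv.refl ℝ)).measurableEmbedding
      _).symm
  have hre' : Integrable (fun e : ℝ × ℝ => (planeKernel s p.1 p.2 (-e.1, e.2) *
      (starRingEnd ℂ) (planeKernel s q.1 q.2 (-e.1, e.2))).re) :=
    measurePreserving_neg_fst.integrable_comp_of_integrable hre
  have hsum : ∫ e, (planeKernel s p.1 p.2 e * (starRingEnd ℂ) (planeKernel s q.1 q.2 e)).re =
      ∫ e : ℝ × ℝ, ((planeKernel s p.1 p.2 e * (starRingEnd ℂ) (planeKernel s q.1 q.2 e)).re +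
        (planeKernel s p.1 p.2 (-e.1, e.2) *
        (starRingEnd ℂ) (planeKernel s q.1 q.2 (-e.1, e.2))).re) / 2 := by
    rw [integral_div, integral_add hre hre', ← hsym]; ring
  rw [hsum]
  have hpt : ∀ e : ℝ × ℝ,
      ((planeKernel s p.1 p.2 e * (starRingEnd ℂ) (planeKernel s q.1 q.2 e)).re +
        (planeKernel s p.1 p.2 (-e.1, e.2) *
        (starRingEnd ℂ) (planeKernel s q.1 q.2 (-e.1, e.2))).re) / 2 =
      polar (fun A => polar (fun B => sqKernel A e.1 * sqKernel B e.2 * w e) p.2 q.2) p.1 q.1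
        / 4 := by
    intro e
    have r1 := expKernel_re_mul_conj p.1 q.1 e.1
    have r2 := expKernel_re_mul_conj p.2 q.2 e.2
    have a1 : planeKernel s p.1 p.2 e * (starRingEnd ℂ) (planeKernel s q.1 q.2 e) =
        (expKernel p.1 e.1 * (starRingEnd ℂ) (expKernel q.1 e.1)) *
        (expKernel p.2 e.2 * (starRingEnd ℂ) (expKernel q.2 e.2)) * ((w e : ℝ) : ℂ) := by
      simp only [planeKernel, map_mul, Complex.conj_ofReal, ← hsw]
      push_cast; ring
    have a2 : planeKernel s p.1 p.2 (-e.1, e.2) *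
        (starRingEnd ℂ) (planeKernel s q.1 q.2 (-e.1, e.2)) =
        (starRingEnd ℂ) (expKernel p.1 e.1 * (starRingEnd ℂ) (expKernel q.1 e.1)) *
        (expKernel p.2 e.2 * (starRingEnd ℂ) (expKernel q.2 e.2)) * ((w e : ℝ) : ℂ) := by
      have hwe : w e = w (-e.1, e.2) := (hw e.1 e.2).symm
      simp only [planeKernel, map_mul, Complex.conj_ofReal, hwe, ← hsw, expKernel_neg,
        Complex.conj_conj]
      push_cast; ring
    rw [a1, a2]
    set α := expKernel p.1 e.1 * (starRingEnd ℂ) (expKernel q.1 e.1)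
    set β := expKernel p.2 e.2 * (starRingEnd ℂ) (expKernel q.2 e.2)
    have a3 : ((α * β * ((w e : ℝ) : ℂ)).re + ((starRingEnd ℂ) α * β * ((w e : ℝ) : ℂ)).re) / 2 =
        α.re * β.re * w e := by
      simp [Complex.mul_re, Complex.mul_im]; ring
    rw [a3, r1, r2]
    simp only [polar]; ring
  simp_rw [hpt]
  rw [integral_div]
  simp only [covOf, polar]
  congr 1
  have i0 : ∀ x y, Integrable (fun e : ℝ × ℝ => sqKernel x e.1 * sqKernel y e.2 * w e) := hint
  have i1 : ∀ x, Integrable (fun e : ℝ × ℝ => sqKernel x e.1 * sqKernel p.2 e.2 * w e +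
      sqKernel x e.1 * sqKernel q.2 e.2 * w e) := fun x => (i0 _ _).add (i0 _ _)
  have i2 : ∀ x, Integrable (fun e : ℝ × ℝ => sqKernel x e.1 * sqKernel p.2 e.2 * w e +
      sqKernel x e.1 * sqKernel q.2 e.2 * w e - sqKernel x e.1 * sqKernel (p.2 - q.2) e.2 * w e) :=
    fun x => (i1 x).sub (i0 _ _)
  have i3 := (i2 p.1).add (i2 q.1)
  simp only [Pi.add_def] at i3
  rw [integral_sub i3 (i2 _), integral_add (i2 _) (i2 _)]
  simp_rw [fun x => integral_sub (i1 x) (i0 x (p.2 - q.2)),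
    fun x => integral_add (i0 x p.2) (i0 x q.2)]

variable {Ω : Type*} [MeasurableSpace Ω] {P : Measure Ω} {V : ℝ × ℝ → Ω → ℝ}
  {W : FiniteVolumeSet (ℝ × ℝ) → Ω → ℂ}

theorem IsGaussianNoise.isVariogramField_plane (hW : IsGaussianNoise P W) (hs : Measurable s)
    (hsw : ∀ q, s q ^ 2 = w q) (hw : ∀ u v, w (-u, v) = w (u, v))
    (hint : ∀ x y, Integrable (fun q : ℝ × ℝ => sqKernel x q.1 * sqKernel y q.2 * w q))
    (hV : ∀ x y, 0 ≤ x → 0 ≤ y →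
      IsStochasticIntegral P W (planeKernel s x y) (fun ω => (V (x, y) ω : ℂ))) :
    IsVariogramField P V (fun x y => ∫ e : ℝ × ℝ, sqKernel x e.1 * sqKernel y e.2 * w e) where
  gaussian p hp := (hW.hasGaussianLaw_pi (V := fun i => V (p i))
    fun i => hV _ _ (hp i).1 (hp i).2).1
  centered p hp := (hW.hasGaussianLaw_pi (V := fun _ : Unit => V p)
    fun _ => hV _ _ hp.1 hp.2).2 ()
  cov p hp q hq := by
    rw [← integral_planeKernel_mul_conj_re hs hsw hw hint,
      ← hW.integral_mul_of_real (hV _ _ hp.1 hp.2) (hV _ _ hq.1 hq.2), Complex.ofReal_re]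

end Plane

/-! ### Covariance of fields that are linear in one coordinate -/

section Line

variable {s w : ℝ → ℝ}

/-- The kernel `x κ e_y(v) s(v)`. -/
noncomputable def lineKernel (s : ℝ → ℝ) (κ x y v : ℝ) : ℂ :=
  ((x * κ : ℝ) : ℂ) * expKernel y v * (s v : ℝ)

lemma memLp_lineKernel (hs : Measurable s) (hsw : ∀ v, s v ^ 2 = w v) (κ x : ℝ)
    {y : ℝ} (hint : Integrable (fun v => sqKernel y v * w v)) :
    MemLp (lineKernel s κ x y) 2 volume := by
  rw [memLp_two_iff_integrable_sq_norm (by unfold lineKernel; fun_prop)]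
  have : ∀ v, ‖lineKernel s κ x y v‖ ^ 2 = (x * κ) ^ 2 * (sqKernel y v * w v) := fun v => by
    simp only [lineKernel, norm_mul, mul_pow, expKernel_norm_sq, Complex.norm_real,
      Real.norm_eq_abs, sq_abs, hsw]
    ring
  simp only [this]
  exact hint.const_mul _

lemma lineKernel_neg (hs : ∀ v, s (-v) = s v) (κ x y v : ℝ) :
    lineKernel s κ x y (-v) = (starRingEnd ℂ) (lineKernel s κ x y v) := by
  simp only [lineKernel, hs, expKernel_neg, map_mul, Complex.conj_ofReal]

/-- The linear factor fits the same scheme because `x²` polarizes to `2 x x'`. -/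
lemma integral_lineKernel_mul_conj_re (hs : Measurable s) (hsw : ∀ v, s v ^ 2 = w v)
    (hint : ∀ y, Integrable (fun v => sqKernel y v * w v)) (κ : ℝ) (p q : ℝ × ℝ) :
    (∫ v, lineKernel s κ p.1 p.2 v * (starRingEnd ℂ) (lineKernel s κ q.1 q.2 v)).re =
      covOf (fun x y => κ ^ 2 * x ^ 2 * ∫ v, sqKernel y v * w v) p q := by
  have hi : Integrable (fun e => lineKernel s κ p.1 p.2 e *
      (starRingEnd ℂ) (lineKernel s κ q.1 q.2 e)) :=
    (memLp_lineKernel hs hsw κ p.1 (hint p.2)).integrable_mul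
      (memLp_conj (memLp_lineKernel hs hsw κ q.1 (hint q.2)))
  have h1 := integral_re hi
  simp only [RCLike.re_eq_complex_re] at h1
  rw [← h1]
  have hpt : ∀ v, (lineKernel s κ p.1 p.2 v * (starRingEnd ℂ) (lineKernel s κ q.1 q.2 v)).re =
      p.1 * q.1 * κ ^ 2 / 2 *
        (sqKernel p.2 v * w v + sqKernel q.2 v * w v - sqKernel (p.2 - q.2) v * w v) := by
    intro v
    have a1 : lineKernel s κ p.1 p.2 v * (starRingEnd ℂ) (lineKernel s κ q.1 q.2 v) =
        ((p.1 * q.1 * κ ^ 2 * w v : ℝ) : ℂ) *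
        (expKernel p.2 v * (starRingEnd ℂ) (expKernel q.2 v)) := by
      simp only [lineKernel, map_mul, Complex.conj_ofReal, ← hsw]
      push_cast; ring
    rw [a1, Complex.re_ofReal_mul, expKernel_re_mul_conj]
    ring
  simp_rw [hpt]
  rw [integral_const_mul]
  have i1 : Integrable (fun v => sqKernel p.2 v * w v + sqKernel q.2 v * w v) :=
    (hint p.2).add (hint q.2)
  rw [integral_sub i1 (hint _), integral_add (hint _) (hint _)]
  simp only [covOf, polar]
  ring

variable {Ω : Type*} [MeasurableSpace Ω] {P : Measure Ω} {V : ℝ × ℝ → Ω → ℝ}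
  {W₁ : FiniteVolumeSet ℝ → Ω → ℂ}

theorem IsGaussianNoise.isVariogramField_line (hW : IsGaussianNoise P W₁) (hs : Measurable s)
    (hsw : ∀ v, s v ^ 2 = w v) (hint : ∀ y, Integrable (fun v => sqKernel y v * w v)) (κ : ℝ)
    (hV : ∀ x y, 0 ≤ x → 0 ≤ y →
      IsStochasticIntegral P W₁ (lineKernel s κ x y) (fun ω => (V (x, y) ω : ℂ))) :
    IsVariogramField P V (fun x y => κ ^ 2 * x ^ 2 * ∫ v, sqKernel y v * w v) where
  gaussian p hp := (hW.hasGaussianLaw_pi (V := fun i => V (p i))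
    fun i => hV _ _ (hp i).1 (hp i).2).1
  centered p hp := (hW.hasGaussianLaw_pi (V := fun _ : Unit => V p)
    fun _ => hV _ _ hp.1 hp.2).2 ()
  cov p hp q hq := by
    rw [← integral_lineKernel_mul_conj_re hs hsw hint,
      ← hW.integral_mul_of_real (hV _ _ hp.1 hp.2) (hV _ _ hq.1 hq.2), Complex.ofReal_re]

end Line

end

section

/-! ### Rectangular increments of variogram fields -/

/-- The covariance of two increments of a process with covariance `polar f`. -/
def polarIncr (f : ℝ → ℝ) (u x u' x' : ℝ) : ℝ := f (x - u') + f (u - x') - f (x - x') - f (u - u')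

/-- The covariance of two rectangular increments of a field with variogram `Φ`. -/
noncomputable def incrCov (Φ : ℝ → ℝ → ℝ) (u v x y u' v' x' y' : ℝ) : ℝ :=
  polarIncr (fun A => polarIncr (fun B => Φ A B) v y v' y') u x u' x' / 4

/-- The four corners of a rectangle. -/
def corner (u v x y : ℝ) : Fin 4 → ℝ × ℝ := ![(x, y), (u, y), (x, v), (u, v)]

/-- The signs of the corners in a rectangular increment. -/
def cornerSign : Fin 4 → ℝ := ![1, -1, -1, 1]

lemma increment_eq_sum {Ω : Type*} (V : ℝ × ℝ → Ω → ℝ) (u v x y : ℝ) (ω : Ω) :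
    increment V u v x y ω = ∑ i, cornerSign i * V (corner u v x y i) ω := by
  simp [increment, Fin.sum_univ_four, corner, cornerSign]
  ring

lemma corner_mem {u v x y : ℝ} (hu : 0 ≤ u) (hv : 0 ≤ v) (hx : 0 ≤ x) (hy : 0 ≤ y) (i : Fin 4) :
    corner u v x y i ∈ closedQuadrant := by
  fin_cases i <;> simp [corner, closedQuadrant, *]

/-- If `K.u < 0`, the half-open rectangle contains a point with first coordinate `min K.x 0 ≤ 0`.
The corners may lie on the axes, which is why covariances are needed on the closed quadrant. -/
lemma Rect.nonneg {K : Rect} (hK : K.toSet ⊆ openQuadrant) :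
    0 ≤ K.u ∧ 0 ≤ K.v ∧ 0 ≤ K.x ∧ 0 ≤ K.y := by
  have hu : 0 ≤ K.u := by
    by_contra h
    push Not at h
    have hm : (min K.x 0, K.y) ∈ K.toSet :=
      ⟨⟨lt_min K.hx h, min_le_left _ _⟩, ⟨K.hy, le_rfl⟩⟩
    exact absurd (hK hm).1 (by simp)
  have hv : 0 ≤ K.v := by
    by_contra h
    push Not at h
    have hm : (K.x, min K.y 0) ∈ K.toSet :=
      ⟨⟨K.hx, le_rfl⟩, ⟨lt_min K.hy h, min_le_left _ _⟩⟩
    exact absurd (hK hm).2 (by simp)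
  exact ⟨hu, hv, hu.trans K.hx.le, hv.trans K.hy.le⟩

lemma Rect.subset_openQuadrant {K : Rect} (hu : 0 ≤ K.u) (hv : 0 ≤ K.v) :
    K.toSet ⊆ openQuadrant := fun _ hp => ⟨hu.trans_lt hp.1.1, hv.trans_lt hp.2.1⟩

section Increments

variable {Ω : Type*} [MeasurableSpace Ω] {P : Measure Ω} {V : ℝ × ℝ → Ω → ℝ} {Φ : ℝ → ℝ → ℝ}

lemma IsVariogramField.memLp (hV : IsVariogramField P V Φ) {p : ℝ × ℝ} (hp : p ∈ closedQuadrant) :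
    MemLp (V p) 2 P :=
  ((hV.gaussian (fun _ : Unit => p) fun _ => hp).eval ()).memLp_two

lemma IsVariogramField.gaussian_increment (hV : IsVariogramField P V Φ) {ι : Type} [Fintype ι]
    {u v x y : ι → ℝ} (hu : ∀ i, 0 ≤ u i) (hv : ∀ i, 0 ≤ v i) (hx : ∀ i, 0 ≤ x i)
    (hy : ∀ i, 0 ≤ y i) :
    HasGaussianLaw (fun ω i => increment V (u i) (v i) (x i) (y i) ω) P := by
  refine hasGaussianLaw_pi_of_forall_sum fun a => ?_
  have h := hasGaussianLaw_sum_mul (hV.gaussian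
    (fun j : ι × Fin 4 => corner (u j.1) (v j.1) (x j.1) (y j.1) j.2)
    fun j => corner_mem (hu _) (hv _) (hx _) (hy _) _) fun j => a j.1 * cornerSign j.2
  convert! h using 2 with ω
  rw [Fintype.sum_prod_type]
  refine Finset.sum_congr rfl fun i _ => ?_
  rw [increment_eq_sum, Finset.mul_sum]
  exact Finset.sum_congr rfl fun j _ => by ring

lemma IsVariogramField.integral_increment (hV : IsVariogramField P V Φ) {u v x y : ℝ}
    (hu : 0 ≤ u) (hv : 0 ≤ v) (hx : 0 ≤ x) (hy : 0 ≤ y) :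
    ∫ ω, increment V u v x y ω ∂P = 0 := by
  have := (hV.memLp (corner_mem hu hv hx hy 0)).1
  have hP : IsProbabilityMeasure P :=
    (hV.gaussian (fun _ : Unit => (0, 0)) fun _ => ⟨le_rfl, le_rfl⟩).isProbabilityMeasure
  simp_rw [increment_eq_sum]
  exact integral_sum_mul_eq_zero
    (fun i => (hV.memLp (corner_mem hu hv hx hy i)).integrable (by norm_num))
    (fun i => hV.centered _ (corner_mem hu hv hx hy i)) _

/-- In the alternating sum over pairs of corners, the terms of `polar` that depend on one corner
only cancel, and only values of `Φ` at coordinate differences remain. -/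
lemma IsVariogramField.cov_increment (hV : IsVariogramField P V Φ) {u v x y u' v' x' y' : ℝ}
    (hu : 0 ≤ u) (hv : 0 ≤ v) (hx : 0 ≤ x) (hy : 0 ≤ y)
    (hu' : 0 ≤ u') (hv' : 0 ≤ v') (hx' : 0 ≤ x') (hy' : 0 ≤ y') :
    ∫ ω, increment V u v x y ω * increment V u' v' x' y' ω ∂P = incrCov Φ u v x y u' v' x' y' := by
  simp_rw [increment_eq_sum]
  rw [integral_sum_mul_sum _ _ fun i j => (hV.memLp (corner_mem hu hv hx hy i)).integrable_mul
    (hV.memLp (corner_mem hu' hv' hx' hy' j))]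
  simp_rw [fun i j => hV.cov _ (corner_mem hu hv hx hy i) _ (corner_mem hu' hv' hx' hy' j)]
  simp only [Fin.sum_univ_four, cornerSign, corner, covOf, polar, incrCov, polarIncr,
    Matrix.cons_val]
  ring

lemma IsVariogramField.stationaryIncrements (hV : IsVariogramField P V Φ) :
    StationaryIncrements P V := by
  intro u v hu hv k p hp
  have hx : ∀ i, 0 ≤ (p i).1 := fun i => hu.trans (hp i).1
  have hy : ∀ i, 0 ≤ (p i).2 := fun i => hv.trans (hp i).2
  have hx' : ∀ i, 0 ≤ (p i).1 - u := fun i => sub_nonneg.2 (hp i).1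
  have hy' : ∀ i, 0 ≤ (p i).2 - v := fun i => sub_nonneg.2 (hp i).2
  refine identDistrib_of_covariance_eq (X := fun i ω => increment V u v (p i).1 (p i).2 ω)
    (Z := fun i ω => increment V 0 0 ((p i).1 - u) ((p i).2 - v) ω)
    (hV.gaussian_increment (fun _ => hu) (fun _ => hv) hx hy)
    (fun i => hV.integral_increment hu hv (hx i) (hy i))
    (hV.gaussian_increment (fun _ => le_rfl) (fun _ => le_rfl) hx' hy')
    (fun i => hV.integral_increment le_rfl le_rfl (hx' i) (hy' i)) fun i j => ?_
  rw [hV.cov_increment hu hv (hx i) (hy i) hu hv (hx j) (hy j),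
    hV.cov_increment le_rfl le_rfl (hx' i) (hy' i) le_rfl le_rfl (hx' j) (hy' j)]
  simp only [incrCov, polarIncr, sub_sub_sub_cancel_right, sub_zero, zero_sub, neg_sub, sub_self]

lemma IsVariogramField.vanishesOnAxes (hV : IsVariogramField P V Φ) (h1 : ∀ y, Φ 0 y = 0)
    (h2 : ∀ x, Φ x 0 = 0) : VanishesOnAxes P V := by
  have key : ∀ p ∈ closedQuadrant, covOf Φ p p = 0 → ∀ᵐ ω ∂P, V p ω = 0 := by
    intro p hp h0
    rw [← hV.cov p hp p hp] at h0
    have hi := (hV.memLp hp).integrable_mul (hV.memLp hp)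
    have := (integral_eq_zero_iff_of_nonneg (fun ω => mul_self_nonneg _) hi).1 h0
    filter_upwards [this] with ω hω
    simpa using hω
  intro x hx
  exact ⟨key _ ⟨hx, le_rfl⟩ (by simp [covOf, polar, h2]),
    key _ ⟨le_rfl, hx⟩ (by simp [covOf, polar, h1])⟩

lemma IsVariogramField.indep_incr (hV : IsVariogramField P V Φ) {K K' : Rect}
    (hK : K.toSet ⊆ openQuadrant) (hK' : K'.toSet ⊆ openQuadrant)
    (h : incrCov Φ K.u K.v K.x K.y K'.u K'.v K'.x K'.y = 0) :
    IndepFun (K.incr V) (K'.incr V) P := by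
  obtain ⟨a1, a2, a3, a4⟩ := Rect.nonneg hK
  obtain ⟨b1, b2, b3, b4⟩ := Rect.nonneg hK'
  have hg := hV.gaussian_increment (ι := Fin 2) (u := ![K.u, K'.u]) (v := ![K.v, K'.v])
    (x := ![K.x, K'.x]) (y := ![K.y, K'.y]) (fun i => by fin_cases i <;> simpa)
    (fun i => by fin_cases i <;> simpa) (fun i => by fin_cases i <;> simpa)
    (fun i => by fin_cases i <;> simpa)
  have hp : HasGaussianLaw (fun ω => (K.incr V ω, K'.incr V ω)) P := hg.prodMk 0 1
  have hP := hp.isProbabilityMeasure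
  refine HasGaussianLaw.indepFun_of_covariance_eq_zero hp ?_
  rw [covariance_eq_sub hp.fst.memLp_two hp.snd.memLp_two]
  have h1 : ∫ ω, (K.incr V * K'.incr V) ω ∂P = 0 :=
    (hV.cov_increment a1 a2 a3 a4 b1 b2 b3 b4).trans h
  have h0 : ∫ ω, K.incr V ω ∂P = 0 := hV.integral_increment a1 a2 a3 a4
  rw [h1, h0, zero_mul, sub_zero]

lemma IsVariogramField.incrCov_eq_zero (hV : IsVariogramField P V Φ) {K K' : Rect}
    (hK : K.toSet ⊆ openQuadrant) (hK' : K'.toSet ⊆ openQuadrant)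
    (h : IndepFun (K.incr V) (K'.incr V) P) :
    incrCov Φ K.u K.v K.x K.y K'.u K'.v K'.x K'.y = 0 := by
  obtain ⟨a1, a2, a3, a4⟩ := Rect.nonneg hK
  obtain ⟨b1, b2, b3, b4⟩ := Rect.nonneg hK'
  have m1 : AEStronglyMeasurable (K.incr V) P :=
    ((hV.gaussian_increment (ι := Unit) (fun _ => a1) (fun _ => a2) (fun _ => a3)
      fun _ => a4).eval ()).memLp_two.1
  have m2 : AEStronglyMeasurable (K'.incr V) P :=
    ((hV.gaussian_increment (ι := Unit) (fun _ => b1) (fun _ => b2) (fun _ => b3)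
      fun _ => b4).eval ()).memLp_two.1
  rw [← hV.cov_increment a1 a2 a3 a4 b1 b2 b3 b4]
  have := h.integral_fun_mul_eq_mul_integral m1 m2
  have h0 := hV.integral_increment a1 a2 a3 a4
  simp only [Rect.incr] at this
  rw [this, h0, zero_mul]

/-- For two variables with the same second moment, `E (X - X')²` is twice the second moment minus
twice `E X X'`. This makes invariance a statement about covariances. -/
lemma IsVariogramField.incr_ae_eq_iff (hV : IsVariogramField P V Φ) {K K' : Rect}
    (hK : K.toSet ⊆ openQuadrant) (hK' : K'.toSet ⊆ openQuadrant)
    (h0 : incrCov Φ K.u K.v K.x K.y K.u K.v K.x K.y = incrCov Φ K'.u K'.v K'.x K'.y K'.u K'.v K'.x K'.y) :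
    K.incr V =ᵐ[P] K'.incr V ↔
      incrCov Φ K.u K.v K.x K.y K'.u K'.v K'.x K'.y =
        incrCov Φ K.u K.v K.x K.y K.u K.v K.x K.y := by
  obtain ⟨a1, a2, a3, a4⟩ := Rect.nonneg hK
  obtain ⟨b1, b2, b3, b4⟩ := Rect.nonneg hK'
  have m1 : MemLp (K.incr V) 2 P :=
    ((hV.gaussian_increment (ι := Unit) (fun _ => a1) (fun _ => a2) (fun _ => a3)
      fun _ => a4).eval ()).memLp_two
  have m2 : MemLp (K'.incr V) 2 P :=
    ((hV.gaussian_increment (ι := Unit) (fun _ => b1) (fun _ => b2) (fun _ => b3)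
      fun _ => b4).eval ()).memLp_two
  rw [← hV.cov_increment b1 b2 b3 b4 b1 b2 b3 b4] at h0
  rw [← hV.cov_increment a1 a2 a3 a4 b1 b2 b3 b4]
  rw [← hV.cov_increment a1 a2 a3 a4 a1 a2 a3 a4] at h0 ⊢
  change ∫ ω, K.incr V ω * K.incr V ω ∂P = ∫ ω, K'.incr V ω * K'.incr V ω ∂P at h0
  change _ ↔ ∫ ω, K.incr V ω * K'.incr V ω ∂P = ∫ ω, K.incr V ω * K.incr V ω ∂P
  constructor
  · intro h
    refine integral_congr_ae ?_
    filter_upwards [h] with ω hω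
    rw [hω]
  · intro h
    have h1 : ∫ ω, (K.incr V ω - K'.incr V ω) ^ 2 ∂P = 0 := by
      have e : ∀ ω, (K.incr V ω - K'.incr V ω) ^ 2 =
          K.incr V ω * K.incr V ω + K'.incr V ω * K'.incr V ω
            - 2 * (K.incr V ω * K'.incr V ω) := fun ω => by ring
      simp_rw [e]
      have i1 : Integrable (fun ω => K.incr V ω * K.incr V ω) P := m1.integrable_mul m1
      have i2 : Integrable (fun ω => K'.incr V ω * K'.incr V ω) P := m2.integrable_mul m2
      have i4 : Integrable (fun ω => 2 * (K.incr V ω * K'.incr V ω)) P :=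
        (m1.integrable_mul m2).const_mul 2
      have i3 : Integrable (fun ω => K.incr V ω * K.incr V ω + K'.incr V ω * K'.incr V ω) P :=
        i1.add i2
      rw [integral_sub i3 i4, integral_const_mul, h, integral_add i1 i2, ← h0]
      ring
    have := (integral_eq_zero_iff_of_nonneg (fun ω => sq_nonneg _)
      ((m1.sub m2).integrable_sq)).1 h1
    filter_upwards [this] with ω hω
    have : (K.incr V ω - K'.incr V ω) ^ 2 = 0 := hω
    exact sub_eq_zero.1 (pow_eq_zero_iff (two_ne_zero) |>.1 this)

lemma incrCov_shift_self (Φ : ℝ → ℝ → ℝ) (K : Rect) (z w : ℝ) :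
    incrCov Φ K.u K.v K.x K.y K.u K.v K.x K.y =
      incrCov Φ (K.shift z w).u (K.shift z w).v (K.shift z w).x (K.shift z w).y
        (K.shift z w).u (K.shift z w).v (K.shift z w).x (K.shift z w).y := by
  simp only [incrCov, polarIncr, Rect.shift, add_sub_add_right_eq_sub]

end Increments

/-! ### Exchanging the coordinates -/

/-- The rectangle reflected in the diagonal. -/
def Rect.swap (K : Rect) : Rect := ⟨K.v, K.u, K.y, K.x, K.hy, K.hx⟩

section Swap

variable {Ω : Type*} [MeasurableSpace Ω] {P : Measure Ω} {V : ℝ × ℝ → Ω → ℝ}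

omit [MeasurableSpace Ω] in
lemma Rect.incr_swap (K : Rect) : K.swap.incr (fun p => V p.swap) = K.incr V := by
  ext ω
  simp only [Rect.incr, increment, Rect.swap, Prod.swap_prod_mk]
  ring

lemma Rect.swap_subset {K : Rect} (h : K.toSet ⊆ openQuadrant) : K.swap.toSet ⊆ openQuadrant :=
  Rect.subset_openQuadrant (Rect.nonneg h).2.1 (Rect.nonneg h).1

lemma Separated.swap {a b c : ℝ} {K K' : Rect} (h : Separated a b c K K') :
    Separated b a c K.swap K'.swap := by
  have key : ∀ {K : Rect} {p : ℝ × ℝ}, p ∈ K.swap.toSet → p.swap ∈ K.toSet :=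
    fun hp => ⟨hp.2, hp.1⟩
  rcases h with ⟨h1, h2⟩ | ⟨h1, h2⟩
  · exact Or.inl ⟨fun p hp => by have := h1 _ (key hp); simp at this; linarith,
      fun p hp => by have := h2 _ (key hp); simp at this; linarith⟩
  · exact Or.inr ⟨fun p hp => by have := h1 _ (key hp); simp at this; linarith,
      fun p hp => by have := h2 _ (key hp); simp at this; linarith⟩

lemma IndepIncrementsDir.of_swap {a b : ℝ}
    (h : IndepIncrementsDir P (fun p => V p.swap) a b) : IndepIncrementsDir P V b a := by
  intro a' b' c' hne ho K K' hK hK' hs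
  have := h b' a' c' (fun he => hne (by simp_all)) (by linarith) K.swap K'.swap
    (Rect.swap_subset hK) (Rect.swap_subset hK') hs.swap
  rwa [Rect.incr_swap, Rect.incr_swap] at this

lemma InvariantIncrementsDir.of_swap {a b : ℝ}
    (h : InvariantIncrementsDir P (fun p => V p.swap) a b) : InvariantIncrementsDir P V b a := by
  intro z w ho K hK hK'
  have := h w z (by linarith) K.swap (Rect.swap_subset hK) (Rect.swap_subset hK')
  rw [Rect.incr_swap] at this
  have e : (K.swap.shift w z) = (K.shift z w).swap := rfl
  rwa [e, Rect.incr_swap] at this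

lemma DependentIncrementsDir.of_swap {a b : ℝ}
    (h : DependentIncrementsDir P (fun p => V p.swap) a b) : DependentIncrementsDir P V b a :=
  ⟨fun hi => h.1 (IndepIncrementsDir.of_swap (V := fun p => V p.swap) hi),
    fun hi => h.2 (InvariantIncrementsDir.of_swap (V := fun p => V p.swap) hi)⟩

lemma SemiDependentIncrements.of_swap (h : SemiDependentIncrements P (fun p => V p.swap)) :
    SemiDependentIncrements P V := by
  obtain ⟨⟨a, b, hne, hd⟩, ⟨a', b', hne', hd'⟩⟩ := h
  exact ⟨⟨b, a, fun he => hne (by simp_all), hd.of_swap⟩,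
    ⟨b', a', fun he => hne' (by simp_all), hd'.imp (·.of_swap) (·.of_swap)⟩⟩

end Swap

/-! ### Product variograms -/

/-- The variogram of a fractional Brownian sheet. -/
noncomputable def sheetVariogram (κ a b x y : ℝ) : ℝ := κ * |x| ^ (1 + a) * |y| ^ (1 + b)

lemma incrCov_sheet (κ a b u v x y u' v' x' y' : ℝ) :
    incrCov (sheetVariogram κ a b) u v x y u' v' x' y' =
      κ / 4 * polarIncr (fun A => |A| ^ (1 + a)) u x u' x' *
        polarIncr (fun B => |B| ^ (1 + b)) v y v' y' := by
  simp only [incrCov, polarIncr, sheetVariogram]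
  ring

section Sheet

variable {Ω : Type*} [MeasurableSpace Ω] {P : Measure Ω} {V : ℝ × ℝ → Ω → ℝ} {κ a b : ℝ}

lemma polarIncr_self_one (h : 0 ≤ a) : polarIncr (fun A => |A| ^ (1 + a)) 0 1 0 1 = 2 := by
  have : (1 + a) ≠ 0 := by linarith
  simp [polarIncr, Real.zero_rpow this]; norm_num

/-- This is twice the covariance of neighbouring unit increments of a fractional Brownian motion, to
be compared with the value `2` for an increment with itself. -/
lemma polarIncr_next_one (h : 0 ≤ a) :
    polarIncr (fun A => |A| ^ (1 + a)) 0 1 1 2 = 2 ^ (1 + a) - 2 := by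
  have : (1 + a) ≠ 0 := by linarith
  simp only [polarIncr, sub_self, zero_sub, abs_neg, abs_zero, Real.zero_rpow this,
    Nat.abs_ofNat, abs_one, Real.one_rpow]
  norm_num
  ring

/-- Two unit squares side by side along the first axis have covariance `κ/2 (2^{1+a} - 2)`. It is
positive because `a > 0`, so they are not independent, and below the variance `κ` because `a < 1`,
so they are not equal. -/
lemma sheet_dependent (hκ : 0 < κ) (ha : 0 < a) (ha1 : a < 1) (hb : 0 ≤ b)
    (hV : IsVariogramField P V (sheetVariogram κ a b)) : DependentIncrementsDir P V 0 1 := by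
  let K : Rect := ⟨0, 0, 1, 1, one_pos, one_pos⟩
  let K' : Rect := ⟨1, 0, 2, 1, one_lt_two, one_pos⟩
  have hK : K.toSet ⊆ openQuadrant := Rect.subset_openQuadrant le_rfl le_rfl
  have hK' : K'.toSet ⊆ openQuadrant := Rect.subset_openQuadrant zero_le_one le_rfl
  have hcov : incrCov (sheetVariogram κ a b) K.u K.v K.x K.y K'.u K'.v K'.x K'.y =
      κ / 2 * (2 ^ (1 + a) - 2) := by
    rw [incrCov_sheet]
    simp only [K, K']
    rw [polarIncr_next_one ha.le, polarIncr_self_one hb]; ring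
  have h2 : (2 : ℝ) < 2 ^ (1 + a) := by
    have := Real.rpow_lt_rpow_of_exponent_lt (x := 2) one_lt_two (show (1 : ℝ) < 1 + a by linarith)
    simpa using this
  have h4 : (2 : ℝ) ^ (1 + a) < 4 := by
    have := Real.rpow_lt_rpow_of_exponent_lt (x := 2) one_lt_two (show 1 + a < 2 by linarith)
    norm_num at this ⊢
    linarith
  constructor
  · intro h
    have hs : Separated 1 0 1 K K' := Or.inl
      ⟨fun p hp => by have := hp.1.2; simp only [K] at this; linarith,
        fun p hp => by have := hp.1.1; simp only [K'] at this; linarith⟩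
    have := hV.incrCov_eq_zero hK hK' (h 1 0 1 (by simp) (by simp) K K' hK hK' hs)
    rw [hcov] at this
    have : 0 < κ / 2 * (2 ^ (1 + a) - 2) := by apply mul_pos <;> linarith
    linarith
  · intro h
    have hsh : K.shift 1 0 = K' := by simp [K, K', Rect.shift]; norm_num
    have h1 := h 1 0 (by simp) K hK (by rw [hsh]; exact hK')
    rw [hsh] at h1
    have h2 := (hV.incr_ae_eq_iff hK hK' (by
      have := incrCov_shift_self (sheetVariogram κ a b) K 1 0
      rwa [hsh] at this)).1 h1
    rw [hcov, incrCov_sheet] at h2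
    simp only [K] at h2
    rw [polarIncr_self_one ha.le, polarIncr_self_one hb] at h2
    have : κ * (2 ^ (1 + a) - 4) = 0 := by linarith
    rcases mul_eq_zero.1 this with h | h <;> linarith

/-- If the vertical sides overlapped, both rectangles would have points at two distinct common
heights, and `b' p.2` would equal `c'` at both. -/
lemma Separated.horizontal {b' c' : ℝ} (hb' : b' ≠ 0) {K K' : Rect} (h : Separated 0 b' c' K K') :
    K.y ≤ K'.v ∨ K'.y ≤ K.v := by
  have key : ∀ {K K' : Rect}, (∀ p ∈ K.toSet, 0 * p.1 + b' * p.2 ≤ c') →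
      (∀ p ∈ K'.toSet, c' ≤ 0 * p.1 + b' * p.2) → K.y ≤ K'.v ∨ K'.y ≤ K.v := by
    intro K K' h1 h2
    by_contra hcon
    push Not at hcon
    have hlt : max K.v K'.v < min K.y K'.y := by
      simp only [max_lt_iff, lt_min_iff]
      exact ⟨⟨K.hy, hcon.1⟩, ⟨hcon.2, K'.hy⟩⟩
    obtain ⟨t, ht1, ht2⟩ := exists_between hlt
    have hm : ∀ s, t ≤ s → s ≤ min K.y K'.y →
        (K.x, s) ∈ K.toSet ∧ (K'.x, s) ∈ K'.toSet := fun s h3 h4 =>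
      ⟨⟨⟨K.hx, le_rfl⟩, ⟨((le_max_left _ _).trans_lt ht1).trans_le h3, h4.trans (min_le_left _ _)⟩⟩,
        ⟨⟨K'.hx, le_rfl⟩, ⟨((le_max_right _ _).trans_lt ht1).trans_le h3,
          h4.trans (min_le_right _ _)⟩⟩⟩
    have e1 := hm t le_rfl ht2.le
    have e2 := hm (min K.y K'.y) ht2.le le_rfl
    have f1 := h1 _ e1.1
    have f2 := h2 _ e1.2
    have f3 := h1 _ e2.1
    have f4 := h2 _ e2.2
    simp only at f1 f2 f3 f4
    have : b' * (min K.y K'.y - t) = 0 := by linarith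
    rcases mul_eq_zero.1 this with h | h
    · exact hb' h
    · linarith
  rcases h with ⟨h1, h2⟩ | ⟨h1, h2⟩
  · exact key h1 h2
  · exact (key h1 h2).symm

/-- Brownian increments over disjoint intervals: all four differences have the same sign, where the
absolute value is linear. -/
lemma polarIncr_abs {v y v' y' : ℝ} (h : v < y) (h' : v' < y') (hd : y ≤ v' ∨ y' ≤ v) :
    polarIncr (fun B => |B| ^ (1 + (0 : ℝ))) v y v' y' = 0 := by
  simp only [polarIncr, add_zero, Real.rpow_one]
  rcases hd with hd | hd
  · rw [abs_of_nonpos (by linarith), abs_of_nonpos (by linarith), abs_of_nonpos (by linarith),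
      abs_of_nonpos (by linarith)]
    ring
  · rw [abs_of_nonneg (by linarith), abs_of_nonneg (by linarith), abs_of_nonneg (by linarith),
      abs_of_nonneg (by linarith)]
    ring

lemma sheet_indep (hV : IsVariogramField P V (sheetVariogram κ a 0)) :
    IndepIncrementsDir P V 1 0 := by
  intro a' b' c' hne ho K K' hK hK' hs
  have ha' : a' = 0 := by linarith
  subst ha'
  have hb' : b' ≠ 0 := fun h => hne (by rw [h])
  refine hV.indep_incr hK hK' ?_
  rw [incrCov_sheet, polarIncr_abs K.hy K'.hy (hs.horizontal hb'), mul_zero]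

/-- With exponent `2`, `polarIncr` is `2 (y - v) (y' - v')`, unaffected by translating either
interval. -/
lemma sheet_invariant (hV : IsVariogramField P V (sheetVariogram κ a 1)) :
    InvariantIncrementsDir P V 1 0 := by
  intro z w ho K hK hK'
  have hz : z = 0 := by linarith
  subst hz
  refine (hV.incr_ae_eq_iff hK hK' (incrCov_shift_self _ K 0 w)).2 ?_
  rw [incrCov_sheet, incrCov_sheet]
  have h2 : ∀ B : ℝ, |B| ^ ((1 : ℝ) + 1) = B ^ 2 := fun B => by
    rw [one_add_one_eq_two, Real.rpow_two, sq_abs]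
  simp only [Rect.shift, add_zero, polarIncr, h2]
  ring

theorem sheet_semiDependent_left (hκ : 0 < κ) (ha : 0 < a) (ha1 : a < 1) (hb : b = 0 ∨ b = 1)
    (hV : IsVariogramField P V (sheetVariogram κ a b)) : SemiDependentIncrements P V := by
  refine ⟨⟨0, 1, by simp, sheet_dependent hκ ha ha1 (by rcases hb with h | h <;> simp [h]) hV⟩,
    ⟨1, 0, by simp, ?_⟩⟩
  rcases hb with rfl | rfl
  · exact Or.inl (sheet_indep hV)
  · exact Or.inr (sheet_invariant hV)

theorem sheet_semiDependent_right (hκ : 0 < κ) (hb : 0 < b) (hb1 : b < 1) (ha : a = 0 ∨ a = 1)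
    (hV : IsVariogramField P V (sheetVariogram κ a b)) : SemiDependentIncrements P V :=
  (sheet_semiDependent_left hκ hb hb1 ha
    (hV.swap.congr fun x y => by simp only [sheetVariogram]; ring)).of_swap

lemma sheetVariogram_zero_left (ha : 0 ≤ a) (y : ℝ) : sheetVariogram κ a b 0 y = 0 := by
  have : (1 + a) ≠ 0 := by linarith
  simp [sheetVariogram, Real.zero_rpow this]

lemma sheetVariogram_zero_right (hb : 0 ≤ b) (x : ℝ) : sheetVariogram κ a b x 0 = 0 := by
  have : (1 + b) ≠ 0 := by linarith
  simp [sheetVariogram, Real.zero_rpow this]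

lemma sheetVariogram_scale {γ H l : ℝ} (hl : 0 < l) (hH : 2 * H = 1 + a + γ * (1 + b)) (x y : ℝ) :
    sheetVariogram κ a b (l * x) (l ^ γ * y) = l ^ (2 * H) * sheetVariogram κ a b x y := by
  simp only [sheetVariogram]
  rw [abs_mul, abs_mul, abs_of_pos hl, abs_of_pos (Real.rpow_pos_of_pos hl γ),
    Real.mul_rpow hl.le (abs_nonneg _), Real.mul_rpow (by positivity) (abs_nonneg _), hH,
    Real.rpow_add hl (1 + a), ← Real.rpow_mul hl.le]
  ring

end Sheet

end

section

/-! ### The variogram of the limit field at the critical exponent -/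

lemma map_mul_prod {a b : ℝ} (ha : 0 < a) (hb : 0 < b) :
    Measure.map (fun q : ℝ × ℝ => (a * q.1, b * q.2)) volume =
      ENNReal.ofReal (a * b)⁻¹ • volume := by
  have h1 := Measure.map_prod_map (volume : Measure ℝ) (volume : Measure ℝ)
    (measurable_const_mul a) (measurable_const_mul b)
  rw [Real.map_volume_mul_left ha.ne', Real.map_volume_mul_left hb.ne'] at h1
  rw [Measure.volume_eq_prod]
  refine h1.symm.trans ?_
  rw [Measure.prod_smul_left, Measure.prod_smul_right, smul_smul, abs_of_pos (inv_pos.2 ha),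
    abs_of_pos (inv_pos.2 hb), ← ENNReal.ofReal_mul (inv_pos.2 ha).le, mul_inv]

lemma measurableEmbedding_mul_prod {a b : ℝ} (ha : 0 < a) (hb : 0 < b) :
    MeasurableEmbedding (fun q : ℝ × ℝ => (a * q.1, b * q.2)) :=
  (measurableEmbedding_mulLeft₀ ha.ne').prodMap (measurableEmbedding_mulLeft₀ hb.ne')

lemma integral_comp_mul_prod {F : Type*} [NormedAddCommGroup F] [NormedSpace ℝ F] {a b : ℝ}
    (ha : 0 < a) (hb : 0 < b) (G : ℝ × ℝ → F) :
    ∫ q : ℝ × ℝ, G (a * q.1, b * q.2) = (a * b)⁻¹ • ∫ q, G q := by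
  rw [← (measurableEmbedding_mul_prod ha hb).integral_map G, map_mul_prod ha hb,
    integral_smul_measure, ENNReal.toReal_ofReal (by positivity)]

lemma integral_pos_of_pos_on {f : ℝ × ℝ → ℝ} (hf : ∀ q, 0 ≤ f q) (hi : Integrable f) {a b : ℝ}
    (ha : 0 < a) (hb : 0 < b) (hpos : ∀ u v, 0 < u → u < a → 0 < v → v < b → 0 < f (u, v)) :
    0 < ∫ q, f q := by
  rw [integral_pos_iff_support_of_nonneg hf hi]
  refine lt_of_lt_of_le ?_ (measure_mono (s := Set.Ioo 0 a ×ˢ Set.Ioo 0 b)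
    fun q hq => (hpos q.1 q.2 hq.1.1 hq.1.2 hq.2.1 hq.2.2).ne')
  rw [Measure.volume_eq_prod, Measure.prod_prod]
  simp [ha, hb]

variable {H₁ H₂ c : ℝ}

/-- The variogram of the limit field at the critical exponent. -/
noncomputable def hVariogram (H₁ H₂ c x y : ℝ) : ℝ :=
  ∫ e : ℝ × ℝ, sqKernel x e.1 * sqKernel y e.2 * hFun H₁ H₂ c e

lemma integrable_sqKernel_mul_hFun (hH₁ : 0 < H₁) (hH₁2 : H₁ < 2) (hH₂0 : 0 < H₂) (hH₂ : H₂ < 2)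
    (hc : 0 < c) (x y : ℝ) :
    Integrable (fun e : ℝ × ℝ => sqKernel x e.1 * sqKernel y e.2 * hFun H₁ H₂ c e) := by
  refine ((integrable_inv_mul_hFun hH₁ hH₁2 hH₂0 hH₂ hc).const_mul
    ((x ^ 2 + 4) * (y ^ 2 + 4))).mono' (by
      have := measurable_sqKernel
      fun_prop) (Eventually.of_forall fun e => ?_)
  have h0 := hFun_nonneg (H₁ := H₁) (H₂ := H₂) hc e
  rw [Real.norm_of_nonneg (mul_nonneg (mul_nonneg (sqKernel_nonneg _ _) (sqKernel_nonneg _ _)) h0)]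
  calc _ ≤ (x ^ 2 + 4) * (1 + e.1 ^ 2)⁻¹ * ((y ^ 2 + 4) * (1 + e.2 ^ 2)⁻¹) * hFun H₁ H₂ c e := by
        gcongr
        · exact sqKernel_nonneg _ _
        · exact sqKernel_le _ _
        · exact sqKernel_le _ _
    _ = _ := by ring

@[simp] lemma hVariogram_zero_left (y : ℝ) : hVariogram H₁ H₂ c 0 y = 0 := by simp [hVariogram]

@[simp] lemma hVariogram_zero_right (x : ℝ) : hVariogram H₁ H₂ c x 0 = 0 := by simp [hVariogram]

lemma hVariogram_neg_left (x y : ℝ) : hVariogram H₁ H₂ c (-x) y = hVariogram H₁ H₂ c x y := by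
  simp [hVariogram]

lemma hVariogram_neg_right (x y : ℝ) : hVariogram H₁ H₂ c x (-y) = hVariogram H₁ H₂ c x y := by
  simp [hVariogram]

lemma hVariogram_mul {a b : ℝ} (ha : 0 < a) (hb : 0 < b) (x y : ℝ) :
    hVariogram H₁ H₂ c (a * x) (b * y) =
      a * b * ∫ e : ℝ × ℝ, sqKernel x e.1 * sqKernel y e.2 * hFun H₁ H₂ c (a⁻¹ * e.1, b⁻¹ * e.2) := by
  have h := integral_comp_mul_prod ha hb fun e : ℝ × ℝ =>
    a ^ 2 * b ^ 2 * (sqKernel x e.1 * sqKernel y e.2 * hFun H₁ H₂ c (a⁻¹ * e.1, b⁻¹ * e.2))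
  rw [integral_const_mul (a ^ 2 * b ^ 2) (fun e : ℝ × ℝ => sqKernel x e.1 * sqKernel y e.2 *
    hFun H₁ H₂ c (a⁻¹ * e.1, b⁻¹ * e.2)), smul_eq_mul] at h
  rw [hVariogram]
  refine Eq.trans (integral_congr_ae (Eventually.of_forall fun e => ?_)) (h.trans ?_)
  · simp only [sqKernel_mul_left ha.ne', sqKernel_mul_left hb.ne']
    rw [inv_mul_cancel_left₀ ha.ne', inv_mul_cancel_left₀ hb.ne']
    ring
  · field_simp

lemma hVariogram_scale (hH₁ : 0 < H₁) (hH₂ : 0 < H₂) (hc : 0 < c) {l : ℝ} (hl : 0 < l) (x y : ℝ) :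
    hVariogram H₁ H₂ c (l * x) (l ^ (H₁ / H₂) * y) =
      l ^ (1 + H₁ / H₂ + H₁) * hVariogram H₁ H₂ c x y := by
  rw [hVariogram_mul hl (Real.rpow_pos_of_pos hl _), Real.rpow_add hl, Real.rpow_add hl,
    Real.rpow_one, hVariogram, ← integral_const_mul, ← integral_const_mul]
  refine integral_congr_ae (Eventually.of_forall fun e => ?_)
  have := hFun_scale hH₁ hH₂ hc (inv_pos.2 hl) e.1 e.2
  rw [Real.inv_rpow hl.le, Real.inv_rpow hl.le, Real.rpow_neg hl.le, inv_inv] at this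
  simp only [this]
  ring

lemma integrable_sqKernel_mul_hFun_comp {a b : ℝ} (ha : 0 < a) (hb : 0 < b) (hH₁ : 0 < H₁)
    (hH₁2 : H₁ < 2) (hH₂0 : 0 < H₂) (hH₂ : H₂ < 2) (hc : 0 < c) (x y : ℝ) :
    Integrable (fun e : ℝ × ℝ => sqKernel x e.1 * sqKernel y e.2 *
      hFun H₁ H₂ c (a⁻¹ * e.1, b⁻¹ * e.2)) := by
  have h := integrable_sqKernel_mul_hFun hH₁ hH₁2 hH₂0 hH₂ hc (a * x) (b * y)
  have h2 := ((measurableEmbedding_mul_prod (inv_pos.2 ha) (inv_pos.2 hb)).integrable_map_iff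
    (μ := volume)
    (g := fun e : ℝ × ℝ => sqKernel (a * x) e.1 * sqKernel (b * y) e.2 * hFun H₁ H₂ c e)).1 (by
      rw [map_mul_prod (inv_pos.2 ha) (inv_pos.2 hb)]
      exact h.smul_measure ENNReal.ofReal_ne_top)
  refine (h2.const_mul ((a ^ 2 * b ^ 2)⁻¹)).congr (Eventually.of_forall fun e => ?_)
  simp only [Function.comp, sqKernel_mul_left ha.ne', sqKernel_mul_left hb.ne']
  rw [mul_inv_cancel_left₀ ha.ne', mul_inv_cancel_left₀ hb.ne']
  field_simp

/-- Substitution moves the dilation from the kernels onto `h`. For `a, b ≥ 1` the right side is then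
nonnegative by monotonicity of `h`: the variogram grows faster than linearly in each variable. -/
lemma hVariogram_sub {a b : ℝ} (ha : 0 < a) (hb : 0 < b) (hH₁ : 0 < H₁) (hH₁2 : H₁ < 2)
    (hH₂0 : 0 < H₂) (hH₂ : H₂ < 2) (hc : 0 < c) (x y : ℝ) :
    hVariogram H₁ H₂ c (a * x) (b * y) - a * b * hVariogram H₁ H₂ c x y = a * b *
      ∫ e : ℝ × ℝ, sqKernel x e.1 * sqKernel y e.2 *
        (hFun H₁ H₂ c (a⁻¹ * e.1, b⁻¹ * e.2) - hFun H₁ H₂ c e) := by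
  rw [hVariogram_mul ha hb, ← mul_sub, hVariogram, ← integral_sub]
  · simp_rw [mul_sub]
  · exact integrable_sqKernel_mul_hFun_comp ha hb hH₁ hH₁2 hH₂0 hH₂ hc x y
  · exact integrable_sqKernel_mul_hFun hH₁ hH₁2 hH₂0 hH₂ hc x y

/-- The condition `u ≠ 0` keeps away from the origin, where division by zero gives `h` the value
`0`. -/
lemma hFun_anti (hH₁ : 0 < H₁) (hH₂ : 0 < H₂) (hc : 0 < c) {u v u' v' : ℝ} (hu0 : u ≠ 0)
    (hu : |u| ≤ |u'|) (hv : |v| ≤ |v'|) : hFun H₁ H₂ c (u', v') ≤ hFun H₁ H₂ c (u, v) := by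
  have : 0 < |u| := abs_pos.2 hu0
  simp only [hFun]
  gcongr

lemma hFun_strictAnti (hH₁ : 0 < H₁) (hH₂ : 0 < H₂) (hc : 0 < c) {u v u' v' : ℝ} (hu0 : u ≠ 0)
    (hu : |u| ≤ |u'|) (hv : |v| ≤ |v'|) (h : |u| < |u'| ∨ |v| < |v'|) :
    hFun H₁ H₂ c (u', v') < hFun H₁ H₂ c (u, v) := by
  have h0 : 0 < |u| := abs_pos.2 hu0
  have h1 : |v| ^ (2 * H₂ / H₁) ≤ |v'| ^ (2 * H₂ / H₁) := by gcongr
  have h2 : |u| ^ 2 ≤ |u'| ^ 2 := by gcongr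
  have h3 : |u| ^ 2 + c * |v| ^ (2 * H₂ / H₁) < |u'| ^ 2 + c * |v'| ^ (2 * H₂ / H₁) := by
    rcases h with h | h
    · have : |u| ^ 2 < |u'| ^ 2 := by gcongr
      nlinarith
    · have : |v| ^ (2 * H₂ / H₁) < |v'| ^ (2 * H₂ / H₁) := by gcongr
      nlinarith
  simp only [hFun]
  gcongr

lemma sqKernel_one_le (w : ℝ) : sqKernel 1 w ≤ 1 := by
  rw [sqKernel]
  rcases eq_or_ne w 0 with rfl | hw
  · simp
  rw [div_le_one (by positivity), one_mul]
  have := Real.one_sub_sq_div_two_le_cos (x := w)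
  linarith

/-- By `1 - cos t ≥ 2 t² / π²` for `|t| ≤ π`, the left kernel is at least `4 d² / π²`, and `sqKernel
1 v ≤ 1`. It yields a quadratic lower bound in `d` after integration. -/
lemma le_sqKernel {d v : ℝ} (hd : 0 < d) (hd1 : d ≤ 1) (hv : 0 < v) (hv1 : v < 1) :
    4 / Real.pi ^ 2 * d ^ 2 * sqKernel 1 v ≤ sqKernel d v := by
  have h1 : |d * v| ≤ Real.pi := by
    rw [abs_of_pos (by positivity)]
    nlinarith [Real.pi_gt_three]
  have h2 := Real.cos_le_one_sub_mul_cos_sq h1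
  calc _ ≤ 4 / Real.pi ^ 2 * d ^ 2 * 1 := by gcongr; exact sqKernel_one_le v
    _ ≤ sqKernel d v := by
      rw [sqKernel, le_div_iff₀ (by positivity)]
      have : 2 / Real.pi ^ 2 * (d * v) ^ 2 ≤ 1 - Real.cos (d * v) := by linarith
      calc _ = 2 * (2 / Real.pi ^ 2 * (d * v) ^ 2) := by ring
        _ ≤ _ := by gcongr

lemma integrable_sqKernel_mul_hFun_sub {a b : ℝ} (ha : 0 < a) (hb : 0 < b) (hH₁ : 0 < H₁)
    (hH₁2 : H₁ < 2) (hH₂0 : 0 < H₂) (hH₂ : H₂ < 2) (hc : 0 < c) (x y : ℝ) :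
    Integrable (fun e : ℝ × ℝ => sqKernel x e.1 * sqKernel y e.2 *
      (hFun H₁ H₂ c (a⁻¹ * e.1, b⁻¹ * e.2) - hFun H₁ H₂ c e)) := by
  simp_rw [mul_sub]
  exact (integrable_sqKernel_mul_hFun_comp ha hb hH₁ hH₁2 hH₂0 hH₂ hc x y).sub
    (integrable_sqKernel_mul_hFun hH₁ hH₁2 hH₂0 hH₂ hc x y)

lemma hFun_sub_nonneg {a b : ℝ} (ha : 1 ≤ a) (hb : 1 ≤ b) (hH₁ : 0 < H₁) (hH₂0 : 0 < H₂)
    (hc : 0 < c) {e : ℝ × ℝ} (he : e.1 ≠ 0) :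
    0 ≤ hFun H₁ H₂ c (a⁻¹ * e.1, b⁻¹ * e.2) - hFun H₁ H₂ c e := by
  have ha' := inv_le_one_of_one_le₀ ha
  have hb' := inv_le_one_of_one_le₀ hb
  refine sub_nonneg.2 (hFun_anti hH₁ hH₂0 hc (by positivity) ?_ ?_)
  · rw [abs_mul, abs_of_pos (by positivity)]
    exact mul_le_of_le_one_left (abs_nonneg _) ha'
  · rw [abs_mul, abs_of_pos (by positivity)]
    exact mul_le_of_le_one_left (abs_nonneg _) hb'

lemma sqKernel_mul_hFun_sub_nonneg {a b : ℝ} (ha : 1 ≤ a) (hb : 1 ≤ b) (hH₁ : 0 < H₁)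
    (hH₂0 : 0 < H₂) (hc : 0 < c) (x y : ℝ) (e : ℝ × ℝ) :
    0 ≤ sqKernel x e.1 * sqKernel y e.2 *
      (hFun H₁ H₂ c (a⁻¹ * e.1, b⁻¹ * e.2) - hFun H₁ H₂ c e) := by
  rcases eq_or_ne e.1 0 with he | he
  · simp [he, sqKernel]
  · exact mul_nonneg (mul_nonneg (sqKernel_nonneg _ _) (sqKernel_nonneg _ _))
      (hFun_sub_nonneg ha hb hH₁ hH₂0 hc he)

lemma sqKernel_mul_hFun_sub_pos {a b : ℝ} (ha : 1 ≤ a) (hb : 1 ≤ b) (hab : 1 < a ∨ 1 < b)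
    (hH₁ : 0 < H₁) (hH₂0 : 0 < H₂) (hc : 0 < c) {u v : ℝ} (hu : 0 < u) (hu1 : u < 1) (hv : 0 < v)
    (hv1 : v < 1) :
    0 < sqKernel 1 u * sqKernel 1 v * (hFun H₁ H₂ c (a⁻¹ * u, b⁻¹ * v) - hFun H₁ H₂ c (u, v)) := by
  have hpi := Real.pi_gt_three
  have ha' := inv_le_one_of_one_le₀ ha
  have hb' := inv_le_one_of_one_le₀ hb
  have ha0 : 0 < a⁻¹ := by positivity
  have hb0 : 0 < b⁻¹ := by positivity
  refine mul_pos (mul_pos (sqKernel_pos (by linarith) (by linarith))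
    (sqKernel_pos (by linarith) (by linarith)))
    (sub_pos.2 (hFun_strictAnti hH₁ hH₂0 hc (by positivity) ?_ ?_ ?_))
  · rw [abs_of_pos hu, abs_of_pos (by positivity)]
    exact mul_le_of_le_one_left hu.le ha'
  · rw [abs_of_pos hv, abs_of_pos (by positivity)]
    exact mul_le_of_le_one_left hv.le hb'
  · rw [abs_of_pos hu, abs_of_pos hv, abs_of_pos (by positivity), abs_of_pos (by positivity)]
    exact hab.imp (fun h => mul_lt_of_lt_one_left hu (inv_lt_one_of_one_lt₀ h))
      fun h => mul_lt_of_lt_one_left hv (inv_lt_one_of_one_lt₀ h)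

lemma hVariogram_double_right (hH₁ : 0 < H₁) (hH₁2 : H₁ < 2) (hH₂0 : 0 < H₂) (hH₂ : H₂ < 2)
    (hc : 0 < c) : 2 * hVariogram H₁ H₂ c 1 1 < hVariogram H₁ H₂ c 1 2 := by
  have h := hVariogram_sub one_pos two_pos hH₁ hH₁2 hH₂0 hH₂ hc 1 1
  have h2 := integral_pos_of_pos_on
    (sqKernel_mul_hFun_sub_nonneg le_rfl one_le_two hH₁ hH₂0 hc 1 1)
    (integrable_sqKernel_mul_hFun_sub one_pos two_pos hH₁ hH₁2 hH₂0 hH₂ hc 1 1) one_pos one_pos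
    fun u v hu hu1 hv hv1 => sqKernel_mul_hFun_sub_pos le_rfl one_le_two (Or.inr one_lt_two)
      hH₁ hH₂0 hc hu hu1 hv hv1
  rw [one_mul, mul_one] at h
  linarith

lemma hVariogram_double_left (hH₁ : 0 < H₁) (hH₁2 : H₁ < 2) (hH₂0 : 0 < H₂) (hH₂ : H₂ < 2)
    (hc : 0 < c) : ∃ C : ℝ, 0 < C ∧ ∀ d : ℝ, 0 < d → d ≤ 1 →
      C * d ^ 2 ≤ hVariogram H₁ H₂ c 2 d - 2 * hVariogram H₁ H₂ c 1 d := by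
  set G : ℝ → ℝ × ℝ → ℝ := fun d e => sqKernel 1 e.1 * sqKernel d e.2 *
        (hFun H₁ H₂ c (2⁻¹ * e.1, 1⁻¹ * e.2) - hFun H₁ H₂ c e) with hG
  have hG0 : ∀ d e, 0 ≤ G d e := fun d e =>
    sqKernel_mul_hFun_sub_nonneg one_le_two le_rfl hH₁ hH₂0 hc 1 d e
  have hGi : ∀ d, Integrable (G d) := fun d =>
    integrable_sqKernel_mul_hFun_sub two_pos one_pos hH₁ hH₁2 hH₂0 hH₂ hc 1 d
  -- `le_sqKernel` compares `G d` with `d² G 1` on this strip; outside it `G d ≥ 0` suffices.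
  set S : Set (ℝ × ℝ) := Set.univ ×ˢ Set.Ioo (0 : ℝ) 1 with hS
  have hSm : MeasurableSet S := MeasurableSet.univ.prod measurableSet_Ioo
  have hpos : 0 < ∫ e, S.indicator (G 1) e := by
    refine integral_pos_of_pos_on (Set.indicator_nonneg fun e _ => hG0 1 e)
      ((hGi 1).indicator hSm) one_pos one_pos fun u v hu hu1 hv hv1 => ?_
    rw [Set.indicator_of_mem (by simp [hS, hv, hv1])]
    exact sqKernel_mul_hFun_sub_pos one_le_two le_rfl (Or.inl one_lt_two) hH₁ hH₂0 hc hu hu1 hv hv1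
  -- The factor `2` is the `a * b` of `hVariogram_sub`; `4 / π²` comes from `le_sqKernel`.
  refine ⟨2 * (4 / Real.pi ^ 2 * ∫ e, S.indicator (G 1) e), by positivity, fun d hd hd1 => ?_⟩
  have h := hVariogram_sub two_pos one_pos hH₁ hH₁2 hH₂0 hH₂ hc 1 d
  rw [one_mul, mul_one] at h
  rw [h, mul_assoc 2, mul_right_comm, ← integral_const_mul]
  refine mul_le_mul_of_nonneg_left ?_ zero_le_two
  refine integral_mono (((hGi 1).indicator hSm).const_mul _) (hGi d) fun e => ?_
  by_cases he : e ∈ S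
  · simp only [Set.indicator_of_mem he]
    rcases eq_or_ne e.1 0 with h0 | h0
    · simp [hG, h0, sqKernel]
    have h1 := hFun_sub_nonneg (a := 2) (b := 1) one_le_two le_rfl hH₁ hH₂0 hc h0
    have h2 := le_sqKernel hd hd1 he.2.1 he.2.2
    calc _ = sqKernel 1 e.1 * (4 / Real.pi ^ 2 * d ^ 2 * sqKernel 1 e.2) *
          (hFun H₁ H₂ c (2⁻¹ * e.1, 1⁻¹ * e.2) - hFun H₁ H₂ c e) := by simp only [hG]; ring
      _ ≤ _ := by
        gcongr
        exact sqKernel_nonneg _ _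
  · simp only [Set.indicator_of_notMem he, mul_zero]
    exact hG0 d e

end

section

variable {H₁ H₂ c : ℝ}

/-! ### Dependence of the increments at the critical exponent -/

lemma polarIncr_eq_sum (f : ℝ → ℝ) (u x u' x' : ℝ) :
    polarIncr f u x u' x' = ∑ i : Fin 4, (![1, 1, -1, -1] : Fin 4 → ℝ) i *
      f ((![x - u', u - x', x - x', u - u'] : Fin 4 → ℝ) i) := by
  simp [polarIncr, Fin.sum_univ_four]
  ring

lemma incrCov_integral {φ ψ : ℝ → ℝ → ℝ} {w : ℝ × ℝ → ℝ}
    (hint : ∀ x y, Integrable (fun e : ℝ × ℝ => φ x e.1 * ψ y e.2 * w e))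
    (u v x y u' v' x' y' : ℝ) :
    incrCov (fun x y => ∫ e : ℝ × ℝ, φ x e.1 * ψ y e.2 * w e) u v x y u' v' x' y' =
      ∫ e : ℝ × ℝ, polarIncr (φ · e.1) u x u' x' * polarIncr (ψ · e.2) v y v' y' * w e / 4 := by
  rw [incrCov, integral_div]
  congr 1
  simp_rw [polarIncr_eq_sum, Finset.sum_mul_sum, Finset.sum_mul, Finset.mul_sum]
  have hi : ∀ r t x y : ℝ, Integrable (fun e : ℝ × ℝ => r * φ x e.1 * (t * ψ y e.2) * w e) :=
    fun r t x y => ((hint x y).const_mul (r * t)).congr (Eventually.of_forall fun e => by ring)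
  rw [integral_finsetSum _ fun i _ => integrable_finsetSum _ fun j _ => hi _ _ _ _]
  refine Finset.sum_congr rfl fun i _ => ?_
  rw [integral_finsetSum _ fun j _ => hi _ _ _ _]
  refine Finset.sum_congr rfl fun j _ => ?_
  rw [← mul_assoc, ← integral_const_mul]
  exact integral_congr_ae (Eventually.of_forall fun e => by ring)

/-- Translating an interval by `z` multiplies its Fourier transform by a phase, whose real part is
the cosine. -/
lemma polarIncr_sqKernel (a z u : ℝ) :
    polarIncr (sqKernel · u) a (a + 1) (a + z) (a + 1 + z) = 
      2 * Real.cos (z * u) * sqKernel 1 u := by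
  simp only [polarIncr, sqKernel]
  rw [show (a + 1 - (a + z)) * u = u - z * u by ring,
    show (a - (a + 1 + z)) * u = -(u + z * u) by ring,
    show (a + 1 - (a + 1 + z)) * u = -(z * u) by ring, show (a - (a + z)) * u = -(z * u) by ring,
    Real.cos_neg, Real.cos_neg, Real.cos_sub, Real.cos_add, one_mul]
  ring

lemma cos_mul_cos_lt_one {z w u v : ℝ} (hzw : (z, w) ≠ (0, 0)) (hu : 0 < u)
    (hu1 : |z| * u < 1) (hv : 0 < v) (hv1 : |w| * v < 1) :
    Real.cos (z * u) * Real.cos (w * v) < 1 := by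
  have hpi := Real.pi_gt_three
  have key : ∀ {z u : ℝ}, 0 < u → |z| * u < 1 → 0 < Real.cos (z * u) ∧
      (z ≠ 0 → Real.cos (z * u) < 1) := by
    intro z u hu hu1
    have h1 : |z * u| < 1 := by rwa [abs_mul, abs_of_pos hu]
    refine ⟨Real.cos_pos_of_mem_Ioo ⟨by linarith [(abs_lt.1 h1).1], by linarith [(abs_lt.1 h1).2]⟩,
      fun hz => ?_⟩
    have := Real.cos_le_one_sub_mul_cos_sq (x := z * u) (by linarith)
    have : 0 < 2 / Real.pi ^ 2 * (z * u) ^ 2 := by positivity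
    linarith
  obtain ⟨a1, a2⟩ := key hu hu1
  obtain ⟨b1, b2⟩ := key hv hv1
  have a3 := Real.cos_le_one (z * u)
  have b3 := Real.cos_le_one (w * v)
  by_cases hz : z = 0
  · have hw : w ≠ 0 := fun h => hzw (by rw [hz, h])
    have := b2 hw
    nlinarith
  · have := a2 hz
    nlinarith

section Dependence

variable {Ω : Type*} [MeasurableSpace Ω] {P : Measure Ω} {V : ℝ × ℝ → Ω → ℝ}

lemma incrCov_hVariogram_shift (hH₁ : 0 < H₁) (hH₁2 : H₁ < 2) (hH₂0 : 0 < H₂) (hH₂ : H₂ < 2)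
    (hc : 0 < c) (a b z w : ℝ) :
    incrCov (hVariogram H₁ H₂ c) a b (a + 1) (b + 1) (a + z) (b + w) (a + 1 + z) (b + 1 + w) =
      ∫ e : ℝ × ℝ, Real.cos (z * e.1) * Real.cos (w * e.2) *
        (sqKernel 1 e.1 * sqKernel 1 e.2 * hFun H₁ H₂ c e) := by
  refine (incrCov_integral (integrable_sqKernel_mul_hFun hH₁ hH₁2 hH₂0 hH₂ hc) _ _ _ _ _ _ _
    _).trans (integral_congr_ae (Eventually.of_forall fun e => ?_))
  simp only [polarIncr_sqKernel]
  ring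

/-- The covariance of a unit square with its translate by `(-b, a)` carries the extra spectral
factor `cos (b u) cos (a v)`. It is at most `1`, and strictly below `1` on a small box at the
origin, so the covariance is smaller than the variance. -/
lemma not_invariant_of_hVariogram (hH₁ : 0 < H₁) (hH₁2 : H₁ < 2) (hH₂0 : 0 < H₂) (hH₂ : H₂ < 2)
    (hc : 0 < c) (hV : IsVariogramField P V (hVariogram H₁ H₂ c)) {a b : ℝ} (hab : (a, b) ≠ (0, 0)) :
    ¬ InvariantIncrementsDir P V a b := by
  intro h
  -- Placing the square at `(M, M)` keeps both it and its translate in the quadrant.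
  set M := |a| + |b|
  have hM : 0 ≤ M := by positivity
  let K : Rect := ⟨M, M, M + 1, M + 1, by linarith, by linarith⟩
  have hK : K.toSet ⊆ openQuadrant := Rect.subset_openQuadrant hM hM
  have hK' : (K.shift (-b) a).toSet ⊆ openQuadrant := Rect.subset_openQuadrant
    (by simp only [K, Rect.shift, M]; linarith [le_abs_self b, abs_nonneg a])
    (by simp only [K, Rect.shift, M]; linarith [neg_abs_le a, abs_nonneg b])
  have h1 := (hV.incr_ae_eq_iff hK hK' (incrCov_shift_self _ K _ _)).1
    (h (-b) a (by ring) K hK hK')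
  have hzw : ((-b), a) ≠ (0, 0) := fun he => hab (by simp_all)
  have h2 := incrCov_hVariogram_shift hH₁ hH₁2 hH₂0 hH₂ hc M M (-b) a
  have h3 := incrCov_hVariogram_shift hH₁ hH₁2 hH₂0 hH₂ hc M M 0 0
  simp only [add_zero, zero_mul, Real.cos_zero, one_mul] at h3
  simp only [K, Rect.shift] at h1
  rw [h2, h3] at h1
  have hi := integrable_sqKernel_mul_hFun hH₁ hH₁2 hH₂0 hH₂ hc 1 1
  have hcc : ∀ e : ℝ × ℝ, |Real.cos (-b * e.1) * Real.cos (a * e.2)| ≤ 1 := fun e => by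
    rw [abs_mul]
    exact mul_le_one₀ (Real.abs_cos_le_one _) (abs_nonneg _) (Real.abs_cos_le_one _)
  have hi2 : Integrable (fun e : ℝ × ℝ => Real.cos (-b * e.1) * Real.cos (a * e.2) *
        (sqKernel 1 e.1 * sqKernel 1 e.2 * hFun H₁ H₂ c e)) :=
    hi.bdd_mul (c := 1) (by fun_prop) (Eventually.of_forall fun e => hcc e)
  have hg : ∀ e : ℝ × ℝ, 0 ≤ sqKernel 1 e.1 * sqKernel 1 e.2 * hFun H₁ H₂ c e := fun e =>
    mul_nonneg (mul_nonneg (sqKernel_nonneg _ _) (sqKernel_nonneg _ _)) (hFun_nonneg hc e)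
  have hpi := Real.pi_gt_three
  have h4 := integral_pos_of_pos_on (f := fun e : ℝ × ℝ =>
      sqKernel 1 e.1 * sqKernel 1 e.2 * hFun H₁ H₂ c e -
      Real.cos (-b * e.1) * Real.cos (a * e.2) *
        (sqKernel 1 e.1 * sqKernel 1 e.2 * hFun H₁ H₂ c e)) (a := (M + 1)⁻¹) (b := (M + 1)⁻¹)
    (fun e => by
      have := (abs_le.1 (hcc e)).2
      nlinarith [hg e])
    (hi.sub hi2) (by positivity) (by positivity) fun u v hu hu1 hv hv1 => ?_
  · rw [integral_sub hi hi2] at h4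
    linarith
  · have hM1 : (M + 1)⁻¹ ≤ 1 := inv_le_one_of_one_le₀ (by linarith)
    -- On the box of side `(M + 1)⁻¹` both arguments have absolute value below `1`, where cosines
    -- are positive, and less than `1` off zero.
    have hb : ∀ {z u : ℝ}, |z| ≤ M → 0 < u → u < (M + 1)⁻¹ → |z| * u < 1 := by
      intro z u hz hu hu1
      calc |z| * u ≤ M * u := by gcongr
        _ < (M + 1) * (M + 1)⁻¹ := by nlinarith
        _ = 1 := mul_inv_cancel₀ (by linarith)
    have hcos := cos_mul_cos_lt_one hzw hu
      (hb (by rw [abs_neg]; simp only [M]; linarith [abs_nonneg a]) hu hu1) hv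
      (hb (by simp only [M]; linarith [abs_nonneg b]) hv hv1)
    have hp : 0 < sqKernel 1 u * sqKernel 1 v * hFun H₁ H₂ c (u, v) :=
      mul_pos (mul_pos (sqKernel_pos (by linarith) (by linarith))
        (sqKernel_pos (by linarith) (by linarith))) (hFun_pos hc hu.ne')
    simp only
    nlinarith

/-- Two unit squares stacked on each other have covariance `(Φ(1,2) - 2 Φ(1,1)) / 2`, which is
positive by `hVariogram_double_right`. -/
lemma not_indep_vertical (hH₁ : 0 < H₁) (hH₁2 : H₁ < 2) (hH₂0 : 0 < H₂) (hH₂ : H₂ < 2)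
    (hc : 0 < c) (hV : IsVariogramField P V (hVariogram H₁ H₂ c)) (a : ℝ) :
    ¬ IndepIncrementsDir P V a 0 := by
  intro h
  let K : Rect := ⟨0, 0, 1, 1, one_pos, one_pos⟩
  let K' : Rect := ⟨0, 1, 1, 2, one_pos, one_lt_two⟩
  have hK : K.toSet ⊆ openQuadrant := Rect.subset_openQuadrant le_rfl le_rfl
  have hK' : K'.toSet ⊆ openQuadrant := Rect.subset_openQuadrant le_rfl zero_le_one
  have hs : Separated 0 1 1 K K' := Or.inl
    ⟨fun p hp => by have := hp.2.2; simp only [K] at this; linarith,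
      fun p hp => by have := hp.2.1; simp only [K'] at this; linarith⟩
  have := hV.incrCov_eq_zero hK hK' (h 0 1 1 (by simp) (by simp) K K' hK hK' hs)
  simp only [K, K', incrCov, polarIncr, sub_zero, zero_sub, sub_self, hVariogram_neg_left,
    hVariogram_neg_right, hVariogram_zero_left, hVariogram_zero_right] at this
  rw [show (1 : ℝ) - 2 = -1 by norm_num, hVariogram_neg_right] at this
  have := hVariogram_double_right hH₁ hH₁2 hH₂0 hH₂ hc
  linarith

/-- The lines orthogonal to the direction are `x - r y = const`. They separate rectangles of height
`1` on the first axis once the horizontal gap is at least `|r|`. Independence then makes mixed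
second differences of `F` vanish far out, so `F(2x) - 2F(x)` is eventually constant, against the
growth forced by scaling. -/
lemma not_indep_of_hVariogram (hH₁ : 0 < H₁) (hH : H₁ ≤ H₂) (hH₂ : H₂ < 2) (hc : 0 < c)
    (hV : IsVariogramField P V (hVariogram H₁ H₂ c)) {a b : ℝ} (hb : b ≠ 0) :
    ¬ IndepIncrementsDir P V a b := by
  have hH₂0 := hH₁.trans_le hH
  have hH₁2 := hH.trans_lt hH₂
  intro h
  set r := a / b
  set F : ℝ → ℝ := fun x => hVariogram H₁ H₂ c x 1
  have hF : ∀ g s t : ℝ, |r| ≤ g → 0 < s → 0 < t → F g + F (g + s + t) = F (g + s) + F (g + t) := by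
    intro g s t hg hs ht
    have hg0 := (abs_nonneg r).trans hg
    let K : Rect := ⟨0, 0, s, 1, hs, one_pos⟩
    let K' : Rect := ⟨s + g, 0, s + g + t, 1, by linarith, one_pos⟩
    have hK : K.toSet ⊆ openQuadrant := Rect.subset_openQuadrant le_rfl le_rfl
    have hK' : K'.toSet ⊆ openQuadrant := Rect.subset_openQuadrant (by positivity) le_rfl
    -- The level is an upper bound of `x - r y` on `K`, where `x ≤ s` and `0 < y ≤ 1`.
    have hsep : Separated 1 (-r) (s + max 0 (-r)) K K' := by
      refine Or.inl ⟨fun p hp => ?_, fun p hp => ?_⟩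
      · have h1 := hp.1.2
        have h2 := hp.2.1
        have h3 := hp.2.2
        simp only [K] at h1 h2 h3
        have : -r * p.2 ≤ max 0 (-r) := by
          rcases le_total 0 r with hr | hr
          · exact le_max_of_le_left (by nlinarith)
          · exact le_max_of_le_right (by nlinarith)
        linarith
      · have h1 := hp.1.1
        have h2 := hp.2.1
        have h3 := hp.2.2
        simp only [K'] at h1 h2 h3
        have : max 0 (-r) ≤ g + -r * p.2 := by
          rcases le_total 0 r with hr | hr
          · rw [abs_of_nonneg hr] at hg
            exact max_le (by nlinarith) (by nlinarith)
          · rw [abs_of_nonpos hr] at hg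
            exact max_le (by nlinarith) (by nlinarith)
        linarith
    have := hV.incrCov_eq_zero hK hK'
      (h 1 (-r) _ (by simp) (by simp only [r]; field_simp; ring) K K' hK hK' hsep)
    simp only [K, K', incrCov, polarIncr, sub_zero, zero_sub, sub_self, hVariogram_neg_left,
      hVariogram_neg_right, hVariogram_zero_right] at this
    rw [show s - (s + g) = -g by ring, show s - (s + g + t) = -(g + t) by ring,
      show s + g + t = g + s + t by ring, show s + g = g + s by ring] at this
    simp only [hVariogram_neg_left] at this
    simp only [F]
    linarith
  set k := |r| + 1
  have hk : 1 ≤ k := by have := abs_nonneg r; simp only [k]; linarith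
  have hconst : ∀ x, k < x → F (2 * x) - 2 * F x = F (2 * k) - 2 * F k := by
    intro x hx
    -- The two instances share the term `F (k + x)`; adding them eliminates it.
    have h1 := hF k (x - k) x (by simp only [k]; linarith) (by linarith) (by linarith)
    have h2 := hF k k (x - k) (by simp only [k]; linarith) (by linarith) (by linarith)
    rw [show k + (x - k) + x = 2 * x by ring, show k + (x - k) = x by ring] at h1
    rw [show k + k + (x - k) = k + x by ring, show k + (x - k) = x by ring,
      show k + k = 2 * k by ring] at h2
    linarith
  obtain ⟨C, hC, hd⟩ := hVariogram_double_left hH₁ hH₁2 hH₂0 hH₂ hc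
  have hgrow : ∀ x, k < x → C * x ^ (1 + H₁ - H₁ / H₂) ≤ F (2 * k) - 2 * F k := by
    intro x hx
    have hx0 : 0 < x := by linarith
    rw [← hconst x hx]
    have hγ : 0 ≤ H₁ / H₂ := by positivity
    have h1 := hd (x ^ (-(H₁ / H₂))) (by positivity)
      (Real.rpow_le_one_of_one_le_of_nonpos (by linarith) (by linarith))
    -- Rescaling by `x` shrinks the height to `d = x^{-H₁/H₂}`; the bound `C d²` lowers the exponent
    -- to `1 + H₁ - H₁/H₂`, positive because `H₁ ≤ H₂`.
    have h2 : ∀ y, F (x * y) = x ^ (1 + H₁ / H₂ + H₁) * hVariogram H₁ H₂ c y (x ^ (-(H₁ / H₂))) := by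
      intro y
      rw [← hVariogram_scale hH₁ hH₂0 hc hx0, ← Real.rpow_add hx0, add_neg_cancel, Real.rpow_zero]
    have h3 := h2 1
    rw [mul_one] at h3
    rw [mul_comm 2 x, h2, h3]
    calc C * x ^ (1 + H₁ - H₁ / H₂)
        = x ^ (1 + H₁ / H₂ + H₁) * (C * (x ^ (-(H₁ / H₂))) ^ 2) := by
          rw [← Real.rpow_natCast (x ^ (-(H₁ / H₂))), ← Real.rpow_mul hx0.le, mul_left_comm,
            ← Real.rpow_add hx0]
          congr 2; push_cast; ring
      _ ≤ x ^ (1 + H₁ / H₂ + H₁) * (hVariogram H₁ H₂ c 2 (x ^ (-(H₁ / H₂))) -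
          2 * hVariogram H₁ H₂ c 1 (x ^ (-(H₁ / H₂)))) := by gcongr
      _ = _ := by ring
  have hexp : 0 < 1 + H₁ - H₁ / H₂ := by
    have : H₁ / H₂ ≤ 1 := (div_le_one hH₂0).2 hH
    linarith
  have ht := (tendsto_rpow_atTop hexp).const_mul_atTop hC
  obtain ⟨x, hx1, hx2⟩ := ((ht.eventually_gt_atTop (F (2 * k) - 2 * F k)).and
    (eventually_gt_atTop k)).exists
  exact absurd (hgrow x hx2) (not_le.2 hx1)

theorem dependentIncrements_of_hVariogram (hH₁ : 0 < H₁) (hH : H₁ ≤ H₂) (hH₂ : H₂ < 2) (hc : 0 < c)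
    (hV : IsVariogramField P V (hVariogram H₁ H₂ c)) : DependentIncrements P V := by
  intro a b hab
  have hH₂0 := hH₁.trans_le hH
  have hH₁2 := hH.trans_lt hH₂
  refine ⟨?_, not_invariant_of_hVariogram hH₁ hH₁2 hH₂0 hH₂ hc hV hab⟩
  by_cases hb : b = 0
  · subst hb
    exact not_indep_vertical hH₁ hH₁2 hH₂0 hH₂ hc hV a
  · exact not_indep_of_hVariogram hH₁ hH hH₂ hc hV hb

end Dependence

end

section

/-! ### Beta integrals and the marginals of `h` -/

/-- Write `(A + B w^p)^{-s}` as a Gamma integral in `t` and exchange the integrals; the integrals in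
`w` and then in `t` are Gamma integrals again, and the three Gamma values combine to a beta value.
-/
lemma integral_Ioi_add_mul_rpow {p s A B : ℝ} (hp : 0 < p) (hs : 1 / p < s) (hA : 0 < A)
    (hB : 0 < B) :
    ∫ w in Set.Ioi (0 : ℝ), (1 / (A + B * w ^ p)) ^ s =
      A ^ (1 / p - s) * B ^ (-1 / p) * (1 / p * beta (1 / p) (s - 1 / p)) := by
  have hp1 : 0 < 1 / p := by positivity
  have hs0 : 0 < s := hp1.trans hs
  have hsp : 0 < s - 1 / p := sub_pos.2 hs
  set f : ℝ → ℝ → ℝ := fun w t =>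
    t ^ (s - 1) * Real.exp (-(A * t)) * Real.exp (-(t * B) * w ^ p) with hf
  have hfm : AEStronglyMeasurable (Function.uncurry f)
      ((volume.restrict (Set.Ioi (0 : ℝ))).prod (volume.restrict (Set.Ioi (0 : ℝ)))) := by
    have : Measurable (Function.uncurry f) := by simp only [hf, Function.uncurry_def]; fun_prop
    exact this.aestronglyMeasurable
  have hinner : ∀ t ∈ Set.Ioi (0 : ℝ), ∫ w in Set.Ioi (0 : ℝ), f w t =
      B ^ (-1 / p) * Real.Gamma (1 / p + 1) * (t ^ (s - 1 / p - 1) * Real.exp (-(A * t))) := by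
    intro t ht
    have ht : 0 < t := ht
    simp only [hf]
    rw [integral_const_mul, integral_exp_neg_mul_rpow hp (by positivity),
      Real.mul_rpow ht.le hB.le, show s - 1 / p - 1 = (s - 1) + (-1 / p) by ring,
      Real.rpow_add ht]
    ring
  have hint : Integrable (Function.uncurry f)
      ((volume.restrict (Set.Ioi (0 : ℝ))).prod (volume.restrict (Set.Ioi (0 : ℝ)))) := by
    rw [integrable_prod_iff' hfm]
    constructor
    · filter_upwards [ae_restrict_mem measurableSet_Ioi] with t ht
      have ht : 0 < t := ht
      have := integrableOn_rpow_mul_exp_neg_mul_rpow (s := 0) (b := t * B) (by norm_num) hp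
        (by positivity)
      simp only [Real.rpow_zero, one_mul] at this
      exact Integrable.const_mul this (t ^ (s - 1) * Real.exp (-(A * t)))
    · have hi := integrableOn_rpow_mul_exp_neg_mul_rpow (s := s - 1 / p - 1) (by linarith) one_pos hA
      simp only [Real.rpow_one] at hi
      refine (hi.const_mul (B ^ (-1 / p) * Real.Gamma (1 / p + 1))).congr ?_
      filter_upwards [ae_restrict_mem measurableSet_Ioi] with t ht
      rw [neg_mul, ← hinner t ht]
      refine setIntegral_congr_fun measurableSet_Ioi fun w _ => ?_
      have ht : 0 < t := ht
      exact (Real.norm_of_nonneg (by simp only [hf]; positivity)).symm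
  have hswap := integral_integral_swap hint
  have hleft : ∀ w ∈ Set.Ioi (0 : ℝ), ∫ t in Set.Ioi (0 : ℝ), f w t =
      (1 / (A + B * w ^ p)) ^ s * Real.Gamma s := by
    intro w hw
    have hw : 0 < w := hw
    rw [← Real.integral_rpow_mul_exp_neg_mul_Ioi hs0 (by positivity)]
    refine setIntegral_congr_fun measurableSet_Ioi fun t _ => ?_
    simp only [hf]
    rw [mul_assoc, ← Real.exp_add]
    congr 2
    ring
  rw [setIntegral_congr_fun measurableSet_Ioi hleft, setIntegral_congr_fun measurableSet_Ioi hinner,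
    integral_mul_const, integral_const_mul, Real.integral_rpow_mul_exp_neg_mul_Ioi hsp hA] at hswap
  have hG := Real.Gamma_pos_of_pos hs0
  rw [eq_div_of_mul_eq hG.ne' hswap, beta, Real.Gamma_add_one hp1.ne', add_sub_cancel, one_div A,
    Real.inv_rpow hA.le, ← Real.rpow_neg hA.le, neg_sub]
  ring

lemma integral_add_mul_abs_rpow {p s A B : ℝ} (hp : 0 < p) (hs : 1 / p < s) (hA : 0 < A)
    (hB : 0 < B) :
    ∫ w : ℝ, 1 / (A + B * |w| ^ p) ^ s =
      A ^ (1 / p - s) * B ^ (-1 / p) * (2 / p * beta (1 / p) (s - 1 / p)) := by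
  have h := integral_comp_abs (f := fun w => (1 / (A + B * w ^ p)) ^ s)
  rw [integral_Ioi_add_mul_rpow hp hs hA hB] at h
  calc _ = ∫ w : ℝ, (1 / (A + B * |w| ^ p)) ^ s := by
        refine integral_congr_ae (Eventually.of_forall fun w => ?_)
        simp only
        rw [Real.div_rpow zero_le_one (by positivity), Real.one_rpow]
    _ = _ := h.trans (by ring)

variable {H₁ H₂ c : ℝ}

lemma rho₁_sq (hH₁ : 1 < H₁) : rho₁ H₁ ^ 2 = beta (1 / 2) ((H₁ - 1) / 2) :=
  Real.sq_sqrt (beta_pos (by norm_num) (by linarith)).le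

lemma rho₂_sq (hH₁ : 0 < H₁) (hH₂ : 1 < H₂) : rho₂ H₁ H₂ ^ 2 =
    H₁ / H₂ * beta (H₁ / (2 * H₂)) ((H₁ * H₂ - H₁) / (2 * H₂)) := by
  refine Real.sq_sqrt (mul_nonneg (by positivity) (beta_pos (by positivity) (div_pos ?_ ?_)).le)
  · nlinarith
  · linarith

lemma rho₁_pos (hH₁ : 1 < H₁) : 0 < rho₁ H₁ :=
  Real.sqrt_pos.2 (beta_pos (by norm_num) (by linarith))

lemma rho₂_pos (hH₁ : 0 < H₁) (hH₂ : 1 < H₂) : 0 < rho₂ H₁ H₂ := by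
  refine Real.sqrt_pos.2 (mul_pos (by positivity) (beta_pos (by positivity) (div_pos ?_ ?_)))
  · nlinarith
  · linarith

/-- The source of the constant and of the power of `|v|` in the limit field for `γ > γ₀`, `H₁ > 1`;
the condition on `H₁` is integrability at infinity. -/
lemma integral_hFun_left (hH₁ : 1 < H₁) (hc : 0 < c) {v : ℝ} (hv : v ≠ 0) :
    ∫ u, hFun H₁ H₂ c (u, v) =
      (rho₁ H₁ * c ^ ((1 - H₁) / 4)) ^ 2 * |v| ^ (-((H₁ * H₂ - H₂) / H₁)) := by
  have hv0 : 0 < |v| := abs_pos.2 hv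
  have h := integral_add_mul_abs_rpow (p := 2) (s := H₁ / 2) (A := c * |v| ^ (2 * H₂ / H₁)) (B := 1)
    two_pos (by linarith) (by positivity) one_pos
  simp only [one_mul, Real.one_rpow, Real.rpow_two] at h
  simp only [hFun]
  simp_rw [add_comm (|_| ^ 2)]
  rw [h, mul_pow, rho₁_sq hH₁, Real.mul_rpow hc.le (by positivity), ← Real.rpow_mul hv0.le,
    ← Real.rpow_natCast (c ^ _), ← Real.rpow_mul hc.le,
    show (H₁ - 1) / 2 = H₁ / 2 - 1 / 2 by ring,
    show (1 - H₁) / 4 * ((2 : ℕ) : ℝ) = 1 / 2 - H₁ / 2 by push_cast; ring,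
    show 2 * H₂ / H₁ * (1 / 2 - H₁ / 2) = -((H₁ * H₂ - H₂) / H₁) by field_simp; ring]
  ring

lemma integral_hFun_right (hH₁ : 0 < H₁) (hH₂ : 1 < H₂) (hc : 0 < c) {u : ℝ} (hu : u ≠ 0) :
    ∫ v, hFun H₁ H₂ c (u, v) =
      (rho₂ H₁ H₂ * c ^ (-H₁ / (4 * H₂))) ^ 2 * |u| ^ (-((H₁ * H₂ - H₁) / H₂)) := by
  have hu0 : 0 < |u| := abs_pos.2 hu
  have hH₂0 : 0 < H₂ := one_pos.trans hH₂
  have h := integral_add_mul_abs_rpow (p := 2 * H₂ / H₁) (s := H₁ / 2) (A := |u| ^ 2) (B := c)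
    (by positivity) (by
      rw [one_div_div, div_lt_div_iff₀ (by positivity) (by norm_num)]
      nlinarith) (by positivity) hc
  simp only [hFun]
  rw [h, mul_pow, rho₂_sq hH₁ hH₂, ← Real.rpow_natCast (|u|), ← Real.rpow_mul hu0.le,
    ← Real.rpow_natCast (c ^ _), ← Real.rpow_mul hc.le,
    show (H₁ * H₂ - H₁) / (2 * H₂) = H₁ / 2 - 1 / (2 * H₂ / H₁) by field_simp,
    show H₁ / (2 * H₂) = 1 / (2 * H₂ / H₁) by field_simp,
    show -H₁ / (4 * H₂) * ((2 : ℕ) : ℝ) = -1 / (2 * H₂ / H₁) by push_cast; field_simp; norm_num,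
    show ((2 : ℕ) : ℝ) * (1 / (2 * H₂ / H₁) - H₁ / 2) = -((H₁ * H₂ - H₁) / H₂) by
      push_cast; field_simp; ring,
    show 2 / (2 * H₂ / H₁) = H₁ / H₂ by field_simp]
  ring

end

section

variable {H₁ H₂ c γ : ℝ}

/-! ### The variogram of the limit field -/

/-- `∫ |e_1(u)|² |u|^{-a} du`. -/
noncomputable def kernelConst (a : ℝ) : ℝ := ∫ u, sqKernel 1 u * |u| ^ (-a)

lemma integral_plane_sheet (r : ℝ) {a b : ℝ} (ha : 0 ≤ a) (hb : 0 ≤ b) (x y : ℝ) :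
    ∫ e : ℝ × ℝ, sqKernel x e.1 * sqKernel y e.2 * (r * (|e.1| ^ (-a) * |e.2| ^ (-b))) =
      sheetVariogram (r * kernelConst a * kernelConst b) a b x y := by
  have h := integral_prod_mul (μ := (volume : Measure ℝ)) (ν := (volume : Measure ℝ))
    (fun u : ℝ => sqKernel x u * |u| ^ (-a)) (fun v : ℝ => sqKernel y v * |v| ^ (-b))
  rw [integral_sqKernel_mul_rpow x ha, integral_sqKernel_mul_rpow y hb] at h
  rw [Measure.volume_eq_prod]
  calc _ = ∫ e : ℝ × ℝ, r * ((sqKernel x e.1 * |e.1| ^ (-a)) * (sqKernel y e.2 * |e.2| ^ (-b)))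
        ∂((volume : Measure ℝ).prod volume) :=
        integral_congr_ae (Eventually.of_forall fun e => by ring)
    _ = _ := by
      rw [integral_const_mul, h, sheetVariogram, kernelConst, kernelConst]
      ring

lemma integrable_plane_sheet (r : ℝ) {a b : ℝ} (ha : 0 ≤ a) (ha1 : a < 1) (hb : 0 ≤ b)
    (hb1 : b < 1) (x y : ℝ) : Integrable (fun e : ℝ × ℝ =>
      sqKernel x e.1 * sqKernel y e.2 * (r * (|e.1| ^ (-a) * |e.2| ^ (-b)))) := by
  have h := (integrable_sqKernel_mul_rpow x ha ha1).mul_prod (integrable_sqKernel_mul_rpow y hb hb1)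
  exact (h.const_mul r).congr (Eventually.of_forall fun e => by ring)

lemma line_sheet (κ : ℝ) {b : ℝ} (hb : 0 ≤ b) (x y : ℝ) :
    κ ^ 2 * x ^ 2 * ∫ v, sqKernel y v * |v| ^ (-b) =
      sheetVariogram (κ ^ 2 * kernelConst b) 1 b x y := by
  rw [integral_sqKernel_mul_rpow y hb, sheetVariogram, kernelConst, one_add_one_eq_two,
    Real.rpow_two, sq_abs]
  ring

lemma kernelConst_pos {a : ℝ} (ha : 0 ≤ a) (ha1 : a < 1) : 0 < kernelConst a :=
  integral_sqKernel_mul_rpow_pos ha ha1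

/-- The variogram of the limit field `V_γ`. -/
noncomputable def limitVariogram (H₁ H₂ c γ : ℝ) : ℝ → ℝ → ℝ :=
  if γ = H₁ / H₂ then hVariogram H₁ H₂ c
  else if H₁ / H₂ < γ then
    if H₁ < 1 then sheetVariogram (1 * kernelConst H₁ * kernelConst 0) H₁ 0
    else sheetVariogram ((rho₁ H₁ * c ^ ((1 - H₁) / 4)) ^ 2 * kernelConst ((H₁ * H₂ - H₂) / H₁)) 1
      ((H₁ * H₂ - H₂) / H₁)
  else
    if H₂ < 1 then sheetVariogram (c ^ (-H₁ / 2) * kernelConst 0 * kernelConst H₂) 0 H₂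
    else sheetVariogram ((rho₂ H₁ H₂ * c ^ (-H₁ / (4 * H₂))) ^ 2 *
      kernelConst ((H₁ * H₂ - H₁) / H₂)) ((H₁ * H₂ - H₁) / H₂) 1

/-- The admissible parameters. -/
structure Parameters (H₁ H₂ c : ℝ) : Prop where
  pos : 0 < H₁
  le : H₁ ≤ H₂
  lt_two : H₂ < 2
  ne₁ : H₁ ≠ 1
  ne₂ : H₂ ≠ 1
  c_pos : 0 < c

namespace Parameters

variable (h : Parameters H₁ H₂ c)
include h

lemma pos₂ : 0 < H₂ := h.pos.trans_le h.le

lemma lt_two₁ : H₁ < 2 := h.le.trans_lt h.lt_two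

lemma ratio_pos : 0 < H₁ / H₂ := div_pos h.pos h.pos₂

lemma one_lt₁ (h' : ¬H₁ < 1) : 1 < H₁ := lt_of_le_of_ne (not_lt.1 h') h.ne₁.symm

lemma one_lt₂ (h' : ¬H₂ < 1) : 1 < H₂ := lt_of_le_of_ne (not_lt.1 h') h.ne₂.symm

/-- The upper bound is `H₂ (H₁ - 1) < 2 (H₁ - 1) < H₁`. The open interval `(0, 1)` gives both
integrability of the kernel and dependence of the increments. -/
lemma exponent₁_mem (h' : ¬H₁ < 1) : 0 < (H₁ * H₂ - H₂) / H₁ ∧ (H₁ * H₂ - H₂) / H₁ < 1 := by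
  have h1 := h.one_lt₁ h'
  have h2 := h.pos₂
  have h3 := h.lt_two
  have h4 := h.le
  have h5 := h.pos
  refine ⟨div_pos (by nlinarith) h5, (div_lt_one h5).2 ?_⟩
  nlinarith

lemma exponent₂_mem (h' : ¬H₂ < 1) : 0 < (H₁ * H₂ - H₁) / H₂ ∧ (H₁ * H₂ - H₁) / H₂ < 1 := by
  have h1 := h.one_lt₂ h'
  have h2 := h.pos₂
  have h3 := h.lt_two
  have h4 := h.le
  have h5 := h.pos
  refine ⟨div_pos (by nlinarith) h2, (div_lt_one h2).2 ?_⟩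
  nlinarith

lemma limitVariogram_zero (γ x y : ℝ) :
    limitVariogram H₁ H₂ c γ 0 y = 0 ∧ limitVariogram H₁ H₂ c γ x 0 = 0 := by
  have := h.pos
  have := h.pos₂
  unfold limitVariogram
  split_ifs with h1 h2 h3 h3
  · simp
  · exact ⟨sheetVariogram_zero_left h.pos.le _, sheetVariogram_zero_right le_rfl _⟩
  · exact ⟨sheetVariogram_zero_left zero_le_one _,
      sheetVariogram_zero_right (h.exponent₁_mem h3).1.le _⟩
  · exact ⟨sheetVariogram_zero_left le_rfl _, sheetVariogram_zero_right h.pos₂.le _⟩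
  · exact ⟨sheetVariogram_zero_left (h.exponent₂_mem h3).1.le _,
      sheetVariogram_zero_right zero_le_one _⟩

lemma limitVariogram_scale {l : ℝ} (hl : 0 < l) (x y : ℝ) :
    limitVariogram H₁ H₂ c γ (l * x) (l ^ γ * y) =
      l ^ (2 * scalingExponent H₁ H₂ γ) * limitVariogram H₁ H₂ c γ x y := by
  have hp := h.pos
  have hp2 := h.pos₂
  unfold limitVariogram
  split_ifs with h1 h2 h3 h3
  · rw [h1, hVariogram_scale h.pos h.pos₂ h.c_pos hl]
    congr 2
    rw [scalingExponent, if_pos le_rfl]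
    split_ifs
    · ring
    · field_simp; ring
  · refine sheetVariogram_scale hl ?_ x y
    rw [scalingExponent, if_pos h2.le, if_pos h3]; ring
  · refine sheetVariogram_scale hl ?_ x y
    rw [scalingExponent, if_pos h2.le, if_neg h3]; field_simp; ring
  · refine sheetVariogram_scale hl ?_ x y
    rw [scalingExponent, if_neg fun h4 => h2 (lt_of_le_of_ne h4 (Ne.symm h1)), if_pos h3]; ring
  · refine sheetVariogram_scale hl ?_ x y
    rw [scalingExponent, if_neg fun h4 => h2 (lt_of_le_of_ne h4 (Ne.symm h1)), if_neg h3]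
    field_simp; ring

lemma scalingExponent_pos (hγ : 0 < γ) : 0 < scalingExponent H₁ H₂ γ := by
  have hp := h.pos
  have hp2 := h.pos₂
  rw [scalingExponent]
  split_ifs with h1 h2 h2
  · linarith
  · have := h.one_lt₁ h2
    have e : γ * H₁ + γ * H₁ * H₂ - γ * H₂ + 2 * H₁ = γ * H₁ + γ * H₂ * (H₁ - 1) + 2 * H₁ := by ring
    rw [e]
    have : 0 < γ * H₂ * (H₁ - 1) := mul_pos (mul_pos hγ hp2) (by linarith)
    positivity
  · positivity
  · have := h.one_lt₂ h2
    have e : H₂ + H₁ * H₂ - H₁ + 2 * γ * H₂ = H₂ + H₁ * (H₂ - 1) + 2 * γ * H₂ := by ring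
    rw [e]
    have : 0 < H₁ * (H₂ - 1) := mul_pos hp (by linarith)
    positivity

variable {Ω : Type*} [MeasurableSpace Ω] {P : Measure Ω} {V : ℝ × ℝ → Ω → ℝ}

theorem semiDependentIncrements (hγ : γ ≠ H₁ / H₂)
    (hV : IsVariogramField P V (limitVariogram H₁ H₂ c γ)) : SemiDependentIncrements P V := by
  have hc := h.c_pos
  rw [limitVariogram, if_neg hγ] at hV
  split_ifs at hV with h2 h3 h3
  · exact sheet_semiDependent_left (mul_pos (mul_pos one_pos (kernelConst_pos h.pos.le h3))
      (kernelConst_pos le_rfl one_pos)) h.pos h3 (Or.inl rfl) hV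
  · have h4 := h.exponent₁_mem h3
    have h5 := rho₁_pos (h.one_lt₁ h3)
    have h6 := kernelConst_pos h4.1.le h4.2
    exact sheet_semiDependent_right (by positivity) h4.1 h4.2 (Or.inr rfl) hV
  · have h4 := kernelConst_pos (a := 0) le_rfl one_pos
    have h5 := kernelConst_pos h.pos₂.le h3
    exact sheet_semiDependent_right (by positivity) h.pos₂ h3 (Or.inl rfl) hV
  · have h4 := h.exponent₂_mem h3
    have h5 := rho₂_pos h.pos (h.one_lt₂ h3)
    have h6 := kernelConst_pos h4.1.le h4.2
    exact sheet_semiDependent_left (by positivity) h4.1 h4.2 (Or.inr rfl) hV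

theorem dependentIncrements (hγ : γ = H₁ / H₂)
    (hV : IsVariogramField P V (limitVariogram H₁ H₂ c γ)) : DependentIncrements P V := by
  rw [limitVariogram, if_pos hγ] at hV
  exact dependentIncrements_of_hVariogram h.pos h.le h.lt_two h.c_pos hV

end Parameters

end

section

variable {H₁ H₂ c γ : ℝ} {Ω : Type*} [MeasurableSpace Ω] {P : Measure Ω}
  {W : FiniteVolumeSet (ℝ × ℝ) → Ω → ℂ} {W₁ : FiniteVolumeSet ℝ → Ω → ℂ}

/-! ### The limit field -/

theorem IsGaussianNoise.plane_field (hW : IsGaussianNoise P W) {s w : ℝ × ℝ → ℝ}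
    (hs : Measurable s) (hsw : ∀ q, s q ^ 2 = w q) (hsn : ∀ q, s (-q) = s q)
    (hint : ∀ x y, Integrable (fun q : ℝ × ℝ => sqKernel x q.1 * sqKernel y q.2 * w q)) :
    ∃ V : ℝ × ℝ → Ω → ℝ, ∀ x y,
      IsStochasticIntegral P W (planeKernel s x y) (fun ω => (V (x, y) ω : ℂ)) := by
  choose V hV using fun p : ℝ × ℝ => hW.exists_real (memLp_planeKernel hs hsw (hint p.1 p.2))
    (planeKernel_neg hsn p.1 p.2)
  exact ⟨V, fun x y => hV (x, y)⟩

theorem IsGaussianNoise.line_field (hW : IsGaussianNoise P W₁) {s w : ℝ → ℝ}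
    (hs : Measurable s) (hsw : ∀ q, s q ^ 2 = w q) (hsn : ∀ q, s (-q) = s q)
    (hint : ∀ y, Integrable (fun v : ℝ => sqKernel y v * w v)) (κ : ℝ) :
    ∃ V : ℝ × ℝ → Ω → ℝ, ∀ x y,
      IsStochasticIntegral P W₁ (lineKernel s κ x y) (fun ω => (V (x, y) ω : ℂ)) := by
  choose V hV using fun p : ℝ × ℝ => hW.exists_real (memLp_lineKernel hs hsw κ p.1 (hint p.2))
    (lineKernel_neg hsn κ p.1 p.2)
  exact ⟨V, fun x y => hV (x, y)⟩

lemma abs_rpow_sq (u : ℝ) {a b : ℝ} (h : 2 * a = b) : (|u| ^ a) ^ 2 = |u| ^ b := by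
  rw [← Real.rpow_natCast, ← Real.rpow_mul (abs_nonneg u), ← h]
  congr 1; push_cast; ring

lemma rpow_mul_self_sq {r a b : ℝ} (hr : 0 ≤ r) (h : 2 * a = b) : (r ^ a) ^ 2 = r ^ b := by
  have := abs_rpow_sq r h
  rwa [abs_of_nonneg hr] at this

/-- The squared weight in the integrand of the limit field, when that is an integral over `ℝ²`. -/
noncomputable def planeWeight (H₁ H₂ c γ : ℝ) (q : ℝ × ℝ) : ℝ :=
  if γ = H₁ / H₂ then hFun H₁ H₂ c q
  else if H₁ / H₂ < γ then |q.1| ^ (-H₁) else c ^ (-H₁ / 2) * |q.2| ^ (-H₂)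

/-- The limit field is an integral over `ℝ²`. -/
def PlaneCase (H₁ H₂ γ : ℝ) : Prop :=
  γ = H₁ / H₂ ∨ (H₁ / H₂ < γ ∧ H₁ < 1) ∨ (γ < H₁ / H₂ ∧ H₂ < 1)

namespace Parameters

variable (h : Parameters H₁ H₂ c)
include h

lemma integrable_planeWeight (hγ : PlaneCase H₁ H₂ γ) (x y : ℝ) :
    Integrable (fun q : ℝ × ℝ => sqKernel x q.1 * sqKernel y q.2 * planeWeight H₁ H₂ c γ q) := by
  have h0 := h.pos
  have h2 := h.pos₂
  rcases hγ with hγ | ⟨hγ, h1⟩ | ⟨hγ, h1⟩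
  · simp only [planeWeight, if_pos hγ]
    exact integrable_sqKernel_mul_hFun h.pos h.lt_two₁ h.pos₂ h.lt_two h.c_pos x y
  · simp only [planeWeight, if_neg hγ.ne', if_pos hγ]
    exact (integrable_plane_sheet 1 h.pos.le h1 le_rfl one_pos x y).congr
      (Eventually.of_forall fun q => by simp)
  · simp only [planeWeight, if_neg hγ.ne, if_neg hγ.not_gt]
    exact (integrable_plane_sheet (c ^ (-H₁ / 2)) le_rfl one_pos h.pos₂.le h1 x y).congr
      (Eventually.of_forall fun q => by simp)

lemma integral_planeWeight (hγ : PlaneCase H₁ H₂ γ) (x y : ℝ) :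
    ∫ q : ℝ × ℝ, sqKernel x q.1 * sqKernel y q.2 * planeWeight H₁ H₂ c γ q =
      limitVariogram H₁ H₂ c γ x y := by
  have h0 := h.pos
  have h2 := h.pos₂
  rcases hγ with hγ | ⟨hγ, h1⟩ | ⟨hγ, h1⟩
  · simp only [planeWeight, limitVariogram, if_pos hγ, hVariogram]
  · simp only [planeWeight, limitVariogram, if_neg hγ.ne', if_pos hγ, if_pos h1]
    rw [← integral_plane_sheet 1 h.pos.le le_rfl x y]
    exact integral_congr_ae (Eventually.of_forall fun q => by simp)
  · simp only [planeWeight, limitVariogram, if_neg hγ.ne, if_neg hγ.not_gt, if_pos h1]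
    rw [← integral_plane_sheet (c ^ (-H₁ / 2)) le_rfl h.pos₂.le x y]
    exact integral_congr_ae (Eventually.of_forall fun q => by simp)

omit h in
lemma planeWeight_neg_left (u v : ℝ) :
    planeWeight H₁ H₂ c γ (-u, v) = planeWeight H₁ H₂ c γ (u, v) := by
  simp [planeWeight, hFun_neg_left]

omit h in
lemma planeWeight_neg (q : ℝ × ℝ) :
    planeWeight H₁ H₂ c γ (-q) = planeWeight H₁ H₂ c γ q := by
  simp [planeWeight, hFun_neg]

omit h in
lemma measurable_planeWeight : Measurable (planeWeight H₁ H₂ c γ) := by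
  unfold planeWeight
  split_ifs <;> fun_prop

lemma planeWeight_nonneg (q : ℝ × ℝ) : 0 ≤ planeWeight H₁ H₂ c γ q := by
  have := h.c_pos
  unfold planeWeight
  split_ifs
  · exact hFun_nonneg h.c_pos q
  · positivity
  · positivity

lemma isLimitField_iff_plane (hγ : PlaneCase H₁ H₂ γ) (V : ℝ × ℝ → Ω → ℝ) :
    IsLimitField H₁ H₂ c γ P W W₁ V ↔ ∀ x y, 0 ≤ x → 0 ≤ y →
      IsStochasticIntegral P W (planeKernel (fun q => √(planeWeight H₁ H₂ c γ q)) x y)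
        (fun ω => (V (x, y) ω : ℂ)) := by
  have hc := h.c_pos
  refine forall₂_congr fun x y => forall₂_congr fun hx hy => ?_
  rcases hγ with hγ | ⟨hγ, h1⟩ | ⟨hγ, h1⟩
  · simp only [if_pos hγ]
    refine iff_of_eq (congrArg (IsStochasticIntegral P W · _) (funext fun q => ?_))
    simp only [planeKernel, planeWeight, if_pos hγ]
  · simp only [if_neg hγ.ne', if_pos hγ, if_pos h1]
    refine iff_of_eq (congrArg (IsStochasticIntegral P W · _) (funext fun q => ?_))
    simp only [planeKernel, planeWeight, if_neg hγ.ne', if_pos hγ]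
    rw [← abs_rpow_sq q.1 (show 2 * (-H₁ / 2) = -H₁ by ring), Real.sqrt_sq (by positivity)]
  · simp only [if_neg hγ.ne, if_neg hγ.not_gt, if_pos h1]
    refine iff_of_eq (congrArg (IsStochasticIntegral P W · _) (funext fun q => ?_))
    simp only [planeKernel, planeWeight, if_neg hγ.ne, if_neg hγ.not_gt]
    rw [← abs_rpow_sq q.2 (show 2 * (-H₂ / 2) = -H₂ by ring),
      ← rpow_mul_self_sq hc.le (show 2 * (-H₁ / 4) = -H₁ / 2 by ring), ← mul_pow,
      Real.sqrt_sq (by positivity)]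
    push_cast
    ring

omit h in
lemma isLimitField_iff_left (hγ : H₁ / H₂ < γ) (h1 : ¬H₁ < 1) (V : ℝ × ℝ → Ω → ℝ) :
    IsLimitField H₁ H₂ c γ P W W₁ V ↔ ∀ x y, 0 ≤ x → 0 ≤ y →
      IsStochasticIntegral P W₁ (lineKernel (fun v => |v| ^ (-(H₁ * H₂ - H₂) / (2 * H₁)))
        (rho₁ H₁ * c ^ ((1 - H₁) / 4)) x y) (fun ω => (V (x, y) ω : ℂ)) := by
  refine forall₂_congr fun x y => forall₂_congr fun hx hy => ?_
  simp only [if_neg hγ.ne', if_pos hγ, if_neg h1]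
  refine iff_of_eq (congrArg (IsStochasticIntegral P W₁ · _) (funext fun q => ?_))
  simp only [lineKernel, mul_assoc]

omit h in
lemma isLimitField_iff_right (hγ : γ < H₁ / H₂) (h1 : ¬H₂ < 1) (V : ℝ × ℝ → Ω → ℝ) :
    IsLimitField H₁ H₂ c γ P W W₁ V ↔ ∀ x y, 0 ≤ x → 0 ≤ y →
      IsStochasticIntegral P W₁ (lineKernel (fun v => |v| ^ (-(H₁ * H₂ - H₁) / (2 * H₂)))
        (rho₂ H₁ H₂ * c ^ (-H₁ / (4 * H₂))) y x) (fun ω => (V (x, y) ω : ℂ)) := by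
  refine forall₂_congr fun x y => forall₂_congr fun hx hy => ?_
  simp only [if_neg hγ.ne, if_neg hγ.not_gt, if_neg h1]
  refine iff_of_eq (congrArg (IsStochasticIntegral P W₁ · _) (funext fun q => ?_))
  simp only [lineKernel, mul_assoc]

omit h in
lemma cases (γ : ℝ) : PlaneCase H₁ H₂ γ ∨ (H₁ / H₂ < γ ∧ ¬H₁ < 1) ∨ (γ < H₁ / H₂ ∧ ¬H₂ < 1) := by
  unfold PlaneCase
  rcases lt_trichotomy γ (H₁ / H₂) with h | h | h <;> tauto

lemma lineVariogram_left (hγ : H₁ / H₂ < γ) (h1 : ¬H₁ < 1) (x y : ℝ) :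
    (rho₁ H₁ * c ^ ((1 - H₁) / 4)) ^ 2 * x ^ 2 *
      ∫ v, sqKernel y v * |v| ^ (-((H₁ * H₂ - H₂) / H₁)) = limitVariogram H₁ H₂ c γ x y := by
  rw [limitVariogram, if_neg hγ.ne', if_pos hγ, if_neg h1, line_sheet _ (h.exponent₁_mem h1).1.le]

lemma lineVariogram_right (hγ : γ < H₁ / H₂) (h1 : ¬H₂ < 1) (x y : ℝ) :
    (rho₂ H₁ H₂ * c ^ (-H₁ / (4 * H₂))) ^ 2 * y ^ 2 *
      ∫ v, sqKernel x v * |v| ^ (-((H₁ * H₂ - H₁) / H₂)) = limitVariogram H₁ H₂ c γ x y := by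
  rw [limitVariogram, if_neg hγ.ne, if_neg hγ.not_gt, if_neg h1,
    line_sheet _ (h.exponent₂_mem h1).1.le, sheetVariogram, sheetVariogram]
  ring

theorem exists_isLimitField (hW : IsGaussianNoise P W) (hW₁ : IsGaussianNoise P W₁) (γ : ℝ) :
    ∃ V : ℝ × ℝ → Ω → ℝ, IsLimitField H₁ H₂ c γ P W W₁ V := by
  have hp := h.pos
  have hp2 := h.pos₂
  rcases cases (H₁ := H₁) (H₂ := H₂) γ with hγ | ⟨hγ, h1⟩ | ⟨hγ, h1⟩
  · obtain ⟨V, hV⟩ := hW.plane_field measurable_planeWeight.sqrt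
      (fun q => Real.sq_sqrt (h.planeWeight_nonneg (γ := γ) q))
      (fun q => by rw [planeWeight_neg]) (h.integrable_planeWeight hγ)
    exact ⟨V, (h.isLimitField_iff_plane hγ V).2 fun x y _ _ => hV x y⟩
  · have he := h.exponent₁_mem h1
    obtain ⟨V, hV⟩ := hW₁.line_field (s := fun v => |v| ^ (-(H₁ * H₂ - H₂) / (2 * H₁)))
      (by fun_prop) (fun v => abs_rpow_sq v (b := -((H₁ * H₂ - H₂) / H₁)) (by field_simp))
      (fun v => by rw [abs_neg])
      (fun y => integrable_sqKernel_mul_rpow y he.1.le he.2) (rho₁ H₁ * c ^ ((1 - H₁) / 4))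
    exact ⟨V, (isLimitField_iff_left hγ h1 V).2 fun x y _ _ => hV x y⟩
  · have he := h.exponent₂_mem h1
    obtain ⟨V, hV⟩ := hW₁.line_field (s := fun v => |v| ^ (-(H₁ * H₂ - H₁) / (2 * H₂)))
      (by fun_prop) (fun v => abs_rpow_sq v (b := -((H₁ * H₂ - H₁) / H₂)) (by field_simp))
      (fun v => by rw [abs_neg])
      (fun y => integrable_sqKernel_mul_rpow y he.1.le he.2)
      (rho₂ H₁ H₂ * c ^ (-H₁ / (4 * H₂)))
    -- `lineKernel` is linear in its first coordinate, while this field is linear in `y`, so the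
    -- coordinates are exchanged.
    exact ⟨fun p => V p.swap, (isLimitField_iff_right hγ h1 _).2 fun x y _ _ => hV y x⟩

theorem isVariogramField (hW : IsGaussianNoise P W) (hW₁ : IsGaussianNoise P W₁) {γ : ℝ}
    {V : ℝ × ℝ → Ω → ℝ} (hV : IsLimitField H₁ H₂ c γ P W W₁ V) :
    IsVariogramField P V (limitVariogram H₁ H₂ c γ) := by
  have hp := h.pos
  have hp2 := h.pos₂
  rcases cases (H₁ := H₁) (H₂ := H₂) γ with hγ | ⟨hγ, h1⟩ | ⟨hγ, h1⟩
  · exact (hW.isVariogramField_plane measurable_planeWeight.sqrt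
      (fun q => Real.sq_sqrt (h.planeWeight_nonneg (γ := γ) q)) planeWeight_neg_left
      (h.integrable_planeWeight hγ) ((h.isLimitField_iff_plane hγ V).1 hV)).congr
        (h.integral_planeWeight hγ)
  · have he := h.exponent₁_mem h1
    exact (hW₁.isVariogramField_line (s := fun v => |v| ^ (-(H₁ * H₂ - H₂) / (2 * H₁)))
      (by fun_prop) (fun v => abs_rpow_sq v (b := -((H₁ * H₂ - H₂) / H₁)) (by field_simp))
      (fun y => integrable_sqKernel_mul_rpow y he.1.le he.2) _
      ((isLimitField_iff_left hγ h1 V).1 hV)).congr (h.lineVariogram_left hγ h1)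
  · have he := h.exponent₂_mem h1
    have := (hW₁.isVariogramField_line (s := fun v => |v| ^ (-(H₁ * H₂ - H₁) / (2 * H₂)))
      (V := fun p => V p.swap)
      (by fun_prop) (fun v => abs_rpow_sq v (b := -((H₁ * H₂ - H₁) / H₂)) (by field_simp))
      (fun y => integrable_sqKernel_mul_rpow y he.1.le he.2) _
      fun x y hx hy => (isLimitField_iff_right hγ h1 V).1 hV y x hy hx).swap
    exact this.congr (h.lineVariogram_right hγ h1)

end Parameters

end

section

/-! ### Dirichlet sums -/

/-- `∑_{t = 1}^N e^{itx}`. -/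
noncomputable def dirichletSum (N : ℤ) (x : ℝ) : ℂ :=
  ∑ t ∈ Finset.Icc (1 : ℤ) N, Complex.exp (Complex.I * (t * x))

@[fun_prop] lemma measurable_dirichletSum (N : ℤ) : Measurable (dirichletSum N) := by
  unfold dirichletSum; fun_prop

lemma norm_exp_I_mul_int (t : ℤ) (x : ℝ) : ‖Complex.exp (Complex.I * (t * x))‖ = 1 := by
  have := Complex.norm_exp_I_mul_ofReal (t * x)
  simpa using this

lemma norm_dirichletSum_le {N : ℤ} (hN : 0 ≤ N) (x : ℝ) : ‖dirichletSum N x‖ ≤ N := by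
  refine (norm_sum_le _ _).trans ?_
  simp only [norm_exp_I_mul_int, Finset.sum_const, Int.card_Icc, add_sub_cancel_right, nsmul_eq_mul,
    mul_one]
  rw [← Int.cast_natCast, Int.toNat_of_nonneg hN]

lemma norm_dirichletSum_sub_le {N : ℤ} (hN : 0 ≤ N) (x : ℝ) :
    ‖dirichletSum N x - N‖ ≤ N * (N * |x|) := by
  have hcard : ((Finset.Icc (1 : ℤ) N).card : ℤ) = N := by
    rw [Int.card_Icc, add_sub_cancel_right, Int.toNat_of_nonneg hN]
  have e : dirichletSum N x - N =
      ∑ t ∈ Finset.Icc (1 : ℤ) N, (Complex.exp (Complex.I * (t * x)) - 1) := by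
    rw [Finset.sum_sub_distrib, Finset.sum_const, nsmul_eq_mul, mul_one, dirichletSum,
      ← Int.cast_natCast (Finset.card _), hcard]
  rw [e]
  refine (norm_sum_le_of_le (n := fun _ => (N * |x| : ℝ)) _ fun t ht => ?_).trans_eq ?_
  · have := Real.norm_exp_I_mul_ofReal_sub_one_le (x := t * x)
    rw [Complex.ofReal_mul, Complex.ofReal_intCast] at this
    refine this.trans ?_
    obtain ⟨h1, h2⟩ := Finset.mem_Icc.1 ht
    rw [Real.norm_eq_abs, abs_mul]
    gcongr
    rw [abs_of_nonneg (by exact_mod_cast (zero_le_one.trans h1))]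
    exact_mod_cast h2
  · rw [Finset.sum_const, nsmul_eq_mul, ← Int.cast_natCast (Finset.card _), hcard]

/-- The geometric sum, in product form so that `x = 0` is no exception. -/
lemma dirichletSum_mul {N : ℤ} (hN : 0 ≤ N) (x : ℝ) :
    dirichletSum N x * (Complex.exp (Complex.I * x) - 1) =
      Complex.exp (Complex.I * x) * (Complex.exp (Complex.I * (N * x : ℝ)) - 1) := by
  induction N, hN using Int.leInduction with
  | base => simp [dirichletSum]
  | succ N hN ih =>
    have h1 : dirichletSum (N + 1) x = Complex.exp (Complex.I * ((N + 1 : ℤ) * x)) +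
        dirichletSum N x := by
      rw [dirichletSum, ← Finset.insert_Icc_right_eq_Icc_add_one (by omega),
        Finset.sum_insert (by simp), dirichletSum]
    rw [h1, add_mul, ih]
    have h2 : Complex.exp (Complex.I * ((N + 1 : ℤ) * x)) =
        Complex.exp (Complex.I * (N * x : ℝ)) * Complex.exp (Complex.I * x) := by
      rw [← Complex.exp_add]; congr 1; push_cast; ring
    have h3 : Complex.exp (Complex.I * (((N + 1 : ℤ) : ℝ) * x : ℝ)) =
        Complex.exp (Complex.I * (N * x : ℝ)) * Complex.exp (Complex.I * x) := by
      rw [← Complex.exp_add]; congr 1; push_cast; ring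
    rw [h2, h3]
    ring

lemma abs_mul_le_norm_exp_sub_one {x : ℝ} (hx : |x| ≤ Real.pi) :
    2 / Real.pi * |x| ≤ ‖Complex.exp (Complex.I * x) - 1‖ := by
  have h := Real.mul_abs_le_abs_sin (x := x / 2) (by rw [abs_div, abs_two]; linarith)
  rw [Complex.norm_exp_I_mul_ofReal_sub_one, Real.norm_eq_abs, abs_mul, abs_two]
  rw [abs_div, abs_two] at h
  calc 2 / Real.pi * |x| = 2 * (2 / Real.pi * (|x| / 2)) := by ring
    _ ≤ _ := by gcongr

/-- The geometric sum has numerator at most `2` and, by Jordan's inequality, denominator at least `2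
|x| / π`. Uniformity in `N` is what provides a dominating function. -/
lemma norm_dirichletSum_mul_le {N : ℤ} (hN : 0 ≤ N) {x : ℝ} (hx : |x| ≤ Real.pi) :
    ‖dirichletSum N x‖ * |x| ≤ Real.pi := by
  have hpi := Real.pi_pos
  have h1 : ‖dirichletSum N x‖ * ‖Complex.exp (Complex.I * x) - 1‖ ≤ 2 := by
    rw [← norm_mul, dirichletSum_mul hN, norm_mul, Complex.norm_exp_I_mul_ofReal, one_mul]
    refine (norm_sub_le _ _).trans ?_
    rw [Complex.norm_exp_I_mul_ofReal, norm_one]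
    norm_num
  have h2 := mul_le_mul_of_nonneg_left (abs_mul_le_norm_exp_sub_one hx)
    (norm_nonneg (dirichletSum N x))
  have h3 : ‖dirichletSum N x‖ * |x| * (2 / Real.pi) ≤ 2 := by linarith
  calc _ = ‖dirichletSum N x‖ * |x| * (2 / Real.pi) * (Real.pi / 2) := by field_simp
    _ ≤ 2 * (Real.pi / 2) := by gcongr
    _ = Real.pi := by ring

/-- The asymptotics `D_{⌊Ly⌋}(u/R) / L → δ_y(u)` of Dirichlet sums, dominated by `C m(u)`. -/
structure DirichletScaling (L R : ℕ → ℝ) (δ : ℝ → ℝ → ℂ) (m : ℝ → ℝ) : Prop where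
  tendsto_left : Tendsto L atTop atTop
  tendsto_right : Tendsto R atTop atTop
  lim : ∀ y, 0 ≤ y → ∀ u, u ≠ 0 →
    Tendsto (fun n => dirichletSum ⌊L n * y⌋ (u / R n) / L n) atTop (𝓝 (δ y u))
  bound : ∀ y, 0 ≤ y → ∃ C, 0 ≤ C ∧ ∀ᶠ n in atTop, ∀ u, |u / R n| ≤ Real.pi →
    ‖dirichletSum ⌊L n * y⌋ (u / R n) / L n‖ ^ 2 ≤ C * m u

lemma tendsto_floor_mul_div {L : ℕ → ℝ} (hL : Tendsto L atTop atTop) (y : ℝ) :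
    Tendsto (fun n => (⌊L n * y⌋ : ℝ) / L n) atTop (𝓝 y) := by
  have h1 : Tendsto (fun n => y - (L n)⁻¹) atTop (𝓝 y) := by
    simpa using tendsto_const_nhds.sub (tendsto_inv_atTop_zero.comp hL)
  refine tendsto_of_tendsto_of_tendsto_of_le_of_le' h1 tendsto_const_nhds ?_ ?_
  · filter_upwards [hL.eventually_gt_atTop 0] with n hn
    rw [le_div_iff₀ hn, sub_mul, inv_mul_cancel₀ hn.ne', mul_comm]
    exact (Int.sub_one_lt_floor _).le
  · filter_upwards [hL.eventually_gt_atTop 0] with n hn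
    rw [div_le_iff₀ hn, mul_comm]
    exact Int.floor_le _

lemma norm_dirichletSum_div_le {L : ℝ} (hL : 0 < L) {y : ℝ} (hy : 0 ≤ y) (x : ℝ) :
    ‖dirichletSum ⌊L * y⌋ x / L‖ ≤ y := by
  rw [norm_div, Complex.norm_real, Real.norm_of_nonneg hL.le, div_le_iff₀ hL, mul_comm]
  exact (norm_dirichletSum_le (Int.floor_nonneg.2 (by positivity)) x).trans (Int.floor_le _)

/-- A Riemann sum for `∫₀^y e^{isu} ds = -e_y(u)`; the sign disappears in covariances. The bound
combines `|D| ≤ L y` with `norm_dirichletSum_mul_le`. -/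
lemma dirichletScaling_eq {L : ℕ → ℝ} (hL : Tendsto L atTop atTop) :
    DirichletScaling L L (fun y u => -expKernel y u) (fun u => (1 + u ^ 2)⁻¹) where
  tendsto_left := hL
  tendsto_right := hL
  lim y hy u hu := by
    have hz : Tendsto (fun n => u / L n) atTop (𝓝 0) := hL.const_div_atTop u
    have hz' : Tendsto (fun n => u / L n) atTop (𝓝[≠] 0) :=
      tendsto_nhdsWithin_iff.2 ⟨hz, by
        filter_upwards [hL.eventually_gt_atTop 0] with n hn
        exact div_ne_zero hu hn.ne'⟩
    have hd : HasDerivAt (fun z : ℝ => Complex.exp (Complex.I * z)) Complex.I 0 := by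
      have h1 : HasDerivAt (fun z : ℝ => Complex.I * (z : ℂ)) (Complex.I * 1) 0 :=
        (Complex.ofRealCLM.hasDerivAt (x := (0 : ℝ))).const_mul Complex.I
      have := h1.cexp
      simpa using this
    have hs := (hd.tendsto_slope_zero).comp hz'
    -- This is the derivative of `z ↦ e^{iz}` at `0`, multiplied by `u`.
    have hden : Tendsto (fun n => (L n : ℂ) * (Complex.exp (Complex.I * (u / L n : ℝ)) - 1)) atTop
        (𝓝 (u * Complex.I)) := by
      refine (hs.const_mul (u : ℂ)).congr' ?_
      filter_upwards [hL.eventually_gt_atTop 0] with n hn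
      have hn' : (L n : ℂ) ≠ 0 := by exact_mod_cast hn.ne'
      have hu' : (u : ℂ) ≠ 0 := by exact_mod_cast hu
      simp only [Function.comp, zero_add, Complex.real_smul, Complex.ofReal_zero, mul_zero,
        Complex.exp_zero]
      push_cast
      field_simp
    have hden0 : (u : ℂ) * Complex.I ≠ 0 :=
      mul_ne_zero (by exact_mod_cast hu) Complex.I_ne_zero
    have hNz : Tendsto (fun n => (⌊L n * y⌋ : ℝ) * (u / L n)) atTop (𝓝 (y * u)) := by
      refine ((tendsto_floor_mul_div hL y).mul_const u).congr fun n => by ring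
    have hexp : Continuous fun z : ℝ => Complex.exp (Complex.I * z) := by fun_prop
    have hnum : Tendsto (fun n => Complex.exp (Complex.I * (u / L n : ℝ)) *
        (Complex.exp (Complex.I * ((⌊L n * y⌋ : ℝ) * (u / L n) : ℝ)) - 1)) atTop
        (𝓝 (1 * (Complex.exp (Complex.I * (y * u : ℝ)) - 1))) := by
      refine Tendsto.mul ?_ (((hexp.tendsto (y * u)).comp hNz).sub_const 1)
      have := (hexp.tendsto 0).comp hz
      rw [Complex.ofReal_zero, mul_zero, Complex.exp_zero] at this
      exact this
    have hlim := hnum.div hden hden0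
    have hval : 1 * (Complex.exp (Complex.I * (y * u : ℝ)) - 1) / (u * Complex.I) =
        -expKernel y u := by
      rw [expKernel, ← neg_div]
      congr 1
      · push_cast; ring_nf
      · ring
    rw [hval] at hlim
    refine hlim.congr' ?_
    filter_upwards [hL.eventually_gt_atTop 0, hden.eventually_ne hden0] with n hn hne
    have hn' : (L n : ℂ) ≠ 0 := by exact_mod_cast hn.ne'
    have h1 := dirichletSum_mul (N := ⌊L n * y⌋) (Int.floor_nonneg.2 (by positivity)) (u / L n)
    simp only [Pi.div_apply]
    rw [div_eq_div_iff hne hn', ← h1]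
    ring
  bound y hy := by
    refine ⟨y ^ 2 + Real.pi ^ 2, by positivity, ?_⟩
    filter_upwards [hL.eventually_gt_atTop 0] with n hn u hu
    have h1 := norm_dirichletSum_div_le hn hy (u / L n)
    have h2 := norm_dirichletSum_mul_le (N := ⌊L n * y⌋) (Int.floor_nonneg.2 (by positivity)) hu
    have h3 : ‖dirichletSum ⌊L n * y⌋ (u / L n) / L n‖ * |u| ≤ Real.pi := by
      rw [abs_div, abs_of_pos hn] at h2
      rw [norm_div, Complex.norm_real, Real.norm_of_nonneg hn.le]
      refine le_trans (le_of_eq ?_) h2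
      ring
    rw [← div_eq_mul_inv, le_div_iff₀ (by positivity), mul_add, mul_one]
    refine add_le_add (by gcongr) ?_
    rw [← sq_abs u, ← mul_pow]
    gcongr

/-- At frequencies far below `1/L` all terms of the sum are close to `1`. The majorant is only a
constant, so integrability in this variable must come from `h`. -/
lemma dirichletScaling_small {L R : ℕ → ℝ} (hL : Tendsto L atTop atTop)
    (hR : Tendsto R atTop atTop) (hLR : Tendsto (fun n => L n / R n) atTop (𝓝 0)) :
    DirichletScaling L R (fun y _ => y) (fun _ => 1) where
  tendsto_left := hL
  tendsto_right := hR
  lim y hy u _ := by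
    have h1 := tendsto_floor_mul_div hL y
    have h2 : Tendsto (fun n => (⌊L n * y⌋ : ℝ) / L n * ((⌊L n * y⌋ : ℝ) / L n *
        (|u| * |L n / R n|))) atTop (𝓝 (y * (y * (|u| * |0|)))) :=
      h1.mul (h1.mul (hLR.abs.const_mul _))
    rw [abs_zero, mul_zero, mul_zero, mul_zero] at h2
    have h3 : Tendsto (fun n => dirichletSum ⌊L n * y⌋ (u / R n) / L n -
        ((⌊L n * y⌋ : ℝ) / L n : ℝ)) atTop (𝓝 0) := by
      refine squeeze_zero_norm' ?_ h2
      filter_upwards [hL.eventually_gt_atTop 0] with n hn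
      have := norm_dirichletSum_sub_le (N := ⌊L n * y⌋) (Int.floor_nonneg.2 (by positivity))
        (u / R n)
      push_cast
      rw [← sub_div, norm_div, Complex.norm_real, Real.norm_of_nonneg hn.le, div_le_iff₀ hn]
      refine this.trans_eq ?_
      rw [abs_div, abs_div, abs_of_pos hn]
      field_simp
    have h4 : Tendsto (fun n => (((⌊L n * y⌋ : ℝ) / L n : ℝ) : ℂ)) atTop (𝓝 (y : ℂ)) :=
      (Complex.continuous_ofReal.tendsto y).comp h1
    simpa using h3.add h4
  bound y hy := by
    refine ⟨y ^ 2, by positivity, ?_⟩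
    filter_upwards [hL.eventually_gt_atTop 0] with n hn u _
    rw [mul_one]
    gcongr
    exact norm_dirichletSum_div_le hn hy _

end

section

/-! ### Covariances of rectangular sums -/

/-- The character `e^{i(tx + sy)}`. -/
noncomputable def latticeChar (e : ℤ × ℤ) (q : ℝ × ℝ) : ℂ :=
  Complex.exp (Complex.I * (e.1 * q.1)) * Complex.exp (Complex.I * (e.2 * q.2))

@[fun_prop] lemma measurable_latticeChar (e : ℤ × ℤ) : Measurable (latticeChar e) := by
  unfold latticeChar; fun_prop

lemma norm_latticeChar (e : ℤ × ℤ) (q : ℝ × ℝ) : ‖latticeChar e q‖ = 1 := by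
  rw [latticeChar, norm_mul, norm_exp_I_mul_int, norm_exp_I_mul_int, one_mul]

lemma latticeChar_mul_conj (e e' : ℤ × ℤ) (q : ℝ × ℝ) :
    latticeChar e q * (starRingEnd ℂ) (latticeChar e' q) =
      Complex.exp (Complex.I * ((e.1 - e'.1 : ℤ) * q.1 + (e.2 - e'.2 : ℤ) * q.2)) := by
  simp only [latticeChar, ← Complex.exp_conj, ← Complex.exp_add]
  congr 1
  simp only [map_add, map_mul, Complex.conj_I, Complex.conj_ofReal, map_intCast]
  push_cast
  ring

lemma sum_latticeChar (N M : ℤ) (q : ℝ × ℝ) :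
    ∑ e ∈ Finset.Icc 1 N ×ˢ Finset.Icc 1 M, latticeChar e q =
      dirichletSum N q.1 * dirichletSum M q.2 := by
  rw [dirichletSum, dirichletSum, Finset.sum_mul_sum, Finset.sum_product]
  rfl

section Covariance

variable {Ω : Type*} [MeasurableSpace Ω] {P : Measure Ω} {Y : ℤ × ℤ → Ω → ℝ} {f : ℝ × ℝ → ℝ}

lemma IsStationaryField.integral_mul (hY : IsStationaryField P Y) (e e' : ℤ × ℤ) :
    ∫ ω, Y e ω * Y e' ω ∂P = ∫ ω, Y (e - e') ω * Y (0, 0) ω ∂P := by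
  have h := (hY e').comp (u := fun F : ℤ × ℤ → ℝ => F (e - e') * F (0, 0)) (by fun_prop)
  have := h.integral_eq
  simpa [Function.comp_def, ← Prod.zero_eq_mk] using this

lemma IsSpectralDensity.integral_mul (hf : IsSpectralDensity P Y f) (hY : IsStationaryField P Y)
    (e e' : ℤ × ℤ) : ((∫ ω, Y e ω * Y e' ω ∂P : ℝ) : ℂ) =
      ∫ q in piSquare, latticeChar e q * (starRingEnd ℂ) (latticeChar e' q) * (f q : ℂ) := by
  rw [hY.integral_mul, show e - e' = (e.1 - e'.1, e.2 - e'.2) from rfl, hf.covariance]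
  simp_rw [latticeChar_mul_conj]

lemma IsSpectralDensity.integrable_mul (hf : IsSpectralDensity P Y f) (e e' : ℤ × ℤ) :
    IntegrableOn (fun q => latticeChar e q * (starRingEnd ℂ) (latticeChar e' q) * (f q : ℂ))
      piSquare := by
  refine Integrable.bdd_mul (c := 1) hf.integrable.ofReal ?_ (Eventually.of_forall fun q => ?_)
  · exact ((measurable_latticeChar e).mul (Complex.continuous_conj.measurable.comp
      (measurable_latticeChar e'))).aestronglyMeasurable
  · rw [norm_mul, RCLike.norm_conj, norm_latticeChar, norm_latticeChar, one_mul]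

lemma IsSpectralDensity.integral_sum_mul_sum (hf : IsSpectralDensity P Y f)
    (hY : IsStationaryField P Y) (hY2 : ∀ e, MemLp (Y e) 2 P) (A B : Finset (ℤ × ℤ)) :
    ((∫ ω, (∑ e ∈ A, Y e ω) * ∑ e ∈ B, Y e ω ∂P : ℝ) : ℂ) =
      ∫ q in piSquare, (∑ e ∈ A, latticeChar e q) *
        (starRingEnd ℂ) (∑ e ∈ B, latticeChar e q) * (f q : ℂ) := by
  simp_rw [map_sum, Finset.sum_mul_sum, Finset.sum_mul]
  have hi : ∀ e e', Integrable (fun ω => Y e ω * Y e' ω) P := fun e e' =>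
    (hY2 e).integrable_mul (hY2 e')
  rw [integral_finsetSum _ fun e _ => integrable_finsetSum _ fun e' _ => hi e e',
    integral_finsetSum _ fun e _ => integrable_finsetSum _ fun e' _ => hf.integrable_mul e e',
    Complex.ofReal_sum]
  refine Finset.sum_congr rfl fun e _ => ?_
  rw [integral_finsetSum _ fun e' _ => hi e e',
    integral_finsetSum _ fun e' _ => hf.integrable_mul e e', Complex.ofReal_sum]
  exact Finset.sum_congr rfl fun e' _ => hf.integral_mul hY e e'

/-- The covariance of two normalized sums in terms of Dirichlet sums. -/
lemma IsSpectralDensity.integral_normalizedSum_mul (hf : IsSpectralDensity P Y f)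
    (hY : IsStationaryField P Y) (hY2 : ∀ e, MemLp (Y e) 2 P) (γ H : ℝ) (n : ℕ) (p q : ℝ × ℝ) :
    ((∫ ω, normalizedSum Y γ H n p ω * normalizedSum Y γ H n q ω ∂P : ℝ) : ℂ) =
      ((((n : ℝ) ^ (-H)) ^ 2 : ℝ) : ℂ) * ∫ e in piSquare,
        dirichletSum ⌊(n : ℝ) * p.1⌋ e.1 * dirichletSum ⌊(n : ℝ) ^ γ * p.2⌋ e.2 *
        (starRingEnd ℂ) (dirichletSum ⌊(n : ℝ) * q.1⌋ e.1 *
          dirichletSum ⌊(n : ℝ) ^ γ * q.2⌋ e.2) * (f e : ℂ) := by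
  simp_rw [← sum_latticeChar]
  rw [← hf.integral_sum_mul_sum hY hY2, ← Complex.ofReal_mul, ← integral_const_mul]
  simp_rw [normalizedSum, ← Finset.sum_product']
  congr 2 with ω
  ring

end Covariance

/-! ### Dominated convergence in the rescaled spectral integral -/

section Limit

variable {L₁ L₂ R₁ R₂ r : ℕ → ℝ} {δ₁ δ₂ : ℝ → ℝ → ℂ} {m₁ m₂ : ℝ → ℝ} {g h w K : ℝ × ℝ → ℝ}

lemma norm_mul_le_of_sq_le {a b : ℂ} {x y : ℝ} (ha : ‖a‖ ^ 2 ≤ x) (hb : ‖b‖ ^ 2 ≤ y) :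
    ‖a‖ * ‖b‖ ≤ x + y := by nlinarith [sq_nonneg (‖a‖ - ‖b‖), sq_nonneg ‖a‖, sq_nonneg ‖b‖]

/-- After substituting `(u/R₁, v/R₂)` and dividing each Dirichlet sum by its length, the remaining
factor is the Jacobian times `r² (L₁ L₂)² h`, with limit `w` and majorant `K`. The values of `g`
tend to `g(0,0)` because `R₁` and `R₂` tend to infinity. -/
theorem tendsto_integral_dirichletSum (h₁ : DirichletScaling L₁ R₁ δ₁ m₁)
    (h₂ : DirichletScaling L₂ R₂ δ₂ m₂) (hg : ∃ C : ℝ, ∀ p ∈ piSquare, |g p| ≤ C)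
    (hg0 : ContinuousAt g (0, 0)) (hh : ∀ q, 0 ≤ h q)
    (hf : IntegrableOn (fun q => g q * h q) piSquare)
    (hm₁ : ∀ u, 0 ≤ m₁ u) (hm₂ : ∀ u, 0 ≤ m₂ u)
    (hw : ∀ᵐ e : ℝ × ℝ, Tendsto (fun n => r n ^ 2 * (L₁ n * L₂ n) ^ 2 * (R₁ n * R₂ n)⁻¹ *
      h (e.1 / R₁ n, e.2 / R₂ n)) atTop (𝓝 (w e)))
    (hK : ∀ᶠ n in atTop, ∀ᵐ e : ℝ × ℝ, r n ^ 2 * (L₁ n * L₂ n) ^ 2 * (R₁ n * R₂ n)⁻¹ *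
      h (e.1 / R₁ n, e.2 / R₂ n) ≤ K e)
    (hKi : Integrable (fun e : ℝ × ℝ => m₁ e.1 * m₂ e.2 * K e)) {p q : ℝ × ℝ}
    (hp : p ∈ closedQuadrant) (hq : q ∈ closedQuadrant) :
    Tendsto (fun n => ((r n ^ 2 : ℝ) : ℂ) * ∫ e in piSquare,
        dirichletSum ⌊L₁ n * p.1⌋ e.1 * dirichletSum ⌊L₂ n * p.2⌋ e.2 *
        (starRingEnd ℂ) (dirichletSum ⌊L₁ n * q.1⌋ e.1 * dirichletSum ⌊L₂ n * q.2⌋ e.2) *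
        ((g e * h e : ℝ) : ℂ)) atTop
      (𝓝 (g (0, 0) * ∫ e : ℝ × ℝ, δ₁ p.1 e.1 * δ₂ p.2 e.2 *
        (starRingEnd ℂ) (δ₁ q.1 e.1 * δ₂ q.2 e.2) * (w e : ℂ))) := by
  obtain ⟨Cg, hCg⟩ := hg
  obtain ⟨C1p, hC1p0, hC1p⟩ := h₁.bound p.1 hp.1
  obtain ⟨C1q, hC1q0, hC1q⟩ := h₁.bound q.1 hq.1
  obtain ⟨C2p, hC2p0, hC2p⟩ := h₂.bound p.2 hp.2
  obtain ⟨C2q, hC2q0, hC2q⟩ := h₂.bound q.2 hq.2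
  set D : ℝ × ℝ → ℕ → ℝ × ℝ → ℂ := fun p n e =>
    dirichletSum ⌊L₁ n * p.1⌋ e.1 * dirichletSum ⌊L₂ n * p.2⌋ e.2 with hD
  set d : ℝ × ℝ → ℕ → ℝ × ℝ → ℂ := fun p n e =>
    (dirichletSum ⌊L₁ n * p.1⌋ (e.1 / R₁ n) / L₁ n) *
      (dirichletSum ⌊L₂ n * p.2⌋ (e.2 / R₂ n) / L₂ n) with hd
  set k : ℕ → ℝ × ℝ → ℝ := fun n e => r n ^ 2 * (L₁ n * L₂ n) ^ 2 * (R₁ n * R₂ n)⁻¹ *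
      h (e.1 / R₁ n, e.2 / R₂ n) with hk
  -- Extending by zero lets the substitution run over the whole plane while the domain grows with
  -- `n`.
  set G : ℕ → ℝ × ℝ → ℂ := fun n => piSquare.indicator fun e =>
    D p n e * (starRingEnd ℂ) (D q n e) * ((g e * h e : ℝ) : ℂ) with hG
  set F : ℕ → ℝ × ℝ → ℂ := fun n e =>
    ((r n ^ 2 * (R₁ n * R₂ n)⁻¹ : ℝ) : ℂ) * G n (e.1 / R₁ n, e.2 / R₂ n) with hF
  have hpiM : MeasurableSet piSquare := measurableSet_Icc.prod measurableSet_Icc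
  have hDm : ∀ p n, Measurable (D p n) := fun p n => by simp only [hD]; fun_prop
  have hGm : ∀ n, AEStronglyMeasurable (G n) := fun n => by
    have : AEStronglyMeasurable (fun e => D p n e * (starRingEnd ℂ) (D q n e) *
        ((g e * h e : ℝ) : ℂ)) (volume.restrict piSquare) :=
      (((hDm p n).mul (Complex.continuous_conj.measurable.comp
        (hDm q n))).aestronglyMeasurable).mul hf.ofReal.1
    exact (aestronglyMeasurable_indicator_iff hpiM).2 this
  have hpos : ∀ᶠ n in atTop, 0 < L₁ n ∧ 0 < L₂ n ∧ 0 < R₁ n ∧ 0 < R₂ n :=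
    (h₁.tendsto_left.eventually_gt_atTop 0).and ((h₂.tendsto_left.eventually_gt_atTop 0).and
      ((h₁.tendsto_right.eventually_gt_atTop 0).and (h₂.tendsto_right.eventually_gt_atTop 0)))
  have hFd : ∀ᶠ n in atTop, ∀ e : ℝ × ℝ, (e.1 / R₁ n, e.2 / R₂ n) ∈ piSquare →
      F n e = d p n e * (starRingEnd ℂ) (d q n e) *
        ((g (e.1 / R₁ n, e.2 / R₂ n) * k n e : ℝ) : ℂ) := by
    filter_upwards [hpos] with n hn e he
    have hL1 : (L₁ n : ℂ) ≠ 0 := by exact_mod_cast hn.1.ne'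
    have hL2 : (L₂ n : ℂ) ≠ 0 := by exact_mod_cast hn.2.1.ne'
    simp only [hF, hG, Set.indicator_of_mem he, hD, hd, hk, map_mul, map_div₀, Complex.conj_ofReal]
    push_cast
    field_simp
  have hkey : Tendsto (fun n => ∫ e, F n e) atTop (𝓝 (∫ e : ℝ × ℝ, g (0, 0) *
      (δ₁ p.1 e.1 * δ₂ p.2 e.2 * (starRingEnd ℂ) (δ₁ q.1 e.1 * δ₂ q.2 e.2) * (w e : ℂ)))) := by
    refine tendsto_integral_filter_of_dominated_convergence
      (fun e => (C1p + C1q) * (C2p + C2q) * Cg * (m₁ e.1 * m₂ e.2 * K e)) ?_ ?_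
      (hKi.const_mul _) ?_
    · filter_upwards [hpos] with n hn
      refine AEStronglyMeasurable.const_mul ?_ _
      have hmap := map_mul_prod (inv_pos.2 hn.2.2.1) (inv_pos.2 hn.2.2.2)
      have := AEStronglyMeasurable.comp_measurable (μ := volume)
        (f := fun e : ℝ × ℝ => ((R₁ n)⁻¹ * e.1, (R₂ n)⁻¹ * e.2)) (g := G n)
        (by rw [hmap]; exact (hGm n).smul_measure _) (by fun_prop)
      refine this.congr (Eventually.of_forall fun e => ?_)
      simp only [Function.comp, div_eq_inv_mul]
    · filter_upwards [hpos, hFd, hK, hC1p, hC1q, hC2p, hC2q] with n hn hFn hKn b1 b2 b3 b4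
      filter_upwards [hKn] with e hKe
      have hk0 : 0 ≤ k n e := mul_nonneg (mul_nonneg (by positivity)
        (inv_nonneg.2 (mul_pos hn.2.2.1 hn.2.2.2).le)) (hh _)
      have hKe0 : 0 ≤ K e := hk0.trans hKe
      have hm1 := hm₁ e.1
      have hm2 := hm₂ e.2
      by_cases he : (e.1 / R₁ n, e.2 / R₂ n) ∈ piSquare
      · have hC0 : 0 ≤ Cg := (abs_nonneg _).trans (hCg _ he)
        have he1 : |e.1 / R₁ n| ≤ Real.pi := abs_le.2 he.1
        have he2 : |e.2 / R₂ n| ≤ Real.pi := abs_le.2 he.2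
        rw [hFn e he, norm_mul, norm_mul, RCLike.norm_conj, Complex.norm_real, Real.norm_eq_abs,
          abs_mul, abs_of_nonneg hk0]
        simp only [hd, norm_mul]
        have t1 := norm_mul_le_of_sq_le (b1 _ he1) (b2 _ he1)
        have t2 := norm_mul_le_of_sq_le (b3 _ he2) (b4 _ he2)
        calc _ = (‖dirichletSum ⌊L₁ n * p.1⌋ (e.1 / R₁ n) / L₁ n‖ *
                ‖dirichletSum ⌊L₁ n * q.1⌋ (e.1 / R₁ n) / L₁ n‖) *
              (‖dirichletSum ⌊L₂ n * p.2⌋ (e.2 / R₂ n) / L₂ n‖ *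
                ‖dirichletSum ⌊L₂ n * q.2⌋ (e.2 / R₂ n) / L₂ n‖) *
              (|g (e.1 / R₁ n, e.2 / R₂ n)| * k n e) := by ring
          _ ≤ (C1p * m₁ e.1 + C1q * m₁ e.1) * (C2p * m₂ e.2 + C2q * m₂ e.2) * (Cg * K e) := by
            gcongr
            exact hCg _ he
          _ = _ := by ring
      · have hCg0 : 0 ≤ Cg := (abs_nonneg _).trans (hCg (0, 0)
          ⟨⟨by simp [Real.pi_pos.le], Real.pi_pos.le⟩, ⟨by simp [Real.pi_pos.le], Real.pi_pos.le⟩⟩)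
        simp only [hF, hG, Set.indicator_of_notMem he, mul_zero, norm_zero]
        positivity
    · filter_upwards [hw, ae_ne_zero_prod] with e hwe he0
      have z1 : Tendsto (fun n => e.1 / R₁ n) atTop (𝓝 0) := h₁.tendsto_right.const_div_atTop _
      have z2 : Tendsto (fun n => e.2 / R₂ n) atTop (𝓝 0) := h₂.tendsto_right.const_div_atTop _
      have z := z1.prodMk_nhds z2
      have hmem : ∀ᶠ n in atTop, (e.1 / R₁ n, e.2 / R₂ n) ∈ piSquare := by
        refine z.eventually (prod_mem_nhds (Icc_mem_nhds ?_ ?_) (Icc_mem_nhds ?_ ?_)) <;>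
          simp [Real.pi_pos]
      have hdl : ∀ p ∈ closedQuadrant, Tendsto (fun n => d p n e) atTop
          (𝓝 (δ₁ p.1 e.1 * δ₂ p.2 e.2)) := fun p hp =>
        (h₁.lim p.1 hp.1 e.1 he0.1).mul (h₂.lim p.2 hp.2 e.2 he0.2)
      have hgk : Tendsto (fun n => ((g (e.1 / R₁ n, e.2 / R₂ n) * k n e : ℝ) : ℂ)) atTop
          (𝓝 ((g (0, 0) * w e : ℝ) : ℂ)) :=
        (Complex.continuous_ofReal.tendsto _).comp ((hg0.tendsto.comp z).mul hwe)
      have hall := ((hdl p hp).mul ((Complex.continuous_conj.tendsto _).comp (hdl q hq))).mul hgk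
      have e1 : δ₁ p.1 e.1 * δ₂ p.2 e.2 * (starRingEnd ℂ) (δ₁ q.1 e.1 * δ₂ q.2 e.2) *
          ((g (0, 0) * w e : ℝ) : ℂ) = g (0, 0) * (δ₁ p.1 e.1 * δ₂ p.2 e.2 *
            (starRingEnd ℂ) (δ₁ q.1 e.1 * δ₂ q.2 e.2) * (w e : ℂ)) := by push_cast; ring
      rw [e1] at hall
      refine hall.congr' ?_
      filter_upwards [hFd, hmem] with n hn hme
      exact (hn e hme).symm
  rw [integral_const_mul] at hkey
  refine hkey.congr' ?_
  filter_upwards [hpos] with n hn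
  have hs := integral_comp_mul_prod (inv_pos.2 hn.2.2.1) (inv_pos.2 hn.2.2.2) (G n)
  simp only [hF]
  rw [integral_const_mul]
  simp_rw [div_eq_inv_mul]
  rw [hs, Complex.real_smul, ← mul_assoc, ← Complex.ofReal_mul, ← mul_inv, inv_inv, mul_assoc,
    inv_mul_cancel₀ (mul_pos hn.2.2.1 hn.2.2.2).ne', mul_one]
  simp only [hG]
  rw [integral_indicator hpiM]

end Limit

end

section

variable {H₁ H₂ c γ : ℝ}

/-! ### Scaling limits of the spectral density -/

lemma continuousAt_hFun (hH₁ : 0 < H₁) (hH₂ : 0 < H₂) (hc : 0 < c) {q : ℝ × ℝ} (hq : q ≠ 0) :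
    ContinuousAt (hFun H₁ H₂ c) q := by
  have hb : 0 < |q.1| ^ 2 + c * |q.2| ^ (2 * H₂ / H₁) := by
    by_cases h1 : q.1 = 0
    · have h2 : q.2 ≠ 0 := fun h2 => hq (Prod.ext h1 h2)
      positivity
    · positivity
  have h1 : ContinuousAt (fun q : ℝ × ℝ => |q.2| ^ (2 * H₂ / H₁)) q :=
    ContinuousAt.rpow_const (by fun_prop) (Or.inr (by positivity))
  have h2 : ContinuousAt (fun q : ℝ × ℝ => |q.1| ^ 2 + c * |q.2| ^ (2 * H₂ / H₁)) q := by fun_prop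
  exact continuousAt_const.div (h2.rpow_const (Or.inl hb.ne')) (Real.rpow_pos_of_pos hb _).ne'

lemma hFun_left_zero (hH₁ : 0 < H₁) (hH₂ : 0 < H₂) (u : ℝ) :
    hFun H₁ H₂ c (u, 0) = |u| ^ (-H₁) := by
  have : 2 * H₂ / H₁ ≠ 0 := by positivity
  simp only [hFun, abs_zero, Real.zero_rpow this, mul_zero, add_zero]
  rw [← Real.rpow_natCast, ← Real.rpow_mul (abs_nonneg u), Real.rpow_neg (abs_nonneg u), one_div]
  congr 2; push_cast; ring

lemma hFun_right_zero (hH₁ : 0 < H₁) (hc : 0 < c) (v : ℝ) :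
    hFun H₁ H₂ c (0, v) = c ^ (-H₁ / 2) * |v| ^ (-H₂) := by
  simp only [hFun, abs_zero, ne_eq, OfNat.ofNat_ne_zero, not_false_eq_true, zero_pow, zero_add]
  rw [rpow_base_right hH₁ hc, one_div, mul_inv, neg_div, Real.rpow_neg hc.le,
    Real.rpow_neg (abs_nonneg v)]

/-- The scaling of `h` along the sequences `n^a`, `n^b`, for a free exponent `t`. -/
lemma normalized_hFun (hH₁ : 0 < H₁) (hH₂ : 0 < H₂) (hc : 0 < c) {N H a b t : ℝ} (hN : 0 < N)
    (ht : 2 + 2 * γ - 2 * H - a - b + t * H₁ = 0) (u v : ℝ) :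
    (N ^ (-H)) ^ 2 * (N * N ^ γ) ^ 2 * (N ^ a * N ^ b)⁻¹ * hFun H₁ H₂ c (u / N ^ a, v / N ^ b) =
      hFun H₁ H₂ c (u * N ^ (t - a), v * N ^ (t * (H₁ / H₂) - b)) := by
  have hs := hFun_scale hH₁ hH₂ hc (Real.rpow_pos_of_pos hN (-t)) (u * N ^ (t - a))
    (v * N ^ (t * (H₁ / H₂) - b))
  rw [← Real.rpow_mul hN.le, ← Real.rpow_mul hN.le,
    show N ^ (-t) * (u * N ^ (t - a)) = u / N ^ a by
      rw [mul_left_comm, ← Real.rpow_add hN, show -t + (t - a) = -a by ring, Real.rpow_neg hN.le,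
        div_eq_mul_inv],
    show N ^ (-t * (H₁ / H₂)) * (v * N ^ (t * (H₁ / H₂) - b)) = v / N ^ b by
      rw [mul_left_comm, ← Real.rpow_add hN, show -t * (H₁ / H₂) + (t * (H₁ / H₂) - b) = -b by ring,
        Real.rpow_neg hN.le, div_eq_mul_inv]] at hs
  -- The condition `ht` says exactly that the total power of `N` is zero.
  have hpre : (N ^ (-H)) ^ 2 * (N * N ^ γ) ^ 2 * (N ^ a * N ^ b)⁻¹ * N ^ (-t * -H₁) = 1 := by
    have e1 : (N ^ (-H)) ^ 2 = N ^ (-H * 2) := by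
      rw [Real.rpow_mul hN.le, Real.rpow_two]
    have e2 : (N * N ^ γ) ^ 2 = N ^ ((1 + γ) * 2) := by
      rw [Real.rpow_mul hN.le, Real.rpow_two, Real.rpow_add hN, Real.rpow_one]
    rw [e1, e2, ← Real.rpow_add hN a b, ← Real.rpow_neg hN.le, ← Real.rpow_add hN,
      ← Real.rpow_add hN, ← Real.rpow_add hN, show -H * 2 + (1 + γ) * 2 + -(a + b) + -t * -H₁ =
        2 + 2 * γ - 2 * H - a - b + t * H₁ by ring, ht, Real.rpow_zero]
  rw [hs, ← mul_assoc, hpre, one_mul]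

lemma tendsto_natCast_rpow {a : ℝ} (ha : 0 < a) :
    Tendsto (fun n : ℕ => (n : ℝ) ^ a) atTop atTop :=
  (tendsto_rpow_atTop ha).comp tendsto_natCast_atTop_atTop

lemma tendsto_natCast_rpow_neg {a : ℝ} (ha : a < 0) :
    Tendsto (fun n : ℕ => (n : ℝ) ^ a) atTop (𝓝 0) := by
  have := (tendsto_rpow_neg_atTop (neg_pos.2 ha)).comp (tendsto_natCast_atTop_atTop (R := ℝ))
  simpa [Function.comp_def] using this

lemma covOf_swap (Φ : ℝ → ℝ → ℝ) (p q : ℝ × ℝ) :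
    covOf (fun x y => Φ y x) p q = covOf Φ p.swap q.swap := by
  simp only [covOf, polar, Prod.fst_swap, Prod.snd_swap]
  ring

lemma norm_expKernel_mul_le (x y u : ℝ) :
    ‖expKernel x u‖ * ‖expKernel y u‖ ≤ (x ^ 2 + 4 + (y ^ 2 + 4)) * (1 + u ^ 2)⁻¹ := by
  have h1 := sqKernel_le x u
  have h2 := sqKernel_le y u
  rw [← expKernel_norm_sq] at h1 h2
  rw [add_mul]
  exact norm_mul_le_of_sq_le h1 h2

section Covariance

variable {Ω : Type*} [MeasurableSpace Ω] {P : Measure Ω} {Y : ℤ × ℤ → Ω → ℝ} {g : ℝ × ℝ → ℝ}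

/-- The hypotheses on the field `Y`. -/
structure IsTypeIField (P : Measure Ω) (Y : ℤ × ℤ → Ω → ℝ) (g : ℝ × ℝ → ℝ) (H₁ H₂ c : ℝ) :
    Prop where
  parameters : Parameters H₁ H₂ c
  bdd : ∃ C : ℝ, ∀ p ∈ piSquare, |g p| ≤ C
  cont : ContinuousAt g (0, 0)
  pos : 0 < g (0, 0)
  gaussian : IsGaussianProcess Y P
  mean : ∀ p, ∫ ω, Y p ω ∂P = 0
  stat : IsStationaryField P Y
  spec : IsSpectralDensity P Y (typeIDensity g H₁ H₂ c)

lemma typeIDensity_eq (q : ℝ × ℝ) : typeIDensity g H₁ H₂ c q = g q * hFun H₁ H₂ c q := by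
  rw [typeIDensity, hFun, mul_one_div]

namespace IsTypeIField

variable (hY : IsTypeIField P Y g H₁ H₂ c)
include hY

lemma memLp (e : ℤ × ℤ) : MemLp (Y e) 2 P := by
  have := hY.gaussian.hasGaussianLaw_eval e
  exact this.memLp_two

/-- The common form of all regimes, with `R₁ = n^a` and `R₂ = n^b`. The limit `w` of the rescaled
`h` is at the same time its majorant. -/
lemma tendsto_cov_of_scaling {H a b t : ℝ} {δ₁ δ₂ : ℝ → ℝ → ℂ} {m₁ m₂ : ℝ → ℝ} {w : ℝ × ℝ → ℝ}
    (h₁ : DirichletScaling (fun n : ℕ => (n : ℝ)) (fun n => (n : ℝ) ^ a) δ₁ m₁)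
    (h₂ : DirichletScaling (fun n : ℕ => (n : ℝ) ^ γ) (fun n => (n : ℝ) ^ b) δ₂ m₂)
    (hm₁ : ∀ u, 0 ≤ m₁ u) (hm₂ : ∀ u, 0 ≤ m₂ u)
    (ht : 2 + 2 * γ - 2 * H - a - b + t * H₁ = 0)
    (hw : ∀ u v : ℝ, u ≠ 0 → v ≠ 0 → Tendsto (fun n : ℕ =>
      hFun H₁ H₂ c (u * (n : ℝ) ^ (t - a), v * (n : ℝ) ^ (t * (H₁ / H₂) - b))) atTop (𝓝 (w (u, v))))
    (hK : ∀ n : ℕ, 0 < n → ∀ u v : ℝ, u ≠ 0 → v ≠ 0 →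
      hFun H₁ H₂ c (u * (n : ℝ) ^ (t - a), v * (n : ℝ) ^ (t * (H₁ / H₂) - b)) ≤ w (u, v))
    (hKi : Integrable (fun e : ℝ × ℝ => m₁ e.1 * m₂ e.2 * w e)) {p q : ℝ × ℝ}
    (hp : p ∈ closedQuadrant) (hq : q ∈ closedQuadrant) {κ : ℝ}
    (hκ : (∫ e : ℝ × ℝ, δ₁ p.1 e.1 * δ₂ p.2 e.2 *
        (starRingEnd ℂ) (δ₁ q.1 e.1 * δ₂ q.2 e.2) * (w e : ℂ)).re = κ) :
    Tendsto (fun n => ∫ ω, normalizedSum Y γ H n p ω * normalizedSum Y γ H n q ω ∂P) atTop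
      (𝓝 (g (0, 0) * κ)) := by
  have hpar := hY.parameters
  have hnf : ∀ n : ℕ, 0 < n → ∀ e : ℝ × ℝ,
      ((n : ℝ) ^ (-H)) ^ 2 * ((n : ℝ) * (n : ℝ) ^ γ) ^ 2 * ((n : ℝ) ^ a * (n : ℝ) ^ b)⁻¹ *
        hFun H₁ H₂ c (e.1 / (n : ℝ) ^ a, e.2 / (n : ℝ) ^ b) =
      hFun H₁ H₂ c (e.1 * (n : ℝ) ^ (t - a), e.2 * (n : ℝ) ^ (t * (H₁ / H₂) - b)) := fun n hn e =>
    normalized_hFun hpar.pos hpar.pos₂ hpar.c_pos (Nat.cast_pos.2 hn) ht e.1 e.2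
  have hfi : IntegrableOn (fun q => g q * hFun H₁ H₂ c q) piSquare := by
    have := hY.spec.integrable
    simpa only [typeIDensity_eq, funext typeIDensity_eq] using this
  have hlim := tendsto_integral_dirichletSum (r := fun n => (n : ℝ) ^ (-H)) h₁ h₂ hY.bdd hY.cont
    (hFun_nonneg hpar.c_pos) hfi hm₁ hm₂ (w := w) (K := w) (by
      filter_upwards [ae_ne_zero_prod] with e he
      refine (hw e.1 e.2 he.1 he.2).congr' ?_
      filter_upwards [eventually_gt_atTop 0] with n hn
      exact (hnf n hn e).symm) (by
      filter_upwards [eventually_gt_atTop 0] with n hn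
      filter_upwards [ae_ne_zero_prod] with e he
      rw [hnf n hn e]
      exact hK n hn e.1 e.2 he.1 he.2) hKi hp hq
  have hre := (Complex.continuous_re.tendsto _).comp hlim
  rw [Complex.re_ofReal_mul, hκ] at hre
  refine hre.congr fun n => ?_
  have := hY.spec.integral_normalizedSum_mul hY.stat hY.memLp γ H n p q
  simp only [typeIDensity_eq] at this
  simp only [Function.comp]
  rw [← this, Complex.ofReal_re]

end IsTypeIField

end Covariance

end

section

variable {H₁ H₂ c γ : ℝ} {Ω : Type*} [MeasurableSpace Ω] {P : Measure Ω} {Y : ℤ × ℤ → Ω → ℝ}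
  {g : ℝ × ℝ → ℝ}

/-! ### Convergence of the covariances -/

lemma two_mul_scalingExponent_of_plane (hH₁ : 0 < H₁) (hH₂ : 0 < H₂) (hγ : PlaneCase H₁ H₂ γ) :
    2 * scalingExponent H₁ H₂ γ = 1 + γ + if H₁ / H₂ ≤ γ then H₁ else γ * H₂ := by
  rw [scalingExponent]
  rcases hγ with hγ | ⟨hγ, h1⟩ | ⟨hγ, h1⟩
  · rw [if_pos hγ.ge, if_pos hγ.ge, hγ]
    split_ifs
    · ring
    · field_simp; ring
  · rw [if_pos hγ.le, if_pos hγ.le, if_pos h1]; ring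
  · rw [if_neg hγ.not_ge, if_neg hγ.not_ge, if_pos h1]; ring

lemma Parameters.integrable_inv_mul_planeWeight (h : Parameters H₁ H₂ c)
    (hγ : PlaneCase H₁ H₂ γ) : Integrable (fun e : ℝ × ℝ =>
      (1 + e.1 ^ 2)⁻¹ * (1 + e.2 ^ 2)⁻¹ * planeWeight H₁ H₂ c γ e) := by
  rcases hγ with hγ | ⟨hγ, h1⟩ | ⟨hγ, h1⟩
  · simp only [planeWeight, if_pos hγ]
    exact integrable_inv_mul_hFun h.pos h.lt_two₁ h.pos₂ h.lt_two h.c_pos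
  · simp only [planeWeight, if_neg hγ.ne', if_pos hγ]
    refine (integrable_inv_mul_rpow_prod h.pos.le h1 le_rfl one_pos).congr
      (Eventually.of_forall fun e => ?_)
    simp only [neg_zero, Real.rpow_zero]
    ring
  · simp only [planeWeight, if_neg hγ.ne, if_neg hγ.not_gt]
    refine ((integrable_inv_mul_rpow_prod le_rfl one_pos h.pos₂.le h1).const_mul
      (c ^ (-H₁ / 2))).congr (Eventually.of_forall fun e => ?_)
    simp only [neg_zero, Real.rpow_zero]
    ring

/-- The exponent `t` in `normalized_hFun` that is adapted to the limit. -/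
noncomputable def planeExponent (H₁ H₂ γ : ℝ) : ℝ := if H₁ / H₂ ≤ γ then 1 else γ / (H₁ / H₂)

/-- The exponent `t` is chosen so that the coordinate that survives in the weight is left unscaled;
discarding the other term in the denominator of `h` can only increase it. -/
lemma Parameters.hFun_le_planeWeight (h : Parameters H₁ H₂ c) (N : ℝ)
    {u v : ℝ} (hu : u ≠ 0) (hv : v ≠ 0) :
    hFun H₁ H₂ c (u * N ^ (planeExponent H₁ H₂ γ - 1),
      v * N ^ (planeExponent H₁ H₂ γ * (H₁ / H₂) - γ)) ≤ planeWeight H₁ H₂ c γ (u, v) := by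
  have hr := h.ratio_pos
  rcases lt_trichotomy γ (H₁ / H₂) with hlt | heq | hlt
  · rw [planeExponent, if_neg hlt.not_ge, div_mul_cancel₀ _ hr.ne', sub_self, Real.rpow_zero,
      mul_one, planeWeight, if_neg hlt.ne, if_neg hlt.not_gt]
    exact hFun_le_right h.pos h.c_pos hv _
  · rw [planeExponent, if_pos heq.ge, heq, one_mul, sub_self, sub_self, Real.rpow_zero, mul_one,
      mul_one, planeWeight, if_pos rfl]
  · rw [planeExponent, if_pos hlt.le, sub_self, Real.rpow_zero,
      mul_one, planeWeight, if_neg hlt.ne', if_pos hlt]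
    exact hFun_le_left h.pos h.c_pos hu _

/-- Off criticality the other coordinate carries a negative power of `n`, and `h` is continuous away
from the origin, so the limit is the trace of `h` on an axis. -/
lemma Parameters.tendsto_hFun_planeWeight (h : Parameters H₁ H₂ c)
    {u v : ℝ} (hu : u ≠ 0) (hv : v ≠ 0) :
    Tendsto (fun n : ℕ => hFun H₁ H₂ c (u * (n : ℝ) ^ (planeExponent H₁ H₂ γ - 1),
      v * (n : ℝ) ^ (planeExponent H₁ H₂ γ * (H₁ / H₂) - γ))) atTop
      (𝓝 (planeWeight H₁ H₂ c γ (u, v))) := by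
  have hr := h.ratio_pos
  rcases lt_trichotomy γ (H₁ / H₂) with hlt | heq | hlt
  · simp only [planeExponent, if_neg hlt.not_ge, div_mul_cancel₀ _ hr.ne', sub_self, Real.rpow_zero,
      mul_one, planeWeight, if_neg hlt.ne, if_neg hlt.not_gt]
    rw [← hFun_right_zero h.pos h.c_pos]
    have h1 : γ / (H₁ / H₂) - 1 < 0 := by rw [sub_neg, div_lt_one hr]; exact hlt
    have h2 := ((tendsto_natCast_rpow_neg h1).const_mul u).prodMk_nhds (tendsto_const_nhds (x := v))
    rw [mul_zero] at h2
    exact (continuousAt_hFun h.pos h.pos₂ h.c_pos (by simp [hv])).tendsto.comp h2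
  · subst heq
    simp only [planeExponent, le_refl, if_true, one_mul, sub_self, Real.rpow_zero, mul_one,
      planeWeight]
    exact tendsto_const_nhds
  · simp only [planeExponent, if_pos hlt.le, sub_self, Real.rpow_zero, one_mul,
      mul_one, planeWeight, if_neg hlt.ne', if_pos hlt]
    rw [← hFun_left_zero (c := c) h.pos h.pos₂]
    have h2 := (tendsto_const_nhds (x := u)).prodMk_nhds
      ((tendsto_natCast_rpow_neg (sub_neg.2 hlt)).const_mul v)
    rw [mul_zero] at h2
    exact (continuousAt_hFun h.pos h.pos₂ h.c_pos (by simp [hu])).tendsto.comp h2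

lemma dirichletScaling_rpow {a : ℝ} (ha : 0 < a) :
    DirichletScaling (fun n : ℕ => (n : ℝ) ^ a) (fun n => (n : ℝ) ^ a)
      (fun y u => -expKernel y u) (fun u => (1 + u ^ 2)⁻¹) :=
  dirichletScaling_eq (tendsto_natCast_rpow ha)

lemma dirichletScaling_natCast :
    DirichletScaling (fun n : ℕ => (n : ℝ)) (fun n => (n : ℝ) ^ (1 : ℝ))
      (fun y u => -expKernel y u) (fun u => (1 + u ^ 2)⁻¹) := by
  simpa using dirichletScaling_rpow one_pos

lemma dirichletScaling_rpow_lt {a b : ℝ} (ha : 0 < a) (hab : a < b) :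
    DirichletScaling (fun n : ℕ => (n : ℝ) ^ a) (fun n => (n : ℝ) ^ b)
      (fun y _ => y) (fun _ => 1) := by
  refine dirichletScaling_small (tendsto_natCast_rpow ha) (tendsto_natCast_rpow (ha.trans hab)) ?_
  refine (tendsto_natCast_rpow_neg (sub_neg.2 hab)).congr' ?_
  filter_upwards [eventually_gt_atTop 0] with n hn
  exact Real.rpow_sub (Nat.cast_pos.2 hn) a b

namespace IsTypeIField

variable (hY : IsTypeIField P Y g H₁ H₂ c)
include hY

lemma tendsto_cov_plane (hγ0 : 0 < γ) (hγ : PlaneCase H₁ H₂ γ) {p q : ℝ × ℝ}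
    (hp : p ∈ closedQuadrant) (hq : q ∈ closedQuadrant) :
    Tendsto (fun n => ∫ ω, normalizedSum Y γ (scalingExponent H₁ H₂ γ) n p ω *
        normalizedSum Y γ (scalingExponent H₁ H₂ γ) n q ω ∂P) atTop
      (𝓝 (g (0, 0) * covOf (limitVariogram H₁ H₂ c γ) p q)) := by
  have h := hY.parameters
  have hr := h.ratio_pos
  have h0 := h.pos
  have h2 := h.pos₂
  refine hY.tendsto_cov_of_scaling (t := planeExponent H₁ H₂ γ) (w := planeWeight H₁ H₂ c γ)
    dirichletScaling_natCast (dirichletScaling_rpow hγ0) (fun u => by positivity)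
    (fun u => by positivity) ?_ (fun u v hu hv => h.tendsto_hFun_planeWeight hu hv)
    (fun n _ u v hu hv => h.hFun_le_planeWeight n hu hv)
    (h.integrable_inv_mul_planeWeight hγ) hp hq ?_
  · rw [two_mul_scalingExponent_of_plane h.pos h.pos₂ hγ, planeExponent]
    split_ifs
    · ring
    · field_simp; ring
  · have := integral_planeKernel_mul_conj_re Parameters.measurable_planeWeight.sqrt
      (fun q => Real.sq_sqrt (h.planeWeight_nonneg (γ := γ) q)) Parameters.planeWeight_neg_left
      (h.integrable_planeWeight hγ) p q
    simp only [h.integral_planeWeight hγ] at this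
    rw [← this]
    congr 1
    refine integral_congr_ae (Eventually.of_forall fun e => ?_)
    have hsq : (planeWeight H₁ H₂ c γ e : ℂ) =
        (√(planeWeight H₁ H₂ c γ e) : ℂ) * (√(planeWeight H₁ H₂ c γ e) : ℂ) := by
      rw [← Complex.ofReal_mul, Real.mul_self_sqrt (h.planeWeight_nonneg e)]
    simp only [planeKernel, map_mul, map_neg, Complex.conj_ofReal]
    rw [hsq]
    ring

/-- With `R₁ = n^{γ/γ₀}`, much larger than `n`, and `R₂ = n^γ`, the scaling of `h` is exact, so the
rescaled density does not depend on `n`. The first Dirichlet sum degenerates to `x`. -/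
lemma tendsto_cov_left (hγ : H₁ / H₂ < γ) (h1 : ¬H₁ < 1) {p q : ℝ × ℝ}
    (hp : p ∈ closedQuadrant) (hq : q ∈ closedQuadrant) :
    Tendsto (fun n => ∫ ω, normalizedSum Y γ (scalingExponent H₁ H₂ γ) n p ω *
        normalizedSum Y γ (scalingExponent H₁ H₂ γ) n q ω ∂P) atTop
      (𝓝 (g (0, 0) * covOf (limitVariogram H₁ H₂ c γ) p q)) := by
  have h := hY.parameters
  have hr := h.ratio_pos
  have hc := h.c_pos
  have h0 := h.pos
  have h2 := h.pos₂
  have hH₁ := h.one_lt₁ h1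
  have he := h.exponent₁_mem h1
  have hb : γ / (H₁ / H₂) * (H₁ / H₂) - γ = 0 := by rw [div_mul_cancel₀ _ hr.ne', sub_self]
  have ha : 1 < γ / (H₁ / H₂) := (one_lt_div hr).2 hγ
  have hint := integrable_inv_snd_mul_hFun hH₁ h.lt_two₁ h.pos₂ h.lt_two h.c_pos
  refine hY.tendsto_cov_of_scaling (a := γ / (H₁ / H₂)) (b := γ) (t := γ / (H₁ / H₂))
    (w := hFun H₁ H₂ c) (by simpa using dirichletScaling_rpow_lt one_pos ha)
    (dirichletScaling_rpow (hr.trans hγ)) (fun u => zero_le_one) (fun u => by positivity) ?_ ?_ ?_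
    (by simpa using hint) hp hq ?_
  · rw [scalingExponent, if_pos hγ.le, if_neg h1]
    field_simp
    ring
  · intro u v _ _
    simp only [hb, sub_self, Real.rpow_zero, mul_one]
    exact tendsto_const_nhds
  · intro n _ u v _ _
    simp only [hb, sub_self, Real.rpow_zero, mul_one, le_refl]
  · have hre := integral_lineKernel_mul_conj_re
      (s := fun v => |v| ^ (-(H₁ * H₂ - H₂) / (2 * H₁))) (by fun_prop)
      (fun v => abs_rpow_sq v (b := -((H₁ * H₂ - H₂) / H₁)) (by field_simp))
      (fun y => integrable_sqKernel_mul_rpow y he.1.le he.2) (rho₁ H₁ * c ^ ((1 - H₁) / 4)) p q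
    simp only [h.lineVariogram_left hγ h1] at hre
    rw [← hre]
    congr 1
    -- Nothing but `h` depends on `u`, so integrating `u` out first leaves the marginal of `h`,
    -- which is the squared weight of the line kernel.
    rw [Measure.volume_eq_prod, integral_prod_symm]
    · refine integral_congr_ae ?_
      filter_upwards [Measure.ae_ne volume (0 : ℝ)] with v hv
      rw [integral_const_mul, integral_complex_ofReal, integral_hFun_left hH₁ hc hv,
        ← abs_rpow_sq v (a := -(H₁ * H₂ - H₂) / (2 * H₁)) (by field_simp)]
      simp only [lineKernel, map_mul, map_neg, Complex.conj_ofReal]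
      push_cast
      ring
    · rw [← Measure.volume_eq_prod]
      refine (hint.const_mul (|p.1| * |q.1| * (p.2 ^ 2 + 4 + (q.2 ^ 2 + 4)))).mono' ?_
        (Eventually.of_forall fun e => ?_)
      · have := measurable_hFun (H₁ := H₁) (H₂ := H₂) (c := c)
        have m1 : Measurable fun e : ℝ × ℝ => (p.1 : ℂ) * -expKernel p.2 e.2 := by fun_prop
        have m2 : Measurable fun e : ℝ × ℝ => (q.1 : ℂ) * -expKernel q.2 e.2 := by fun_prop
        exact ((m1.mul (Complex.continuous_conj.measurable.comp m2)).mul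
          (Complex.measurable_ofReal.comp this)).aestronglyMeasurable
      · have := norm_expKernel_mul_le p.2 q.2 e.2
        have hh := hFun_nonneg (H₁ := H₁) (H₂ := H₂) hc e
        rw [norm_mul, norm_mul, RCLike.norm_conj, norm_mul, norm_mul, norm_neg, norm_neg,
          Complex.norm_real, Complex.norm_real, Complex.norm_real, Real.norm_of_nonneg hh,
          Real.norm_eq_abs, Real.norm_eq_abs]
        calc _ = |p.1| * |q.1| * (‖expKernel p.2 e.2‖ * ‖expKernel q.2 e.2‖) * hFun H₁ H₂ c e := by
              ring
          _ ≤ |p.1| * |q.1| * ((p.2 ^ 2 + 4 + (q.2 ^ 2 + 4)) * (1 + e.2 ^ 2)⁻¹) *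
              hFun H₁ H₂ c e := by gcongr
          _ = _ := by ring

/-- The mirror image: `R₁ = n` and `R₂ = n^{γ₀}`, much larger than `n^γ`, so the second Dirichlet
sum degenerates to `y` and `v` is integrated out. -/
lemma tendsto_cov_right (hγ0 : 0 < γ) (hγ : γ < H₁ / H₂) (h1 : ¬H₂ < 1) {p q : ℝ × ℝ}
    (hp : p ∈ closedQuadrant) (hq : q ∈ closedQuadrant) :
    Tendsto (fun n => ∫ ω, normalizedSum Y γ (scalingExponent H₁ H₂ γ) n p ω *
        normalizedSum Y γ (scalingExponent H₁ H₂ γ) n q ω ∂P) atTop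
      (𝓝 (g (0, 0) * covOf (limitVariogram H₁ H₂ c γ) p q)) := by
  have h := hY.parameters
  have hr := h.ratio_pos
  have hc := h.c_pos
  have h0 := h.pos
  have h2 := h.pos₂
  have hH₂ := h.one_lt₂ h1
  have he := h.exponent₂_mem h1
  have hint := integrable_inv_fst_mul_hFun h.pos h.lt_two₁ hH₂ h.lt_two h.c_pos
  refine hY.tendsto_cov_of_scaling (b := H₁ / H₂) (t := 1)
    (w := hFun H₁ H₂ c) dirichletScaling_natCast
    (dirichletScaling_rpow_lt hγ0 hγ) (fun u => by positivity) (fun u => zero_le_one) ?_ ?_ ?_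
    (by simpa using hint) hp hq ?_
  · rw [scalingExponent, if_neg hγ.not_ge, if_neg h1]
    field_simp
    ring
  · intro u v _ _
    simp only [one_mul, sub_self, Real.rpow_zero, mul_one]
    exact tendsto_const_nhds
  · intro n _ u v _ _
    simp only [one_mul, sub_self, Real.rpow_zero, mul_one, le_refl]
  · have hre := integral_lineKernel_mul_conj_re
      (s := fun v => |v| ^ (-(H₁ * H₂ - H₁) / (2 * H₂))) (by fun_prop)
      (fun v => abs_rpow_sq v (b := -((H₁ * H₂ - H₁) / H₂)) (by field_simp))
      (fun y => integrable_sqKernel_mul_rpow y he.1.le he.2) (rho₂ H₁ H₂ * c ^ (-H₁ / (4 * H₂)))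
      p.swap q.swap
    rw [← covOf_swap] at hre
    simp only [h.lineVariogram_right hγ h1] at hre
    rw [← hre]
    congr 1
    rw [Measure.volume_eq_prod, integral_prod]
    · refine integral_congr_ae ?_
      filter_upwards [Measure.ae_ne volume (0 : ℝ)] with v hv
      rw [integral_const_mul, integral_complex_ofReal, integral_hFun_right h0 hH₂ hc hv,
        ← abs_rpow_sq v (a := -(H₁ * H₂ - H₁) / (2 * H₂)) (by field_simp)]
      simp only [lineKernel, map_mul, map_neg, Complex.conj_ofReal, Prod.fst_swap, Prod.snd_swap]
      push_cast
      ring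
    · rw [← Measure.volume_eq_prod]
      refine (hint.const_mul (|p.2| * |q.2| * (p.1 ^ 2 + 4 + (q.1 ^ 2 + 4)))).mono' ?_
        (Eventually.of_forall fun e => ?_)
      · have := measurable_hFun (H₁ := H₁) (H₂ := H₂) (c := c)
        have m1 : Measurable fun e : ℝ × ℝ => -expKernel p.1 e.1 * (p.2 : ℂ) := by fun_prop
        have m2 : Measurable fun e : ℝ × ℝ => -expKernel q.1 e.1 * (q.2 : ℂ) := by fun_prop
        exact ((m1.mul (Complex.continuous_conj.measurable.comp m2)).mul
          (Complex.measurable_ofReal.comp this)).aestronglyMeasurable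
      · have := norm_expKernel_mul_le p.1 q.1 e.1
        have hh := hFun_nonneg (H₁ := H₁) (H₂ := H₂) hc e
        rw [norm_mul, norm_mul, RCLike.norm_conj, norm_mul, norm_mul, norm_neg, norm_neg,
          Complex.norm_real, Complex.norm_real, Complex.norm_real, Real.norm_of_nonneg hh,
          Real.norm_eq_abs, Real.norm_eq_abs]
        calc _ = |p.2| * |q.2| * (‖expKernel p.1 e.1‖ * ‖expKernel q.1 e.1‖) * hFun H₁ H₂ c e := by
              ring
          _ ≤ |p.2| * |q.2| * ((p.1 ^ 2 + 4 + (q.1 ^ 2 + 4)) * (1 + e.1 ^ 2)⁻¹) *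
              hFun H₁ H₂ c e := by gcongr
          _ = _ := by ring

theorem tendsto_cov (hγ0 : 0 < γ) {p q : ℝ × ℝ}
    (hp : p ∈ closedQuadrant) (hq : q ∈ closedQuadrant) :
    Tendsto (fun n => ∫ ω, normalizedSum Y γ (scalingExponent H₁ H₂ γ) n p ω *
        normalizedSum Y γ (scalingExponent H₁ H₂ γ) n q ω ∂P) atTop
      (𝓝 (g (0, 0) * covOf (limitVariogram H₁ H₂ c γ) p q)) := by
  rcases Parameters.cases (H₁ := H₁) (H₂ := H₂) γ with hγ | ⟨hγ, h1⟩ | ⟨hγ, h1⟩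
  · exact hY.tendsto_cov_plane hγ0 hγ hp hq
  · exact hY.tendsto_cov_left hγ h1 hp hq
  · exact hY.tendsto_cov_right hγ0 hγ h1 hp hq

end IsTypeIField

end

section

/-! ### Multiples of fields -/

section Multiple

variable {Ω : Type*} [MeasurableSpace Ω] {P : Measure Ω} {V : ℝ × ℝ → Ω → ℝ} {Φ : ℝ → ℝ → ℝ}

lemma IsVariogramField.const_mul (hV : IsVariogramField P V Φ) (r : ℝ) :
    IsVariogramField P (fun p ω => r * V p ω) (fun x y => r ^ 2 * Φ x y) where
  gaussian p hp := by
    have := (hV.gaussian p hp).fun_smul r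
    simpa [Pi.smul_def] using this
  centered p hp := by rw [integral_const_mul, hV.centered p hp, mul_zero]
  cov p hp q hq := by
    have h1 : covOf (fun x y => r ^ 2 * Φ x y) p q = r ^ 2 * covOf Φ p q := by
      simp only [covOf, polar]; ring
    rw [h1, ← hV.cov p hp q hq, ← integral_const_mul]
    congr 1 with ω
    ring

lemma incr_const_mul {Ω : Type*} (V : ℝ × ℝ → Ω → ℝ) (K : Rect) (r : ℝ) :
    K.incr (fun p ω => r * V p ω) = fun ω => r * K.incr V ω := by
  ext ω
  simp only [Rect.incr, increment]
  ring

lemma IndepIncrementsDir.const_mul {a b : ℝ} (h : IndepIncrementsDir P V a b) (r : ℝ) :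
    IndepIncrementsDir P (fun p ω => r * V p ω) a b := by
  intro a' b' c' hne ho K K' hK hK' hs
  rw [incr_const_mul, incr_const_mul]
  exact (h a' b' c' hne ho K K' hK hK' hs).comp (measurable_const_mul r) (measurable_const_mul r)

lemma InvariantIncrementsDir.const_mul {a b : ℝ} (h : InvariantIncrementsDir P V a b) (r : ℝ) :
    InvariantIncrementsDir P (fun p ω => r * V p ω) a b := by
  intro z w ho K hK hK'
  rw [incr_const_mul, incr_const_mul]
  filter_upwards [h z w ho K hK hK'] with ω hω
  rw [hω]

lemma DependentIncrementsDir.const_mul {a b r : ℝ} (h : DependentIncrementsDir P V a b)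
    (hr : r ≠ 0) : DependentIncrementsDir P (fun p ω => r * V p ω) a b := by
  have e : V = fun p ω => r⁻¹ * (r * V p ω) := by
    funext p ω
    rw [inv_mul_cancel_left₀ hr]
  rw [e] at h
  exact ⟨fun h1 => h.1 (h1.const_mul r⁻¹), fun h1 => h.2 (h1.const_mul r⁻¹)⟩

lemma DependentIncrements.const_mul {r : ℝ} (h : DependentIncrements P V) (hr : r ≠ 0) :
    DependentIncrements P (fun p ω => r * V p ω) := fun a b hab => (h a b hab).const_mul hr

lemma SemiDependentIncrements.const_mul {r : ℝ} (h : SemiDependentIncrements P V) (hr : r ≠ 0) :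
    SemiDependentIncrements P (fun p ω => r * V p ω) := by
  obtain ⟨⟨a, b, hab, h1⟩, ⟨a', b', hab', h2⟩⟩ := h
  exact ⟨⟨a, b, hab, h1.const_mul hr⟩, ⟨a', b', hab', h2.imp (·.const_mul r) (·.const_mul r)⟩⟩

end Multiple

/-! ### Convergence of the normalized sums -/

section Main

variable {H₁ H₂ c γ : ℝ} {Ω Ω' : Type*} [MeasurableSpace Ω] [MeasurableSpace Ω'] {P : Measure Ω}
  {P' : Measure Ω'} {Y : ℤ × ℤ → Ω → ℝ} {g : ℝ × ℝ → ℝ} {V : ℝ × ℝ → Ω' → ℝ}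

lemma isGaussianProcess_normalizedSum (hY : IsGaussianProcess Y P) (γ H : ℝ) (n : ℕ) :
    IsGaussianProcess (normalizedSum Y γ H n) P := by
  refine hY.of_isGaussianProcess fun p => ⟨Finset.Icc (1 : ℤ) ⌊(n : ℝ) * p.1⌋ ×ˢ
    Finset.Icc (1 : ℤ) ⌊(n : ℝ) ^ γ * p.2⌋,
    ((n : ℝ) ^ (-H)) • ∑ e, ContinuousLinearMap.proj e, fun ω => ?_⟩
  simp only [normalizedSum, smul_apply, sum_apply,
    ContinuousLinearMap.proj_apply, smul_eq_mul, Finset.restrict_def]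
  rw [Finset.sum_coe_sort _ (fun e => Y e ω), Finset.sum_product]

lemma hasGaussianLaw_normalizedSum (hY : IsGaussianProcess Y P) (γ H : ℝ) (n : ℕ) {k : ℕ}
    (p : Fin k → ℝ × ℝ) : HasGaussianLaw (fun ω i => normalizedSum Y γ H n (p i) ω) P := by
  refine hasGaussianLaw_pi_of_forall_sum fun a => ?_
  exact (((isGaussianProcess_normalizedSum hY γ H n).comp_right p).smul
    a).hasGaussianLaw_fun_sum (I := Finset.univ)

namespace IsTypeIField

variable (hY : IsTypeIField P Y g H₁ H₂ c)
include hY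

lemma integral_normalizedSum [IsProbabilityMeasure P] (γ H : ℝ) (n : ℕ) (p : ℝ × ℝ) :
    ∫ ω, normalizedSum Y γ H n p ω ∂P = 0 := by
  have hi : ∀ e, Integrable (Y e) P := fun e => (hY.memLp e).integrable (by norm_num)
  simp only [normalizedSum]
  rw [integral_const_mul, integral_finsetSum _ fun t _ => integrable_finsetSum _ fun s _ => hi _]
  simp_rw [integral_finsetSum _ fun s _ => hi (_, s), hY.mean]
  simp

theorem fddTendsto [IsProbabilityMeasure P] [IsProbabilityMeasure P'] (hγ : 0 < γ)
    (hV : IsVariogramField P' V (limitVariogram H₁ H₂ c γ)) :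
    FddTendsto P P' (normalizedSum Y γ (scalingExponent H₁ H₂ γ))
      (fun p ω => √(g (0, 0)) * V p ω) := by
  intro k p hp
  have hp' : ∀ i, p i ∈ closedQuadrant := fun i => ⟨(hp i).1.le, (hp i).2.le⟩
  have hVg := hV.const_mul √(g (0, 0))
  refine tendstoInDistribution_of_tendsto_covariance
    (X := fun n i => normalizedSum Y γ (scalingExponent H₁ H₂ γ) n (p i))
    (Z := fun i ω => √(g (0, 0)) * V (p i) ω)
    (fun n => hasGaussianLaw_normalizedSum hY.gaussian _ _ n p)
    (fun n i => hY.integral_normalizedSum _ _ n _) (hVg.gaussian p hp')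
    (fun i => hVg.centered _ (hp' i)) fun i j => ?_
  rw [hVg.cov _ (hp' i) _ (hp' j), Real.sq_sqrt hY.pos.le]
  have h1 : covOf (fun x y => g (0, 0) * limitVariogram H₁ H₂ c γ x y) (p i) (p j) =
      g (0, 0) * covOf (limitVariogram H₁ H₂ c γ) (p i) (p j) := by
    simp only [covOf, polar]; ring
  rw [h1]
  exact hY.tendsto_cov hγ (hp' i) (hp' j)

theorem hasTypeILRDAt [IsProbabilityMeasure P] : HasTypeILRDAt P Y (H₁ / H₂) := by
  have h := hY.parameters
  have hg : √(g (0, 0)) ≠ 0 := (Real.sqrt_pos.2 hY.pos).ne'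
  refine ⟨h.ratio_pos, hY.stat, fun γ hγ => ⟨scalingExponent H₁ H₂ γ, h.scalingExponent_pos hγ, ?_⟩⟩
  obtain ⟨Ω', _, P', _, W, W₁, hW, hW₁⟩ := exists_noises
  obtain ⟨V, hV⟩ := h.exists_isLimitField hW hW₁ γ
  have hV' := h.isVariogramField hW hW₁ hV
  have hVg := hV'.const_mul √(g (0, 0))
  refine ⟨Ω', inferInstance, P', inferInstance, fun p ω => √(g (0, 0)) * V p ω,
    hY.fddTendsto hγ hV', hVg.stationaryIncrements, hVg.vanishesOnAxes (fun y => ?_) (fun x => ?_),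
    fun he => (h.dependentIncrements he hV').const_mul hg,
    fun he => (h.semiDependentIncrements he hV').const_mul hg⟩
  · rw [(h.limitVariogram_zero γ 0 y).1, mul_zero]
  · rw [(h.limitVariogram_zero γ x 0).2, mul_zero]

end IsTypeIField

end Main

end

end ScalingLimits

theorem mainTheorem3 {Ω : Type*} [MeasurableSpace Ω] (P : MeasureTheory.Measure Ω)
    [MeasureTheory.IsProbabilityMeasure P] (Y : ℤ × ℤ → Ω → ℝ)
    (H₁ H₂ c : ℝ) (g : ℝ × ℝ → ℝ)
    (hH₁ : 0 < H₁) (hH : H₁ ≤ H₂) (hH₂ : H₂ < 2) (hH₁' : H₁ ≠ 1) (hH₂' : H₂ ≠ 1) (hc : 0 < c)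
    (hg_bdd : ∃ C : ℝ, ∀ p ∈ piSquare, |g p| ≤ C)
    (hg_cont : ContinuousAt g (0, 0)) (hg_pos : 0 < g (0, 0))
    (hY_gauss : ProbabilityTheory.IsGaussianProcess Y P)
    (hY_mean : ∀ p, ∫ ω, Y p ω ∂P = 0)
    (hY_stat : IsStationaryField P Y)
    (hY_spec : IsSpectralDensity P Y (typeIDensity g H₁ H₂ c)) :
    -- Gaussian noises as in the definition of the limit fields exist
    (∃ (Ω' : Type) (_ : MeasurableSpace Ω') (P' : MeasureTheory.Measure Ω')
      (_ : MeasureTheory.IsProbabilityMeasure P')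
      (W : FiniteVolumeSet (ℝ × ℝ) → Ω' → ℂ) (W₁ : FiniteVolumeSet ℝ → Ω' → ℂ),
      IsGaussianNoise P' W ∧ IsGaussianNoise P' W₁) ∧
    -- for any such noises and any `γ > 0`, the limit field is well defined, is a Gaussian
    -- operator scaling field, and is the limit of the normalized partial sums
    (∀ (Ω' : Type*) [MeasurableSpace Ω'] (P' : MeasureTheory.Measure Ω')
      [MeasureTheory.IsProbabilityMeasure P']
      (W : FiniteVolumeSet (ℝ × ℝ) → Ω' → ℂ) (W₁ : FiniteVolumeSet ℝ → Ω' → ℂ),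
      IsGaussianNoise P' W → IsGaussianNoise P' W₁ → ∀ γ : ℝ, 0 < γ →
        (∃ V : ℝ × ℝ → Ω' → ℝ, IsLimitField H₁ H₂ c γ P' W W₁ V) ∧
        ∀ V : ℝ × ℝ → Ω' → ℝ, IsLimitField H₁ H₂ c γ P' W W₁ V →
          ProbabilityTheory.IsGaussianProcess (fun p : closedQuadrant => V p) P' ∧
          OperatorScaling P' V γ (scalingExponent H₁ H₂ γ) ∧
          FddTendsto P P' (normalizedSum Y γ (scalingExponent H₁ H₂ γ))
            (fun p ω => √(g (0, 0)) * V p ω)) ∧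
    (H₁ = H₂ → HasTypeIIsotropicLRD P Y) ∧
    (H₁ < H₂ → HasTypeIAnisotropicLRD P Y) := by
  have hpar : Parameters H₁ H₂ c := ⟨hH₁, hH, hH₂, hH₁', hH₂', hc⟩
  have hY : IsTypeIField P Y g H₁ H₂ c :=
    ⟨hpar, hg_bdd, hg_cont, hg_pos, hY_gauss, hY_mean, hY_stat, hY_spec⟩
  refine ⟨exists_noises, ?_, fun h => ⟨H₁ / H₂, ?_, hY.hasTypeILRDAt⟩,
    fun h => ⟨H₁ / H₂, ?_, hY.hasTypeILRDAt⟩⟩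
  · intro Ω' _ P' _ W W₁ hW hW₁ γ hγ
    refine ⟨hpar.exists_isLimitField hW hW₁ γ, fun V hV => ?_⟩
    have hV' := hpar.isVariogramField hW hW₁ hV
    exact ⟨hV'.isGaussianProcess,
      hV'.operatorScaling fun l hl x y => hpar.limitVariogram_scale hl x y, hY.fddTendsto hγ hV'⟩
  · rw [h, div_self (hH₁.trans_le hH).ne']
  · exact ((div_lt_one (hH₁.trans_le hH)).2 h).ne
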